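/- Let $m,n\ge 1$ be integers, let $\lambda>1$, and let $B_1\in\mathbb R^{n\times m}$, $B_2\in\mathbb R^{n\times n}$ satisfy $\operatorname{rank}[B_1,B_2B_1,\dots,B_2^{n-1}B_1]=n$. There is a constant $c_0\in(0,1)$, depending only on $\lambda,m,n,B_1,B_2$, with the following property. Let $T>0$. Let $A=(a_{ij})_{1\le i,j\le m}$, $c$ and $d=(d_1,\dots,d_m)$ be real-valued functions of $(t,v)\in(0,T)\times\mathbb R^m$, with $c,d$ measurable, $A$ symmetric, each $a_{ij}$ Lipschitz continuous on $(0,T)\times\mathbb R^m$, $$\lambda^{-1}|\xi|^2\le\sum_{i,j=1}^m a_{ij}(t,v)\xi_i\xi_j\le\lambda|\xi|^2\qquad\text{for all }(t,v)\in(0,T)\times\mathbb R^m,\ \xi\in\mathbb R^m,$$ and, for all $i,j$ and almost every $(t,v)\in(0,T)\times\mathbb R^m$, $$|\partial_t a_{ij}(t,v)|+|\nabla_v a_{ij}(t,v)|+|c(t,v)|+|d(t,v)|\le\lambda .$$ Let $Y=\partial_t+(B_1v+B_2w)\cdot\nabla_w$, and let $u:(0,T)\times\mathbb R^m\times\mathbb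 R^n\to\mathbb C$ (in particular, $u$ may be real-valued) be such that $u$ and the distributional derivatives $\nabla_vu$ and $Yu$ belong to $L^2((0,T)\times\mathbb R^m\times\mathbb R^n)$, $$Yu+\operatorname{div}_v\big(A(t,v)\nabla_vu\big)=c(t,v)\,u+d(t,v)\cdot\nabla_vu$$ in the sense of distributions on $(0,T)\times\mathbb R^m\times\mathbb R^n$, and $u$ has zero $L^2(\mathbb R^m\times\mathbb R^n)$-trace at $t=0$, i.e. $\operatorname{ess\,lim}_{t\to0^+}\|u(t,\cdot,\cdot)\|_{L^2(\mathbb R^m\times\mathbb R^n)}=0$. Let $$0<t_1<t_2<\min\{c_0\lambda^{-2},T\}.$$ Then $u=0$ almost everywhere on $(0,t_1)\times\mathbb R^m\times\mathbb R^n$. -/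

import Mathlib

open MeasureTheory Set
open scoped ENNReal NNReal Distributions

namespace Ultraparabolic

/-- The space `ℝ × ℝ^m × ℝ^n` of points `z = (t, v, w)`: `t = z.1`, `v = z.2.1`, `w = z.2.2`. -/
abbrev Pt (m n : ℕ) : Type :=
  ℝ × EuclideanSpace ℝ (Fin m) × EuclideanSpace ℝ (Fin n)

/-- The open set `(0, T) × ℝ^m × ℝ^n`. -/
def slab (m n : ℕ) (T : ℝ) : TopologicalSpace.Opens (Pt m n) :=
  ⟨Ioo 0 T ×ˢ univ, isOpen_Ioo.prod isOpen_univ⟩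

/-- The set `(0, T) × ℝ^m` on which the coefficients live. -/
def coeffDomain (m : ℕ) (T : ℝ) : Set (ℝ × EuclideanSpace ℝ (Fin m)) :=
  Ioo 0 T ×ˢ univ

/-- The condition `rank [B₁, B₂ B₁, …, B₂ ^ (n - 1) B₁] = n`. The block matrix has its columns
indexed by pairs `(k, j)`: the block number `k < n` and the column `j` inside the block. -/
def KalmanRankCondition {m n : ℕ} (B₁ : Matrix (Fin n) (Fin m) ℝ) (B₂ : Matrix (Fin n) (Fin n) ℝ) :
    Prop :=
  (Matrix.of fun (i : Fin n) (q : Fin n × Fin m) => (B₂ ^ (q.1 : ℕ) * B₁) i q.2).rank = n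

/-- The assumptions on the diffusion matrix `A` and on the lower order coefficients `c`, `d`, all
functions of `(t, v) ∈ (0, T) × ℝ^m`. -/
structure CoeffHyp {m : ℕ} (lam T : ℝ)
    (A : ℝ × EuclideanSpace ℝ (Fin m) → Matrix (Fin m) (Fin m) ℝ)
    (c : ℝ × EuclideanSpace ℝ (Fin m) → ℝ)
    (d : ℝ × EuclideanSpace ℝ (Fin m) → EuclideanSpace ℝ (Fin m)) : Prop where
  symm : ∀ p ∈ coeffDomain m T, (A p).IsSymm
  lipschitz : ∀ i j, ∃ K : ℝ≥0, LipschitzOnWith K (fun p => A p i j) (coeffDomain m T)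
  elliptic : ∀ p ∈ coeffDomain m T, ∀ ξ : EuclideanSpace ℝ (Fin m),
    lam⁻¹ * ‖ξ‖ ^ 2 ≤ ∑ i, ∑ j, A p i j * ξ i * ξ j ∧
      ∑ i, ∑ j, A p i j * ξ i * ξ j ≤ lam * ‖ξ‖ ^ 2
  aestronglyMeasurable_c : AEStronglyMeasurable c (volume.restrict (coeffDomain m T))
  aestronglyMeasurable_d : AEStronglyMeasurable d (volume.restrict (coeffDomain m T))
  /-- `|∂ₜ aᵢⱼ| + |∇ᵥ aᵢⱼ| + |c| + |d| ≤ lam`. The derivatives of the Lipschitz functions `aᵢⱼ`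
  exist almost everywhere. The norm of the differential in `v` is the Euclidean norm of the
  gradient. -/
  bound : ∀ i j, ∀ᵐ p ∂(volume.restrict (coeffDomain m T)),
    |deriv (fun s : ℝ => A (s, p.2) i j) p.1|
      + ‖fderiv ℝ (fun v : EuclideanSpace ℝ (Fin m) => A (p.1, v) i j) p.2‖
      + |c p| + ‖d p‖ ≤ lam

/-- The classical derivative `∂φ/∂v_i`. -/
noncomputable def dv {m n : ℕ} (φ : Pt m n → ℝ) (i : Fin m) (z : Pt m n) : ℝ :=
  fderiv ℝ φ z (0, EuclideanSpace.single i 1, 0)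

/-- The classical derivative `Y φ = ∂ₜ φ + (B₁ v + B₂ w) · ∇_w φ`. -/
noncomputable def dY {m n : ℕ} (B₁ : Matrix (Fin n) (Fin m) ℝ) (B₂ : Matrix (Fin n) (Fin n) ℝ)
    (φ : Pt m n → ℝ) (z : Pt m n) : ℝ :=
  fderiv ℝ φ z (1, 0, Matrix.toEuclideanLin B₁ z.2.1 + Matrix.toEuclideanLin B₂ z.2.2)

/-- `G = ∇ᵥ u` in the sense of distributions on `(0, T) × ℝ^m × ℝ^n`. -/
def HasWeakGradV {m n : ℕ} (T : ℝ) (u : Pt m n → ℂ) (G : Pt m n → EuclideanSpace ℂ (Fin m)) :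
    Prop :=
  ∀ φ : 𝓓(slab m n T, ℝ), ∀ i : Fin m,
    ∫ z in (slab m n T : Set (Pt m n)), dv φ i z • u z
      = -∫ z in (slab m n T : Set (Pt m n)), φ z • G z i

/-- `f = (∂ₜ + (B₁ v + B₂ w) · ∇_w) u` in the sense of distributions on `(0, T) × ℝ^m × ℝ^n`.
The divergence of the field `(1, 0, B₁ v + B₂ w)` is `tr B₂`, so the formal adjoint of `Y` is
`φ ↦ -(Y φ + (tr B₂) φ)`. -/
def HasWeakY {m n : ℕ} (T : ℝ) (B₁ : Matrix (Fin n) (Fin m) ℝ) (B₂ : Matrix (Fin n) (Fin n) ℝ)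
    (u f : Pt m n → ℂ) : Prop :=
  ∀ φ : 𝓓(slab m n T, ℝ),
    ∫ z in (slab m n T : Set (Pt m n)), (dY B₁ B₂ φ z + B₂.trace * φ z) • u z
      = -∫ z in (slab m n T : Set (Pt m n)), φ z • f z

/-- `u` has zero `L²(ℝ^m × ℝ^n)`-trace at `t = 0`: the norm of `u(t, ·)` in `L²(ℝ^m × ℝ^n)` tends
to `0` as `t → 0+`, up to a null set of times. -/
def HasZeroInitialTrace {m n : ℕ} (u : Pt m n → ℂ) : Prop :=
  ∀ ε : ℝ≥0∞, 0 < ε → ∃ δ : ℝ, 0 < δ ∧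
    ∀ᵐ t ∂(volume.restrict (Ioo 0 δ)),
      eLpNorm (fun y : EuclideanSpace ℝ (Fin m) × EuclideanSpace ℝ (Fin n) => u (t, y)) 2 volume
        ≤ ε

/-- `u`, `∇ᵥ u` and `Y u` are in `L²((0, T) × ℝ^m × ℝ^n)`, the equation
`Y u + div_v (A ∇ᵥ u) = c u + d · ∇ᵥ u` holds in the sense of distributions on
`(0, T) × ℝ^m × ℝ^n`, and `u` has zero trace at `t = 0`. The weak derivatives `G = ∇ᵥ u` and
`f = Y u` are unique up to null sets. -/
structure IsWeakSolution {m n : ℕ} (T : ℝ)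
    (B₁ : Matrix (Fin n) (Fin m) ℝ) (B₂ : Matrix (Fin n) (Fin n) ℝ)
    (A : ℝ × EuclideanSpace ℝ (Fin m) → Matrix (Fin m) (Fin m) ℝ)
    (c : ℝ × EuclideanSpace ℝ (Fin m) → ℝ)
    (d : ℝ × EuclideanSpace ℝ (Fin m) → EuclideanSpace ℝ (Fin m))
    (u : Pt m n → ℂ) : Prop where
  memLp : MemLp u 2 (volume.restrict (slab m n T : Set (Pt m n)))
  equation : ∃ (G : Pt m n → EuclideanSpace ℂ (Fin m)) (f : Pt m n → ℂ),
    MemLp G 2 (volume.restrict (slab m n T : Set (Pt m n))) ∧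
    MemLp f 2 (volume.restrict (slab m n T : Set (Pt m n))) ∧
    HasWeakGradV T u G ∧
    HasWeakY T B₁ B₂ u f ∧
    ∀ φ : 𝓓(slab m n T, ℝ),
      (∫ z in (slab m n T : Set (Pt m n)),
        (φ z • f z - ∑ i, ∑ j, (A (z.1, z.2.1) i j * dv φ i z) • G z j))
      = ∫ z in (slab m n T : Set (Pt m n)),
        φ z • (c (z.1, z.2.1) • u z + ∑ i, d (z.1, z.2.1) i • G z i)
  trace_zero : HasZeroInitialTrace u

end Ultraparabolic

/-!
Backward uniqueness for `Y u + div_v (A ∇_v u) = c u + d · ∇_v u` with zero data at `t = 0`.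

*Straightening the drift.* Let `M (v, w) = (0, B₁ v + B₂ w)`. In the coordinates `(t, x)` with
`(v, w) = exp (t M) x` the field `Y` becomes `∂_t`, up to a constant zeroth order term, and `∂_{v_i}`
becomes `D_i = ∂_{v_i} + q_i(t) · ∂_y`. Since `M` maps into the second factor, the flow leaves `v`
unchanged, so the coefficients are still functions of `(t, v)`; in particular nothing depends on
`y`. Because the trace at `t = 0` vanishes, `θ(t) u` may be extended by zero to `t ≤ 0` for every
smooth `θ` that vanishes near `t = T`; this gives an equation on the whole space
(`IsFlatSolution`), obtained in `IsRealSolution.isFlatSolution` for the real and imaginary parts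
of `u`.

*Band-limited averages.* The fields `D_i` depend on `t`, so the commutator of `∂_t` with the second
order operator contains `y`-derivatives of `u`, which are not controlled by the equation. But the
equation commutes with translations in `y`, hence with averaging in `y` against an integrable
kernel `K`. If the Fourier transform of `K` has compact support, then `K' ⋆ K = K` for a smooth `K'`
(`exists_reproducing_kernel`), and the `y`-derivatives of an average are bounded by the average
itself (`exists_weakDeriv_avg`). The bound depends on the scale of `K`, which is harmless: the
estimate is used for each scale separately.

*Carleman estimate.* For an average `w` of `θ u` with the weight `exp ((s / γ) exp (-γ t))` contained
in `θ`, the conjugated equation is `∂_t w + p w + L = g` with `p = s exp (-γ t)`. Expanding `‖g‖²` and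
dropping squares leaves the term `2 ⟪∂_t w, p w⟫ = γ ⟪p w, w⟫`, against which the commutator term
`2 ⟪∂_t w, L⟫` (`IsElliptic.abs_inner_deriv_le`) and the lower order terms are absorbed, once `γ` and
then `s` are large (`exists_carleman`). Letting `s → ∞` shows that the average of `u` vanishes for
`t < t₁` (`IsFlatSolution.mulL_cut_eq_zero`), and letting the scale of `K` tend to zero gives `u = 0`
there.

Weak derivatives are treated as relations between elements of the Hilbert space `L²`: `WeakDeriv`
and `WeakDiv`. The tool that replaces smoothness is `WeakDiv.inner_eq`, integration by parts against
every `L²` function whose weak derivatives are in `L²`.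
-/

namespace Ultraparabolic

open Filter Topology
open scoped RealInnerProductSpace ContDiff
set_option linter.unusedSectionVars false

/-! ### Test functions -/

section TestFunctions

variable {P : Type*} [NormedAddCommGroup P] [NormedSpace ℝ P]

/-- A test function: smooth with compact support. -/
def IsTest (ψ : P → ℝ) : Prop := ContDiff ℝ ∞ ψ ∧ HasCompactSupport ψ

theorem IsTest.differentiable {ψ : P → ℝ} (h : IsTest ψ) : Differentiable ℝ ψ :=
  h.1.differentiable (by simp)

theorem IsTest.fderiv_apply {ψ : P → ℝ} (h : IsTest ψ) (e : P) :
    IsTest (fun z => fderiv ℝ ψ z e) :=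
  ⟨(h.1.fderiv_right (m := ∞) le_rfl).clm_apply contDiff_const, h.2.fderiv_apply ℝ e⟩

theorem IsTest.mul_left {ψ b : P → ℝ} (h : IsTest ψ) (hb : ContDiff ℝ ∞ b) :
    IsTest (fun z => b z * ψ z) :=
  ⟨hb.mul h.1, h.2.mul_left⟩

theorem IsTest.comp_add {ψ : P → ℝ} (h : IsTest ψ) (a : P) : IsTest (fun z => ψ (z + a)) :=
  ⟨h.1.comp (contDiff_id.add contDiff_const), h.2.comp_homeomorph (Homeomorph.addRight a)⟩

end TestFunctions

/-! ### Translations and test functions in `L²` -/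

section Translation

variable {P : Type*} [NormedAddCommGroup P] [NormedSpace ℝ P] [FiniteDimensional ℝ P]
  [MeasurableSpace P] [BorelSpace P] {μ : Measure P} [μ.IsAddHaarMeasure]

/-- The class in `L²(μ)` of a square integrable function; the junk value is `0`. -/
noncomputable def toL2 {Q : Type*} [MeasurableSpace Q] (μ : Measure Q) (g : Q → ℝ) : Lp ℝ 2 μ :=
  open Classical in if h : MemLp g 2 μ then h.toLp g else 0

theorem coeFn_toL2 {Q : Type*} [MeasurableSpace Q] {μ : Measure Q} {g : Q → ℝ}
    (h : MemLp g 2 μ) : toL2 μ g =ᵐ[μ] g := by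
  rw [toL2, dif_pos h]; exact h.coeFn_toLp

theorem inner_eq_integral {Q : Type*} [MeasurableSpace Q] {μ : Measure Q} (f g : Lp ℝ 2 μ) :
    ⟪f, g⟫ = ∫ z, f z * g z ∂μ := by
  rw [L2.inner_def]
  exact integral_congr_ae (Eventually.of_forall fun z => by simp [mul_comm])

theorem integrable_mul_L2 {Q : Type*} [MeasurableSpace Q] {μ : Measure Q} (f g : Lp ℝ 2 μ) :
    Integrable (fun z => f z * g z) μ :=
  (Lp.memLp f).integrable_mul (Lp.memLp g)

theorem inner_toL2 {Q : Type*} [MeasurableSpace Q] {μ : Measure Q} {g : Q → ℝ}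
    (h : MemLp g 2 μ) (f : Lp ℝ 2 μ) :
    ⟪toL2 μ g, f⟫ = ∫ z, g z * f z ∂μ := by
  rw [inner_eq_integral]
  refine integral_congr_ae ?_
  filter_upwards [coeFn_toL2 h] with z hz
  rw [hz]

theorem toL2_congr {Q : Type*} [MeasurableSpace Q] {μ : Measure Q} {g : Q → ℝ} {f : Lp ℝ 2 μ}
    (h : f =ᵐ[μ] g) : toL2 μ g = f := by
  have hm : MemLp g 2 μ := (memLp_congr_ae h).1 (Lp.memLp f)
  exact Lp.ext ((coeFn_toL2 hm).trans h.symm)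

/-- Translation `f ↦ f (· + a)` on `L²`. -/
noncomputable def translate (μ : Measure P) [μ.IsAddHaarMeasure] (a : P) :
    Lp ℝ 2 μ →ₗᵢ[ℝ] Lp ℝ 2 μ :=
  Lp.compMeasurePreservingₗᵢ ℝ (fun z => z + a) (measurePreserving_add_right μ a)

theorem coeFn_translate (a : P) (f : Lp ℝ 2 μ) :
    translate μ a f =ᵐ[μ] fun z => f (z + a) :=
  Lp.coeFn_compMeasurePreserving f (measurePreserving_add_right μ a)

theorem ae_translate {p : P → Prop} (a : P) (h : ∀ᵐ z ∂μ, p z) : ∀ᵐ z ∂μ, p (z + a) :=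
  (measurePreserving_add_right μ a).quasiMeasurePreserving.ae h

theorem translate_translate (a b : P) (f : Lp ℝ 2 μ) :
    translate μ a (translate μ b f) = translate μ (a + b) f := by
  apply Lp.ext
  filter_upwards [coeFn_translate a (translate μ b f), coeFn_translate (a + b) f,
    ae_translate a (coeFn_translate b f)] with z h1 h2 h3
  rw [h1, h2, h3, add_assoc]

theorem translate_zero (f : Lp ℝ 2 μ) : translate μ 0 f = f := by
  apply Lp.ext
  filter_upwards [coeFn_translate 0 f] with z h1
  rw [h1, add_zero]

theorem inner_translate (a : P) (f g : Lp ℝ 2 μ) :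
    ⟪translate μ a f, g⟫ = ⟪f, translate μ (-a) g⟫ := by
  rw [← (translate μ a).inner_map_map f, translate_translate, add_neg_cancel, translate_zero]

theorem inner_translate_right (a : P) (f g : Lp ℝ 2 μ) :
    ⟪f, translate μ a g⟫ = ⟪translate μ (-a) f, g⟫ := by
  rw [inner_translate, neg_neg]

theorem continuous_translate (f : Lp ℝ 2 μ) : Continuous fun a => translate μ a f := by
  refine Continuous.compMeasurePreservingLp (f := fun _ => f)
    (g := fun a : P => ⟨fun z => z + a, by fun_prop⟩) continuous_const ?_
    (fun a => measurePreserving_add_right μ a) (by norm_num)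
  exact ContinuousMap.continuous_of_continuous_uncurry _ (by simp only [Function.uncurry_def, ContinuousMap.coe_mk]; fun_prop)

theorem IsTest.memLp {ψ : P → ℝ} (h : IsTest ψ) : MemLp ψ 2 μ :=
  h.1.continuous.memLp_of_hasCompactSupport h.2

theorem translate_toL2 {g : P → ℝ} (h : MemLp g 2 μ) (a : P) :
    translate μ a (toL2 μ g) = toL2 μ (fun z => g (z + a)) := by
  symm
  apply toL2_congr
  filter_upwards [coeFn_translate a (toL2 μ g), ae_translate a (coeFn_toL2 h)] with z h1 h2
  rw [h1, h2]

/-- Regularizations are differentiable, and the derivative falls on the test function. -/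
theorem IsTest.hasDerivAt_inner_translate {ψ : P → ℝ} (h : IsTest ψ) (f : Lp ℝ 2 μ) (a e : P) :
    HasLineDerivAt ℝ (fun z => ⟪toL2 μ ψ, translate μ z f⟫)
      (-⟪toL2 μ (fun z => fderiv ℝ ψ z e), translate μ a f⟫) a e := by
  have hval : ∀ (φ : P → ℝ), IsTest φ → ∀ z, ⟪toL2 μ φ, translate μ z f⟫ =
      ∫ x, f x * φ (x - z) ∂μ := by
    intro φ hφ z
    rw [inner_translate_right, translate_toL2 hφ.memLp, inner_toL2 (hφ.comp_add (-z)).memLp]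
    simp only [mul_comm, sub_eq_add_neg]
  set g : P → ℝ := fun x => ψ (-x) with hg
  have hgd : ContDiff ℝ 1 g := (h.1.comp contDiff_neg).of_le (by exact_mod_cast le_top)
  have hgc : HasCompactSupport g := h.2.comp_homeomorph (Homeomorph.neg P)
  have hf : LocallyIntegrable f μ := (Lp.memLp f).locallyIntegrable (by norm_num)
  have key := hgc.hasFDerivAt_convolution_right (ContinuousLinearMap.mul ℝ ℝ) hf hgd a
  have h1 : (fun z => ⟪toL2 μ ψ, translate μ z f⟫) =
      convolution f g (ContinuousLinearMap.mul ℝ ℝ) μ := by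
    ext z
    rw [hval ψ h, convolution_def]
    simp [hg]
  rw [h1]
  have h2 := key.hasLineDerivAt e
  rw [convolution_precompR_apply _ hf (hgc.fderiv ℝ) (hgd.continuous_fderiv one_ne_zero)] at h2
  convert h2 using 1
  rw [hval _ (h.fderiv_apply e), convolution_def, ← integral_neg]
  refine integral_congr_ae (Eventually.of_forall fun x => ?_)
  have : fderiv ℝ g (a - x) = -fderiv ℝ ψ (x - a) := by
    have := (h.differentiable (-(a - x))).hasFDerivAt.comp (a - x) (hasFDerivAt_id (𝕜 := ℝ) (a - x)).neg
    rw [show g = ψ ∘ fun y => -y from rfl]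
    erw [this.fderiv]
    ext v
    simp
  simp [this]

end Translation

/-! ### Multiplication operators -/

section Multiplication

variable {Q : Type*} [MeasurableSpace Q] {μ : Measure Q}

/-- Bounded measurable functions, the symbols of the multiplication operators `mulL`. -/
def BddMeas (b : Q → ℝ) : Prop := Measurable b ∧ ∃ C, ∀ z, |b z| ≤ C

theorem BddMeas.memLp_mul {b : Q → ℝ} (hb : BddMeas b) {f : Q → ℝ} (hf : MemLp f 2 μ) :
    MemLp (fun z => b z * f z) 2 μ := by
  obtain ⟨C, hC⟩ := hb.2
  refine hf.of_le_mul (c := C) (hb.1.aestronglyMeasurable.mul hf.1) (Eventually.of_forall fun z => ?_)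
  rw [norm_mul]
  exact mul_le_mul_of_nonneg_right (hC z) (norm_nonneg _)

theorem norm_le_mul_of_ae {C : ℝ} {f g : Lp ℝ 2 μ} (hC : ∀ᵐ z ∂μ, |f z| ≤ C * |g z|) :
    ‖f‖ ≤ C * ‖g‖ := Lp.norm_le_mul_norm_of_ae_le_mul hC

/-- Multiplication by a bounded measurable function as an operator on `L²`; the junk value
is `0`. -/
noncomputable def mulL (μ : Measure Q) (b : Q → ℝ) : Lp ℝ 2 μ →L[ℝ] Lp ℝ 2 μ :=
  open Classical in
  if h : BddMeas b then
    LinearMap.mkContinuous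
      { toFun := fun f => (h.memLp_mul (Lp.memLp f)).toLp _
        map_add' := fun f g => by
          apply Lp.ext
          filter_upwards [(h.memLp_mul (Lp.memLp (f + g))).coeFn_toLp,
            (h.memLp_mul (Lp.memLp f)).coeFn_toLp, (h.memLp_mul (Lp.memLp g)).coeFn_toLp,
            Lp.coeFn_add f g, Lp.coeFn_add ((h.memLp_mul (Lp.memLp f)).toLp _)
              ((h.memLp_mul (Lp.memLp g)).toLp _)] with z h1 h2 h3 h4 h5
          rw [h1, h5, Pi.add_apply, h2, h3, h4, Pi.add_apply, mul_add]
        map_smul' := fun c f => by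
          apply Lp.ext
          filter_upwards [(h.memLp_mul (Lp.memLp (c • f))).coeFn_toLp,
            (h.memLp_mul (Lp.memLp f)).coeFn_toLp,
            Lp.coeFn_smul c f, Lp.coeFn_smul c ((h.memLp_mul (Lp.memLp f)).toLp _)]
            with z h1 h2 h3 h4
          rw [h1, RingHom.id_apply, h4, Pi.smul_apply, h2, h3, Pi.smul_apply]
          simp only [smul_eq_mul]
          ring }
      h.2.choose (fun f => by
        apply norm_le_mul_of_ae
        filter_upwards [(h.memLp_mul (Lp.memLp f)).coeFn_toLp] with z h1
        simp only [LinearMap.coe_mk, AddHom.coe_mk]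
        rw [h1, abs_mul]
        exact mul_le_mul_of_nonneg_right (h.2.choose_spec z) (abs_nonneg _))
  else 0

theorem coeFn_mulL {b : Q → ℝ} (h : BddMeas b) (f : Lp ℝ 2 μ) :
    mulL μ b f =ᵐ[μ] fun z => b z * f z := by
  rw [mulL, dif_pos h]
  exact (h.memLp_mul (Lp.memLp f)).coeFn_toLp

theorem norm_mulL_le {b : Q → ℝ} (h : BddMeas b) {C : ℝ} (hC : ∀ z, |b z| ≤ C) (f : Lp ℝ 2 μ) :
    ‖mulL μ b f‖ ≤ C * ‖f‖ := by
  apply norm_le_mul_of_ae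
  filter_upwards [coeFn_mulL h f] with z h1
  rw [h1, abs_mul]
  exact mul_le_mul_of_nonneg_right (hC z) (abs_nonneg _)

theorem inner_mulL {b : Q → ℝ} (h : BddMeas b) (f g : Lp ℝ 2 μ) :
    ⟪mulL μ b f, g⟫ = ⟪f, mulL μ b g⟫ := by
  rw [inner_eq_integral, inner_eq_integral]
  refine integral_congr_ae ?_
  filter_upwards [coeFn_mulL h f, coeFn_mulL h g] with z h1 h2
  rw [h1, h2]; ring

theorem mulL_toL2 {b g : Q → ℝ} (h : BddMeas b) (hg : MemLp g 2 μ) :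
    mulL μ b (toL2 μ g) = toL2 μ (fun z => b z * g z) := by
  symm
  apply toL2_congr
  filter_upwards [coeFn_mulL h (toL2 μ g), coeFn_toL2 hg] with z h1 h2
  rw [h1, h2]

end Multiplication

/-! ### Weak derivatives of elements of `L²` -/

section Translation

variable {P : Type*} [NormedAddCommGroup P] [NormedSpace ℝ P] [FiniteDimensional ℝ P]
  [MeasurableSpace P] [BorelSpace P] {μ : Measure P} [μ.IsAddHaarMeasure]

theorem translate_mulL {b : P → ℝ} (h : BddMeas b) (a : P) (f : Lp ℝ 2 μ) :
    translate μ a (mulL μ b f) = mulL μ (fun z => b (z + a)) (translate μ a f) := by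
  have h' : BddMeas (fun z => b (z + a)) :=
    ⟨h.1.comp (measurable_add_const a), h.2.imp fun C hC z => hC _⟩
  apply Lp.ext
  filter_upwards [coeFn_translate a (mulL μ b f), ae_translate a (coeFn_mulL h f),
    coeFn_mulL h' (translate μ a f), coeFn_translate a f] with z h1 h2 h3 h4
  rw [h1, h2, h3, h4]

/-- The commutator of a translation with multiplication by a function that is Lipschitz along the
translation is small. -/
theorem norm_translate_mulL_sub_le {b : P → ℝ} (h : BddMeas b) {a : P} {C : ℝ}
    (hC : ∀ z, |b (z + a) - b z| ≤ C) (f : Lp ℝ 2 μ) :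
    ‖translate μ a (mulL μ b f) - mulL μ b (translate μ a f)‖ ≤ C * ‖f‖ := by
  have h' : BddMeas (fun z => b (z + a)) :=
    ⟨h.1.comp (measurable_add_const a), h.2.imp fun C hC z => hC _⟩
  rw [translate_mulL h, ← (translate μ a).norm_map f]
  apply norm_le_mul_of_ae
  filter_upwards [Lp.coeFn_sub (mulL μ (fun z => b (z + a)) (translate μ a f))
    (mulL μ b (translate μ a f)), coeFn_mulL h (translate μ a f), coeFn_mulL h' (translate μ a f)]
    with z h1 h2 h3
  rw [h1, Pi.sub_apply, h2, h3, ← sub_mul, abs_mul]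
  exact mul_le_mul_of_nonneg_right (hC z) (abs_nonneg _)

/-- `α = ∑ₖ ∂_{e k} (β k)` in the sense of distributions, for elements of `L²`. -/
def WeakDiv {ι : Type*} [Fintype ι] (e : ι → P) (β : ι → Lp ℝ 2 μ) (α : Lp ℝ 2 μ) : Prop :=
  ∀ ψ : P → ℝ, IsTest ψ →
    ⟪toL2 μ ψ, α⟫ = -∑ k, ⟪toL2 μ (fun z => fderiv ℝ ψ z (e k)), β k⟫

/-- `g = ∂_e f` in the sense of distributions, for elements of `L²`. -/
def WeakDeriv (e : P) (f g : Lp ℝ 2 μ) : Prop :=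
  ∀ ψ : P → ℝ, IsTest ψ → ⟪toL2 μ ψ, g⟫ = -⟪toL2 μ (fun z => fderiv ℝ ψ z e), f⟫

theorem WeakDeriv.weakDiv {e : P} {f g : Lp ℝ 2 μ} (h : WeakDeriv e f g) :
    WeakDiv (fun _ : Unit => e) (fun _ => f) g := fun ψ hψ => by
  simpa using h ψ hψ

theorem WeakDiv.comp_translate {ι : Type*} [Fintype ι] {e : ι → P} {β : ι → Lp ℝ 2 μ} {α : Lp ℝ 2 μ}
    (h : WeakDiv e β α) (a : P) :
    WeakDiv e (fun k => translate μ a (β k)) (translate μ a α) := by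
  intro ψ hψ
  simp only [inner_translate_right]
  rw [translate_toL2 hψ.memLp, h _ (hψ.comp_add (-a))]
  congr 1
  refine Finset.sum_congr rfl fun k _ => ?_
  rw [translate_toL2 (hψ.fderiv_apply (e k)).memLp]
  simp only [fderiv_comp_add_right]

theorem WeakDeriv.comp_translate {e : P} {f g : Lp ℝ 2 μ} (h : WeakDeriv e f g) (a : P) :
    WeakDeriv e (translate μ a f) (translate μ a g) := fun ψ hψ => by
  simpa using h.weakDiv.comp_translate a ψ hψ

theorem WeakDeriv.mul {e : P} {f g : Lp ℝ 2 μ} (h : WeakDeriv e f g) {b : P → ℝ}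
    (hb : ContDiff ℝ ∞ b) (hbb : BddMeas b) (hbd : BddMeas (fun z => fderiv ℝ b z e)) :
    WeakDeriv e (mulL μ b f) (mulL μ b g + mulL μ (fun z => fderiv ℝ b z e) f) := by
  intro ψ hψ
  have hψ' := hψ.fderiv_apply e
  rw [inner_add_right, ← inner_mulL hbb, ← inner_mulL hbd, ← inner_mulL hbb,
    mulL_toL2 hbb hψ.memLp, mulL_toL2 hbd hψ.memLp, mulL_toL2 hbb hψ'.memLp,
    h _ (hψ.mul_left hb)]
  have h1 : (fun z => fderiv ℝ (fun z => b z * ψ z) z e) =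
      (fun z => b z * fderiv ℝ ψ z e) + fun z => fderiv ℝ b z e * ψ z := by
    ext z
    have := fderiv_fun_mul (𝕜 := ℝ) (hb.differentiable (by simp) z) (hψ.differentiable z)
    rw [this]
    simp [mul_comm]
  have h2 : toL2 μ (fun z => fderiv ℝ (fun z => b z * ψ z) z e) =
      toL2 μ (fun z => b z * fderiv ℝ ψ z e) + toL2 μ (fun z => fderiv ℝ b z e * ψ z) := by
    rw [h1]
    apply toL2_congr
    filter_upwards [coeFn_toL2 (hbb.memLp_mul (μ := μ) hψ'.memLp),
      coeFn_toL2 (hbd.memLp_mul (μ := μ) hψ.memLp),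
      Lp.coeFn_add (toL2 μ (fun z => b z * fderiv ℝ ψ z e))
        (toL2 μ (fun z => fderiv ℝ b z e * ψ z))] with z h1 h2 h3
    rw [h3, Pi.add_apply, h1, h2, Pi.add_apply]
  rw [h2, inner_add_left]
  ring

/-- Test functions separate the elements of `L²`. -/
theorem eq_of_forall_inner_test {f g : Lp ℝ 2 μ}
    (h : ∀ ψ : P → ℝ, IsTest ψ → ⟪toL2 μ ψ, f⟫ = ⟪toL2 μ ψ, g⟫) : f = g := by
  apply Lp.ext
  refine ae_eq_of_integral_contDiff_smul_eq ((Lp.memLp f).locallyIntegrable (by norm_num))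
    ((Lp.memLp g).locallyIntegrable (by norm_num)) fun ψ h1 h2 => ?_
  have hψ : IsTest ψ := ⟨h1, h2⟩
  simpa [inner_toL2 hψ.memLp] using h ψ hψ

/-- The fundamental theorem of calculus for weak derivatives: `L²` functions with a weak derivative
in `L²` are strongly differentiable along translations. -/
theorem WeakDeriv.translate_sub {e : P} {f g : Lp ℝ 2 μ} (h : WeakDeriv e f g) (s : ℝ) :
    translate μ (s • e) f - f = ∫ r in (0 : ℝ)..s, translate μ (r • e) g := by
  apply eq_of_forall_inner_test
  intro ψ hψ
  have hc : Continuous fun r : ℝ => translate μ (r • e) g :=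
    (continuous_translate g).comp (continuous_id.smul continuous_const)
  have hd : ∀ r : ℝ, HasDerivAt (fun r : ℝ => ⟪toL2 μ ψ, translate μ (r • e) f⟫)
      ⟪toL2 μ ψ, translate μ (r • e) g⟫ r := by
    intro r
    have h1 := hψ.hasDerivAt_inner_translate f (r • e) e
    rw [HasLineDerivAt] at h1
    rw [← h.comp_translate (r • e) ψ hψ] at h1
    have h3 : HasDerivAt (fun t : ℝ => t - r) 1 r := (hasDerivAt_id r).sub_const r
    have h2 := HasDerivAt.scomp_of_eq r h1 h3 (sub_self r).symm
    rw [one_smul] at h2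
    refine h2.congr_of_eventuallyEq (Eventually.of_forall fun t => ?_)
    simp [← add_smul]
  have := intervalIntegral.integral_eq_sub_of_hasDerivAt (a := 0) (b := s) (fun r _ => hd r)
    ((continuous_const.inner hc).intervalIntegrable _ _)
  have h4 := (innerSL ℝ (toL2 μ ψ)).intervalIntegral_comp_comm
    (hc.intervalIntegrable (μ := volume) 0 s)
  simp only [innerSL_apply_apply] at h4
  rw [inner_sub_right, ← h4, this]
  simp [translate_zero]

theorem WeakDeriv.hasDerivAt_translate {e : P} {f g : Lp ℝ 2 μ} (h : WeakDeriv e f g) :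
    HasDerivAt (fun s : ℝ => translate μ (s • e) f) g 0 := by
  have hc : Continuous fun r : ℝ => translate μ (r • e) g :=
    (continuous_translate g).comp (continuous_id.smul continuous_const)
  have h1 := (hc.integral_hasStrictDerivAt 0 0).hasDerivAt.add_const f
  simp only [zero_smul, translate_zero] at h1
  refine h1.congr_of_eventuallyEq (Eventually.of_forall fun s => ?_)
  simp only [← h.translate_sub s, sub_add_cancel]

end Translation

/-! ### Integration by parts -/

section Density

variable {P : Type*} [NormedAddCommGroup P] [NormedSpace ℝ P] [FiniteDimensional ℝ P]
  [MeasurableSpace P] [BorelSpace P] {μ : Measure P} [μ.IsAddHaarMeasure]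

theorem IsTest.bddMeas {ψ : P → ℝ} (h : IsTest ψ) : BddMeas ψ :=
  ⟨h.1.continuous.measurable, by
    simpa using h.1.continuous.bounded_above_of_compact_support h.2⟩

theorem inner_toL2_translate_eq {φ : P → ℝ} (hφ : MemLp φ 2 μ) (f : Lp ℝ 2 μ) (z : P) :
    ⟪toL2 μ φ, translate μ z f⟫ = ∫ a, φ a * f (a + z) ∂μ := by
  rw [inner_toL2 hφ]
  refine integral_congr_ae ?_
  filter_upwards [coeFn_translate z f] with a ha
  rw [ha]

/-- The regularization `z ↦ ⟪φ, f (· + z)⟫` of a compactly supported `f` by a test function `φ` is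
a test function. -/
theorem IsTest.inner_translate {φ : P → ℝ} (hφ : IsTest φ) {f : Lp ℝ 2 μ} {F : P → ℝ}
    (hF : HasCompactSupport F) (hfF : f =ᵐ[μ] F) :
    IsTest (fun z => ⟪toL2 μ φ, translate μ z f⟫) := by
  set g : P → ℝ := fun x => φ (-x) with hg
  have hgd : ContDiff ℝ ∞ g := hφ.1.comp contDiff_neg
  have hgc : HasCompactSupport g := hφ.2.comp_homeomorph (Homeomorph.neg P)
  have hf : LocallyIntegrable f μ := (Lp.memLp f).locallyIntegrable (by norm_num)
  have hF' : LocallyIntegrable F μ := hf.congr hfF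
  have h1 : (fun z => ⟪toL2 μ φ, translate μ z f⟫) =
      convolution F g (ContinuousLinearMap.mul ℝ ℝ) μ := by
    ext z
    rw [inner_translate_right, translate_toL2 hφ.memLp, inner_toL2 (hφ.comp_add (-z)).memLp,
      convolution_def]
    refine integral_congr_ae ?_
    filter_upwards [hfF] with x hx
    simp [hg, hx, mul_comm, sub_eq_add_neg]
  rw [h1]
  refine ⟨?_, ?_⟩
  · exact HasCompactSupport.contDiff_convolution_right (n := ⊤) (ContinuousLinearMap.mul ℝ ℝ) hgc hF' hgd
  · exact HasCompactSupport.convolution (ContinuousLinearMap.mul ℝ ℝ) hF hgc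

/-- Testing a regularization of `f` against `α` is testing the correlations `⟪f(· + a), α⟫` against
the regularizing function. -/
theorem integral_inner_translate_mul {φ : P → ℝ} (hφ : IsTest φ) (f α : Lp ℝ 2 μ) :
    ∫ z, ⟪toL2 μ φ, translate μ z f⟫ * α z ∂μ = ∫ a, φ a * ⟪translate μ a f, α⟫ ∂μ := by
  have hi : Integrable φ μ := hφ.1.continuous.integrable_of_hasCompactSupport hφ.2
  have mp := measurePreserving_prod_add μ μ
  have i1 : Integrable (fun p : P × P => |φ p.1| * (f (p.1 + p.2)) ^ 2) (μ.prod μ) :=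
    mp.integrable_comp_of_integrable (hi.abs.mul_prod (Lp.memLp f).integrable_sq)
  have i2 : Integrable (fun p : P × P => |φ p.1| * (α p.2) ^ 2) (μ.prod μ) :=
    hi.abs.mul_prod (Lp.memLp α).integrable_sq
  have mf : AEStronglyMeasurable (fun p : P × P => f (p.1 + p.2)) (μ.prod μ) :=
    ((Lp.aestronglyMeasurable f).comp_snd (μ := μ)).comp_measurePreserving mp
  have i3 : Integrable (fun p : P × P => φ p.1 * f (p.1 + p.2) * α p.2) (μ.prod μ) := by
    refine (i1.add i2).mono' ((hi.1.comp_fst.mul mf).mul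
      (Lp.aestronglyMeasurable α).comp_snd) (Eventually.of_forall fun p => ?_)
    rw [Real.norm_eq_abs, mul_assoc, abs_mul, abs_mul, Pi.add_apply, ← mul_add]
    refine mul_le_mul_of_nonneg_left ?_ (abs_nonneg _)
    nlinarith [sq_nonneg (|f (p.1 + p.2)| - |α p.2|), sq_abs (f (p.1 + p.2)), sq_abs (α p.2),
      sq_nonneg (f (p.1 + p.2)), sq_nonneg (α p.2)]
  have := integral_integral_swap (f := fun a z => φ a * f (a + z) * α z) i3
  simp only [inner_toL2_translate_eq hφ.memLp, ← integral_mul_const]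
  rw [← this]
  refine integral_congr_ae (Eventually.of_forall fun a => ?_)
  simp only [mul_assoc, integral_const_mul]
  congr 1
  rw [inner_eq_integral]
  refine integral_congr_ae ?_
  filter_upwards [coeFn_translate a f] with z hz
  rw [hz, add_comm]

theorem fderiv_inner_translate {φ : P → ℝ} (hφ : IsTest φ) {f g : Lp ℝ 2 μ} {e : P}
    (h : WeakDeriv e f g) (hs : IsTest (fun z => ⟪toL2 μ φ, translate μ z f⟫)) (z : P) :
    fderiv ℝ (fun z => ⟪toL2 μ φ, translate μ z f⟫) z e = ⟪toL2 μ φ, translate μ z g⟫ := by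
  rw [h.comp_translate z φ hφ, ← (hs.differentiable z).lineDeriv_eq_fderiv]
  exact (hφ.hasDerivAt_inner_translate f z e).lineDeriv

/-- The integration by parts formula for compactly supported `f`, by regularization. -/
theorem WeakDiv.inner_eq_of_compact {ι : Type*} [Fintype ι] {e : ι → P} {β : ι → Lp ℝ 2 μ}
    {α : Lp ℝ 2 μ} (h : WeakDiv e β α) {f : Lp ℝ 2 μ} {g : ι → Lp ℝ 2 μ} {F : P → ℝ}
    (hF : HasCompactSupport F) (hfF : f =ᵐ[μ] F) (hfg : ∀ k, WeakDeriv (e k) f (g k)) :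
    ⟪f, α⟫ = -∑ k, ⟪g k, β k⟫ := by
  have hc : Continuous fun a => ⟪translate μ a f, α⟫ + ∑ k, ⟪translate μ a (g k), β k⟫ := by
    refine ((continuous_translate f).inner continuous_const).add ?_
    exact continuous_finsetSum _ fun k _ => (continuous_translate (g k)).inner continuous_const
  -- regularizing `f` by `φ` tests the continuous function below against `φ`; its value at `0` is
  -- the assertion
  have hz : (fun a => ⟪translate μ a f, α⟫ + ∑ k, ⟪translate μ a (g k), β k⟫) = fun _ => 0 := by
    rw [← hc.ae_eq_iff_eq μ continuous_const]
    refine ae_eq_zero_of_integral_contDiff_smul_eq_zero hc.locallyIntegrable fun φ h1 h2 => ?_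
    have hφ : IsTest φ := ⟨h1, h2⟩
    have hs := hφ.inner_translate hF hfF
    have key := h _ hs
    simp only [fderiv_inner_translate hφ (hfg _) hs] at key
    have hm : ∀ k, MemLp (fun z => ⟪toL2 μ φ, translate μ z (g k)⟫) 2 μ := by
      intro k
      have := (hs.fderiv_apply (e k)).memLp (μ := μ)
      simpa only [fderiv_inner_translate hφ (hfg k) hs] using this
    rw [inner_toL2 hs.memLp, integral_inner_translate_mul hφ] at key
    simp only [inner_toL2 (hm _), integral_inner_translate_mul hφ] at key
    have hint : ∀ u v : Lp ℝ 2 μ, Integrable (fun a => φ a * ⟪translate μ a u, v⟫) μ := by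
      intro u v
      refine Continuous.integrable_of_hasCompactSupport ?_ h2.mul_right
      exact h1.continuous.mul ((continuous_translate u).inner continuous_const)
    simp only [smul_eq_mul, mul_add, Finset.mul_sum]
    rw [integral_add (hint f α) (integrable_finsetSum _ fun k _ => hint _ _),
      integral_finsetSum _ fun k _ => hint _ _, key]
    ring
  have := congrFun hz 0
  simp only [translate_zero] at this
  linarith

theorem tendsto_inner_mulL {b : ℕ → P → ℝ} {b₀ : P → ℝ} (hb : ∀ n, BddMeas (b n))
    (hb₀ : BddMeas b₀) {C : ℝ} (hC : ∀ n z, |b n z| ≤ C)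
    (hlim : ∀ z, Tendsto (fun n => b n z) atTop (𝓝 (b₀ z))) (f α : Lp ℝ 2 μ) :
    Tendsto (fun n => ⟪mulL μ (b n) f, α⟫) atTop (𝓝 ⟪mulL μ b₀ f, α⟫) := by
  have hval : ∀ c : P → ℝ, BddMeas c → ⟪mulL μ c f, α⟫ = ∫ z, c z * (f z * α z) ∂μ := by
    intro c hc
    rw [inner_eq_integral]
    refine integral_congr_ae ?_
    filter_upwards [coeFn_mulL hc f] with z hz
    rw [hz, mul_assoc]
  simp only [hval _ (hb _), hval _ hb₀]
  refine tendsto_integral_of_dominated_convergence (fun z => C * |f z * α z|) ?_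
    ((integrable_mul_L2 f α).abs.const_mul C) ?_ ?_
  · exact fun n => (hb n).1.aestronglyMeasurable.mul (integrable_mul_L2 f α).1
  · refine fun n => Eventually.of_forall fun z => ?_
    rw [norm_mul]
    exact mul_le_mul_of_nonneg_right (hC n z) (norm_nonneg _)
  · exact Eventually.of_forall fun z => (hlim z).mul_const _

theorem mulL_one (f : Lp ℝ 2 μ) : mulL μ (fun _ => 1) f = f := by
  apply Lp.ext
  filter_upwards [coeFn_mulL (μ := μ) (b := fun _ => 1)
    ⟨measurable_const, 1, fun z => by simp⟩ f] with z hz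
  rw [hz, one_mul]

theorem mulL_zero (f : Lp ℝ 2 μ) : mulL μ (fun _ => 0) f = 0 := by
  apply Lp.ext
  filter_upwards [coeFn_mulL (μ := μ) (b := fun _ => 0)
    ⟨measurable_const, 0, fun z => by simp⟩ f, Lp.coeFn_zero ℝ 2 μ] with z hz h0
  rw [hz, zero_mul, h0, Pi.zero_apply]

/-- Integration by parts: a divergence in the sense of distributions may be tested against every
`f ∈ L²` that has the corresponding weak derivatives in `L²`. -/
theorem WeakDiv.inner_eq {ι : Type*} [Fintype ι] {e : ι → P} {β : ι → Lp ℝ 2 μ}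
    {α : Lp ℝ 2 μ} (h : WeakDiv e β α) {f : Lp ℝ 2 μ} {g : ι → Lp ℝ 2 μ}
    (hfg : ∀ k, WeakDeriv (e k) f (g k)) :
    ⟪f, α⟫ = -∑ k, ⟪g k, β k⟫ := by
  let B : ContDiffBump (0 : P) := ⟨1, 2, by norm_num, by norm_num⟩
  have hBt : IsTest (B : P → ℝ) := ⟨B.contDiff, B.hasCompactSupport⟩
  let r : ℕ → ℝ := fun n => ((n : ℝ) + 1)⁻¹
  have hr0 : ∀ n, 0 < r n := fun n => by positivity
  have hr1 : ∀ n, r n ≤ 1 := fun n => inv_le_one_of_one_le₀ (by simp)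
  have hr : Tendsto r atTop (𝓝 0) := tendsto_inv_atTop_zero.comp
    (tendsto_atTop_add_const_right _ _ tendsto_natCast_atTop_atTop)
  -- slowly varying cutoffs, whose derivatives tend to zero uniformly
  let χ : ℕ → P → ℝ := fun n z => B (r n • z)
  have hχ : ∀ n, IsTest (χ n) := fun n =>
    ⟨hBt.1.comp (contDiff_const.smul contDiff_id),
      hBt.2.comp_homeomorph (Homeomorph.smulOfNeZero (r n) (hr0 n).ne')⟩
  have hχ1 : ∀ n z, |χ n z| ≤ 1 := fun n z => by
    rw [abs_of_nonneg (B.nonneg' _)]; exact B.le_one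
  have hχlim : ∀ z, Tendsto (fun n => χ n z) atTop (𝓝 1) := fun z => by
    have h0 : Tendsto (fun n => r n • z) atTop (𝓝 0) := by simpa using hr.smul_const z
    have := (B.contDiff (n := 0)).continuous.tendsto (0 : P) |>.comp h0
    rwa [B.one_of_mem_closedBall (by simp [B])] at this
  have hder : ∀ n z e, fderiv ℝ (χ n) z e = r n * fderiv ℝ B (r n • z) e := by
    intro n z e
    have h1 := (hBt.differentiable (r n • z)).hasFDerivAt.comp z
      ((hasFDerivAt_id (𝕜 := ℝ) z).const_smul (r n))
    have h2 : HasFDerivAt (χ n) _ z := h1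
    rw [h2.fderiv]
    simp
  have step : ∀ n, ⟪mulL μ (χ n) f, α⟫ = -∑ k, (⟪mulL μ (χ n) (g k), β k⟫ +
      ⟪mulL μ (fun z => fderiv ℝ (χ n) z (e k)) f, β k⟫) := by
    intro n
    simp only [← inner_add_left]
    refine h.inner_eq_of_compact (F := fun z => χ n z * f z) (hχ n).2.mul_right
      (coeFn_mulL (hχ n).bddMeas f) fun k => ?_
    exact (hfg k).mul (hχ n).1 (hχ n).bddMeas ((hχ n).fderiv_apply (e k)).bddMeas
  have one : BddMeas (fun _ : P => (1 : ℝ)) := ⟨measurable_const, 1, fun z => by simp⟩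
  have zero : BddMeas (fun _ : P => (0 : ℝ)) := ⟨measurable_const, 0, fun z => by simp⟩
  have l1 := tendsto_inner_mulL (fun n => (hχ n).bddMeas) one hχ1 hχlim f α
  have l2 : Tendsto (fun n => -∑ k, (⟪mulL μ (χ n) (g k), β k⟫ +
      ⟪mulL μ (fun z => fderiv ℝ (χ n) z (e k)) f, β k⟫)) atTop
      (𝓝 (-∑ k, (⟪mulL μ (fun _ => 1) (g k), β k⟫ + ⟪mulL μ (fun _ => 0) f, β k⟫))) := by
    refine (tendsto_finsetSum _ fun k _ => ?_).neg
    refine (tendsto_inner_mulL (fun n => (hχ n).bddMeas) one hχ1 hχlim _ _).add ?_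
    obtain ⟨C, hC⟩ := (hBt.fderiv_apply (e k)).bddMeas.2
    have hC0 : 0 ≤ C := (abs_nonneg _).trans (hC 0)
    refine tendsto_inner_mulL (C := C) (fun n => ((hχ n).fderiv_apply (e k)).bddMeas) zero ?_ ?_ _ _
    · intro n z
      rw [hder, abs_mul, abs_of_pos (hr0 n)]
      exact (mul_le_mul (hr1 n) (hC _) (abs_nonneg _) zero_le_one).trans_eq (one_mul C)
    · intro z
      simp only [hder]
      refine squeeze_zero_norm (a := fun n => r n * C) (fun n => ?_) (by simpa using hr.mul_const C)
      rw [norm_mul, Real.norm_eq_abs, Real.norm_eq_abs, abs_of_pos (hr0 n)]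
      exact mul_le_mul_of_nonneg_left (hC _) (hr0 n).le
  simp only [← step] at l2
  have := tendsto_nhds_unique l1 l2
  simpa [mulL_one, mulL_zero] using this

/-- Weak differentiation is skew-symmetric. -/
theorem WeakDeriv.inner_eq {e : P} {f f' g g' : Lp ℝ 2 μ} (hf : WeakDeriv e f f')
    (hg : WeakDeriv e g g') : ⟪f, g'⟫ = -⟪f', g⟫ := by
  simpa using hg.weakDiv.inner_eq (g := fun _ => f') fun _ => hf

end Density

/-! ### Averages along a subspace -/

section Average

variable {P : Type*} [NormedAddCommGroup P] [NormedSpace ℝ P] [FiniteDimensional ℝ P]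
  [MeasurableSpace P] [BorelSpace P] {μ : Measure P} [μ.IsAddHaarMeasure]
  {Y : Type*} [NormedAddCommGroup Y] [NormedSpace ℝ Y] [FiniteDimensional ℝ Y]
  [MeasurableSpace Y] [BorelSpace Y] {ν : Measure Y} [ν.IsAddHaarMeasure]

theorem continuous_translate_comp (ι : Y →L[ℝ] P) (f : Lp ℝ 2 μ) :
    Continuous fun y => translate μ (ι y) f :=
  (continuous_translate f).comp ι.continuous

theorem integrable_smul_translate {K : Y → ℝ} (hK : Integrable K ν) (ι : Y →L[ℝ] P)
    (f : Lp ℝ 2 μ) : Integrable (fun y => K y • translate μ (ι y) f) ν := by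
  refine (hK.norm.mul_const ‖f‖).mono' (hK.1.smul
    (continuous_translate_comp ι f).aestronglyMeasurable) (Eventually.of_forall fun y => ?_)
  rw [norm_smul, LinearIsometry.norm_map]

/-- The average `f ↦ ∫ K(y) f(· + ι y) dy` of the translates of `f` along the subspace `ι`. -/
noncomputable def avg (μ : Measure P) [μ.IsAddHaarMeasure] (ι : Y →L[ℝ] P) {K : Y → ℝ}
    (hK : Integrable K ν) : Lp ℝ 2 μ →L[ℝ] Lp ℝ 2 μ :=
  LinearMap.mkContinuous
    { toFun := fun f => ∫ y, K y • translate μ (ι y) f ∂ν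
      map_add' := fun f g => by
        simp only [map_add, smul_add]
        exact integral_add (integrable_smul_translate hK ι f) (integrable_smul_translate hK ι g)
      map_smul' := fun c f => by
        simp only [map_smul, RingHom.id_apply, smul_comm _ c]
        exact integral_smul c _ }
    (∫ y, ‖K y‖ ∂ν) (fun f => by
      simp only [LinearMap.coe_mk, AddHom.coe_mk]
      refine (norm_integral_le_integral_norm _).trans_eq ?_
      simp only [norm_smul, LinearIsometry.norm_map]
      exact integral_mul_const _ _)

theorem avg_apply (ι : Y →L[ℝ] P) {K : Y → ℝ} (hK : Integrable K ν) (f : Lp ℝ 2 μ) :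
    avg μ ι hK f = ∫ y, K y • translate μ (ι y) f ∂ν := rfl

theorem map_avg (ι : Y →L[ℝ] P) {K : Y → ℝ} (hK : Integrable K ν) (f : Lp ℝ 2 μ)
    {X : Type*} [NormedAddCommGroup X] [NormedSpace ℝ X] [CompleteSpace X]
    (B : Lp ℝ 2 μ →L[ℝ] X) :
    B (avg μ ι hK f) = ∫ y, K y • B (translate μ (ι y) f) ∂ν := by
  rw [avg_apply, ← B.integral_comp_comm (integrable_smul_translate hK ι f)]
  simp only [map_smul]

theorem inner_avg (ι : Y →L[ℝ] P) {K : Y → ℝ} (hK : Integrable K ν) (f g : Lp ℝ 2 μ) :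
    ⟪g, avg μ ι hK f⟫ = ∫ y, K y * ⟪g, translate μ (ι y) f⟫ ∂ν :=
  map_avg ι hK f (innerSL ℝ g)

theorem integrable_mul_inner_translate {K : Y → ℝ} (hK : Integrable K ν) (ι : Y →L[ℝ] P)
    (f g : Lp ℝ 2 μ) : Integrable (fun y => K y * ⟪g, translate μ (ι y) f⟫) ν := by
  have := (innerSL ℝ g).integrable_comp (integrable_smul_translate hK ι f)
  simpa [inner_smul_right] using this

/-- Averages commute with multiplication by functions that are invariant along the averaged
translations. -/
theorem mulL_avg (ι : Y →L[ℝ] P) {K : Y → ℝ} (hK : Integrable K ν) {b : P → ℝ} (hb : BddMeas b)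
    (hinv : ∀ z y, b (z + ι y) = b z) (f : Lp ℝ 2 μ) :
    mulL μ b (avg μ ι hK f) = avg μ ι hK (mulL μ b f) := by
  rw [map_avg, avg_apply]
  simp only [translate_mulL hb, hinv]

theorem WeakDiv.avg {ι' : Type*} [Fintype ι'] {e : ι' → P} {β : ι' → Lp ℝ 2 μ} {α : Lp ℝ 2 μ}
    (h : WeakDiv e β α) (ι : Y →L[ℝ] P) {K : Y → ℝ} (hK : Integrable K ν) :
    WeakDiv e (fun k => avg μ ι hK (β k)) (avg μ ι hK α) := by
  intro ψ hψ
  simp only [inner_avg]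
  rw [← integral_finsetSum _ fun k _ => integrable_mul_inner_translate hK ι _ _, ← integral_neg]
  refine integral_congr_ae (Eventually.of_forall fun y => ?_)
  simp only [h.comp_translate (ι y) ψ hψ, mul_neg, Finset.mul_sum]

theorem WeakDeriv.avg {e : P} {f g : Lp ℝ 2 μ} (h : WeakDeriv e f g) (ι : Y →L[ℝ] P) {K : Y → ℝ}
    (hK : Integrable K ν) : WeakDeriv e (avg μ ι hK f) (avg μ ι hK g) := fun ψ hψ => by
  simpa using h.weakDiv.avg ι hK ψ hψ

/-- An average is differentiable along the averaged directions: the derivative falls on the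
kernel. -/
theorem weakDeriv_avg (ι : Y →L[ℝ] P) {K : Y → ℝ} (hK : Integrable K ν)
    (hd : Differentiable ℝ K) {e : Y} (hK' : Integrable (fun y => fderiv ℝ K y e) ν)
    (f : Lp ℝ 2 μ) : WeakDeriv (ι e) (avg μ ι hK f) (-avg μ ι hK' f) := by
  intro ψ hψ
  rw [inner_neg_right, inner_avg, inner_avg]
  have key := integral_bilinear_hasLineDerivAt_right_eq_neg_left_of_integrable (μ := ν)
    (B := ContinuousLinearMap.mul ℝ ℝ) (v := e) (f := K) (f' := fun y => fderiv ℝ K y e)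
    (g := fun y => ⟪toL2 μ ψ, translate μ (ι y) f⟫)
    (g' := fun y => -⟪toL2 μ (fun z => fderiv ℝ ψ z (ι e)), translate μ (ι y) f⟫)
    (integrable_mul_inner_translate hK' ι f _)
    (by simpa using (integrable_mul_inner_translate hK ι f _).neg)
    (integrable_mul_inner_translate hK ι f _)
    (fun y _ => (hd y).hasFDerivAt.hasLineDerivAt e)
    (fun y _ => by
      have := hψ.hasDerivAt_inner_translate f (ι y) (ι e)
      simpa only [HasLineDerivAt, map_add, map_smul] using this)
  simp only [ContinuousLinearMap.mul_apply', mul_neg, integral_neg] at key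
  rw [← key]

/-- The composition of two averages is the average for the convolution of the kernels. -/
theorem avg_avg (ι : Y →L[ℝ] P) {K K' L : Y → ℝ} (hK : Integrable K ν) (hK' : Integrable K' ν)
    (hL : Integrable L ν) (h : ∀ y, ∫ x, K' x * K (y - x) ∂ν = L y) (f : Lp ℝ 2 μ) :
    avg μ ι hK' (avg μ ι hK f) = avg μ ι hL f := by
  have hint : Integrable (fun p : Y × Y => (K' p.1 * K (p.2 - p.1)) • translate μ (ι p.2) f)
      (ν.prod ν) := by
    have h1 := (hK'.convolution_integrand (ContinuousLinearMap.mul ℝ ℝ) hK).swap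
    have h2 : Integrable (fun p : Y × Y => K' p.1 * K (p.2 - p.1)) (ν.prod ν) := h1
    refine (h2.norm.mul_const ‖f‖).mono' (h2.1.smul
      ((continuous_translate_comp ι f).comp continuous_snd).aestronglyMeasurable)
      (Eventually.of_forall fun y => ?_)
    rw [norm_smul, LinearIsometry.norm_map]
  have swap := integral_integral_swap (f := fun x y => (K' x * K (y - x)) • translate μ (ι y) f)
    hint
  rw [avg_apply ι hK', avg_apply ι hL]
  have h1 : ∀ x, K' x • translate μ (ι x) (avg μ ι hK f) =
      ∫ y, (K' x * K (y - x)) • translate μ (ι y) f ∂ν := by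
    intro x
    have := map_avg ι hK f (translate μ (ι x)).toContinuousLinearMap
    rw [LinearIsometry.coe_toContinuousLinearMap] at this
    rw [this, ← integral_smul, ← integral_sub_right_eq_self _ x]
    refine integral_congr_ae (Eventually.of_forall fun y => ?_)
    simp only [translate_translate, smul_smul, ← map_add, add_sub_cancel]
  simp only [h1]
  rw [swap]
  refine integral_congr_ae (Eventually.of_forall fun y => ?_)
  simp only [integral_smul_const, h y]

/-- Averages with kernels that concentrate at `0` form an approximate identity. -/
theorem tendsto_avg (ι : Y →L[ℝ] P) {K : Y → ℝ} (hK : Integrable K ν) (h1 : ∫ y, K y ∂ν = 1)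
    {r : ℕ → ℝ} (hr : Tendsto r atTop (𝓝 0)) (f : Lp ℝ 2 μ) :
    Tendsto (fun n => avg μ (r n • ι) hK f) atTop (𝓝 f) := by
  have h2 : ∫ y, K y • f ∂ν = f := by rw [integral_smul_const, h1, one_smul]
  conv => rhs; rw [← h2]
  refine tendsto_integral_of_dominated_convergence (fun y => ‖K y‖ * ‖f‖)
    (fun n => (integrable_smul_translate hK _ f).1) (hK.norm.mul_const _) ?_ ?_
  · refine fun n => Eventually.of_forall fun y => ?_
    rw [norm_smul, LinearIsometry.norm_map]
  · refine Eventually.of_forall fun y => ?_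
    have h0 : Tendsto (fun n => (r n • ι) y) atTop (𝓝 0) := by
      simpa using hr.smul_const (ι y)
    have := ((continuous_translate f).tendsto 0).comp h0
    rw [translate_zero] at this
    exact this.const_smul _

end Average

/-! ### A band-limited kernel -/

section Kernel

open FourierTransform SchwartzMap

variable (Y : Type*) [NormedAddCommGroup Y] [InnerProductSpace ℝ Y] [FiniteDimensional ℝ Y]
  [MeasurableSpace Y] [BorelSpace Y]

variable {Y} in
theorem conj_fourierInv_of_even {F : Y → ℂ} (hF : ∀ y, F (-y) = F y)
    (hr : ∀ y, (starRingEnd ℂ) (F y) = F y) (y : Y) :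
    (starRingEnd ℂ) (𝓕⁻ F y) = 𝓕⁻ F y := by
  rw [Real.fourierInv_eq', ← integral_conj, ← integral_neg_eq_self]
  refine integral_congr_ae (Eventually.of_forall fun x => ?_)
  simp only [smul_eq_mul, map_mul, hF, hr, ← Complex.exp_conj, Complex.conj_ofReal, Complex.conj_I,
    inner_neg_left]
  congr 2
  push_cast
  ring

/-- There is a real integrable kernel `K` of mass `1` and band-limited: `K' ⋆ K = K` for a smooth
kernel `K'`. It is the inverse Fourier transform of a bump function, and `K'` that of a bump
function equal to `1` on the support of the former. -/
theorem exists_reproducing_kernel : ∃ K K' : Y → ℝ, Integrable K ∧ Integrable K' ∧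
    Differentiable ℝ K' ∧ (∀ e, Integrable fun y => fderiv ℝ K' y e) ∧ ∫ y, K y = 1 ∧
    ∀ y, ∫ x, K' x * K (y - x) = K y := by
  let B₀ : ContDiffBump (0 : Y) := ⟨1, 2, by norm_num, by norm_num⟩
  let B₁ : ContDiffBump (0 : Y) := ⟨2, 3, by norm_num, by norm_num⟩
  have hc : ∀ B : ContDiffBump (0 : Y), HasCompactSupport fun y => ((B y : ℝ) : ℂ) :=
    fun B => B.hasCompactSupport.comp_left (g := fun x : ℝ => (x : ℂ)) (by simp)
  have hs : ∀ B : ContDiffBump (0 : Y), ContDiff ℝ ∞ fun y => ((B y : ℝ) : ℂ) :=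
    fun B => Complex.ofRealCLM.contDiff.comp B.contDiff
  let F : ContDiffBump (0 : Y) → 𝓢(Y, ℂ) := fun B => (hc B).toSchwartzMap (hs B)
  have hF : ∀ B y, F B y = ((B y : ℝ) : ℂ) := fun B y => rfl
  let k : ContDiffBump (0 : Y) → 𝓢(Y, ℂ) := fun B => 𝓕⁻ (F B)
  have hk : ∀ B y, k B y = (((k B y).re : ℝ) : ℂ) := by
    intro B y
    rw [eq_comm, ← Complex.conj_eq_iff_re]
    have h1 : ∀ y, F B (-y) = F B y := fun y => by rw [hF, hF, B.neg]
    have h2 : ∀ y, (starRingEnd ℂ) (F B y) = F B y := fun y => by rw [hF, Complex.conj_ofReal]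
    simp only [k, SchwartzMap.fourierInv_coe]
    exact conj_fourierInv_of_even h1 h2 y
  have hkd : ∀ B, Integrable (fun y => (k B y).re) := fun B => (k B).integrable.re
  refine ⟨fun y => (k B₀ y).re, fun y => (k B₁ y).re, hkd _, hkd _, ?_, ?_, ?_, ?_⟩
  · exact Complex.reCLM.differentiable.comp (k B₁).differentiable
  · intro e
    have : ∀ y, fderiv ℝ (fun y => (k B₁ y).re) y e = (LineDeriv.lineDerivOp e (k B₁) y).re := by
      intro y
      have := (Complex.reCLM.hasFDerivAt (x := k B₁ y)).comp y
        ((k B₁).differentiable y).hasFDerivAt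
      have h2 : HasFDerivAt (fun y => (k B₁ y).re) _ y := this
      rw [h2.fderiv, SchwartzMap.lineDerivOp_apply_eq_fderiv]
      rfl
    simp only [this]
    exact (LineDeriv.lineDerivOp e (k B₁)).integrable.re
  · have h1 : 𝓕 (k B₀) 0 = 1 := by
      simp only [k, fourier_fourierInv_eq, hF]
      rw [B₀.one_of_mem_closedBall (by simp [B₀])]; simp
    rw [SchwartzMap.fourier_coe, Real.fourier_eq'] at h1
    have h2 : ∫ y, k B₀ y = 1 := by simpa using h1
    have h3 := integral_re (𝕜 := ℂ) ((k B₀).integrable (μ := volume))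
    simp only [RCLike.re_to_complex] at h3
    rw [h3, h2, Complex.one_re]
  · intro y
    have h1 : SchwartzMap.convolution (ContinuousLinearMap.mul ℂ ℂ) (k B₁) (k B₀) = k B₀ := by
      have : 𝓕 (SchwartzMap.convolution (ContinuousLinearMap.mul ℂ ℂ) (k B₁) (k B₀)) = F B₀ := by
        rw [SchwartzMap.fourier_convolution]
        ext x
        simp only [k, fourier_fourierInv_eq, SchwartzMap.pairing_apply_apply, hF,
          ContinuousLinearMap.mul_apply']
        by_cases hx : x ∈ Metric.closedBall (0 : Y) 2
        · rw [B₁.one_of_mem_closedBall hx]; simp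
        · rw [B₀.zero_of_le_dist (not_le.1 hx).le]; simp
      have h := congrArg (fun g : 𝓢(Y, ℂ) => (𝓕⁻ g : 𝓢(Y, ℂ))) this
      simpa only [fourierInv_fourier_eq] using h
    have h2 := SchwartzMap.convolution_apply (ContinuousLinearMap.mul ℂ ℂ) (k B₁) (k B₀) y
    rw [h1, convolution_def] at h2
    have h3 : ((k B₀ y).re : ℂ) = ((∫ x, (k B₁ x).re * (k B₀ (y - x)).re : ℝ) : ℂ) := by
      rw [← hk, h2, ← integral_complex_ofReal]
      refine integral_congr_ae (Eventually.of_forall fun x => ?_)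
      simp only [ContinuousLinearMap.mul_apply']
      rw [hk, hk B₀ (y - x)]
      push_cast
      simp
    exact_mod_cast h3.symm

end Kernel

/-! ### The Carleman estimate -/

section Carleman

variable {P : Type*} [NormedAddCommGroup P] [NormedSpace ℝ P] [FiniteDimensional ℝ P]
  [MeasurableSpace P] [BorelSpace P] {μ : Measure P} [μ.IsAddHaarMeasure]
  {ι κ : Type*} [Fintype ι] [Fintype κ]

/-- The flux `∑ⱼ aᵢⱼ Gⱼ`. -/
noncomputable def flux (a : ι → ι → P → ℝ) (G : ι → Lp ℝ 2 μ) (i : ι) : Lp ℝ 2 μ :=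
  ∑ j, mulL μ (a i j) (G j)

/-- The vector fields `Dᵢ = ∂_{ev i} + ∑ₖ qᵢₖ ∂_{ey k}`: `G i = Dᵢ w`, where the derivatives
`Y k = ∂_{ey k} w` are themselves in `L²`, and `L = ∑ᵢ Dᵢ (∑ⱼ aᵢⱼ Gⱼ)`. -/
structure IsElliptic (ev : ι → P) (ey : κ → P) (a : ι → ι → P → ℝ) (q : ι → κ → P → ℝ)
    (w L : Lp ℝ 2 μ) (G : ι → Lp ℝ 2 μ) (Y : κ → Lp ℝ 2 μ) : Prop where
  deriv_v : ∀ i, WeakDeriv (ev i) w (G i - ∑ k, mulL μ (q i k) (Y k))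
  deriv_y : ∀ k, WeakDeriv (ey k) w (Y k)
  weakDiv : WeakDiv (Sum.elim ev ey)
    (Sum.elim (flux a G) fun k => ∑ i, mulL μ (q i k) (flux a G i)) L

variable {ev : ι → P} {ey : κ → P} {a : ι → ι → P → ℝ} {q : ι → κ → P → ℝ}
    {w L : Lp ℝ 2 μ} {G : ι → Lp ℝ 2 μ} {Y : κ → Lp ℝ 2 μ}

/-- The equation tested with a translate of the solution. The last sum is due to the variable
coefficients of the vector fields. -/
theorem IsElliptic.inner_translate_self (h : IsElliptic ev ey a q w L G Y)
    (hq : ∀ i k, BddMeas (q i k)) (x : P) :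
    ⟪translate μ x w, L⟫ = -∑ i, ⟪translate μ x (G i), flux a G i⟫ +
      ∑ i, ∑ k, ⟪translate μ x (mulL μ (q i k) (Y k)) - mulL μ (q i k) (translate μ x (Y k)),
        flux a G i⟫ := by
  have := h.weakDiv.inner_eq (f := translate μ x w)
    (g := Sum.elim (fun i => translate μ x (G i - ∑ k, mulL μ (q i k) (Y k)))
      fun k => translate μ x (Y k)) (by
      rintro (i | k)
      · exact (h.deriv_v i).comp_translate x
      · exact (h.deriv_y k).comp_translate x)
  rw [this, Fintype.sum_sum_type]
  simp only [Sum.elim_inl, Sum.elim_inr, map_sub, map_sum, inner_sub_left, sum_inner, inner_sum,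
    Finset.sum_sub_distrib]
  rw [Finset.sum_comm (f := fun k i => ⟪translate μ x (Y k), mulL μ (q i k) (flux a G i)⟫)]
  simp only [inner_mulL (hq _ _)]
  ring

theorem norm_flux_le {Ca : ℝ} (ha : ∀ i j, BddMeas (a i j)) (hCa : ∀ i j z, |a i j z| ≤ Ca)
    (i : ι) : ‖flux a G i‖ ≤ Ca * ∑ j, ‖G j‖ := by
  rw [flux, Finset.mul_sum]
  exact (norm_sum_le _ _).trans (Finset.sum_le_sum fun j _ => norm_mulL_le (ha i j) (hCa i j) _)

/-- The commutator estimate: `∂ₜ` and the second order operator `L` commute up to terms controlled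
by first order derivatives, if the coefficients are Lipschitz in time. It comes from testing the
equation with the centred difference quotient in time. -/
theorem IsElliptic.abs_inner_deriv_le (h : IsElliptic ev ey a q w L G Y) {et : P}
    {w' : Lp ℝ 2 μ} (hw : WeakDeriv et w w')
    (hq : ∀ i k, BddMeas (q i k)) (ha : ∀ i j, BddMeas (a i j)) (hsymm : ∀ i j, a i j = a j i)
    {Ca Ka Kq : ℝ} (hCa : ∀ i j z, |a i j z| ≤ Ca) (hCa0 : 0 ≤ Ca) (hKa0 : 0 ≤ Ka) (hKq0 : 0 ≤ Kq)
    (hKa : ∀ i j z (s : ℝ), |a i j (z + s • et) - a i j z| ≤ Ka * |s|)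
    (hKq : ∀ i k z (s : ℝ), |q i k (z + s • et) - q i k z| ≤ Kq * |s|) :
    |2 * ⟪w', L⟫| ≤ Ka * (∑ i, ‖G i‖) ^ 2 +
      2 * (Kq * (∑ k, ‖Y k‖) * (Fintype.card ι * (Ca * ∑ i, ‖G i‖))) := by
  set Γ := ∑ i, ‖G i‖ with hΓ
  set Λ := ∑ k, ‖Y k‖ with hΛ
  have hΓ0 : 0 ≤ Γ := Finset.sum_nonneg fun _ _ => norm_nonneg _
  have hΛ0 : 0 ≤ Λ := Finset.sum_nonneg fun _ _ => norm_nonneg _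
  have hd : HasDerivAt (fun s : ℝ => ⟪translate μ (s • et) w - translate μ (-(s • et)) w, L⟫)
      (2 * ⟪w', L⟫) 0 := by
    have h1 := hw.hasDerivAt_translate
    have h2 : HasDerivAt (fun s : ℝ => translate μ ((-s) • et) w) (-w') 0 := by
      have h3 := HasDerivAt.scomp_of_eq (0 : ℝ) h1 (hasDerivAt_neg (0 : ℝ)) (by simp)
      rw [neg_one_smul] at h3
      exact h3
    have h3 := ((h1.sub h2).inner ℝ (hasDerivAt_const (0 : ℝ) L))
    simp only [sub_neg_eq_add, inner_zero_right, zero_add, inner_add_left] at h3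
    rw [two_mul]
    refine h3.congr_of_eventuallyEq (Eventually.of_forall fun s => ?_)
    simp [neg_smul]
  refine hd.le_of_lip' (by positivity) (Eventually.of_forall fun s => ?_)
  simp only [zero_smul, neg_zero, sub_self, inner_zero_left, sub_zero]
  set x := s • et with hx
  -- the error terms due to the time dependence of the vector fields
  have hE : ∀ y : P, (∃ r : ℝ, |r| = |s| ∧ y = r • et) →
      |∑ i, ∑ k, ⟪translate μ y (mulL μ (q i k) (Y k)) - mulL μ (q i k) (translate μ y (Y k)),
        flux a G i⟫| ≤ Kq * Λ * (Fintype.card ι * (Ca * Γ)) * |s| := by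
    rintro y ⟨r, hr, rfl⟩
    have h1 : ∀ i k, |⟪translate μ (r • et) (mulL μ (q i k) (Y k)) -
        mulL μ (q i k) (translate μ (r • et) (Y k)), flux a G i⟫| ≤
        Kq * |s| * ‖Y k‖ * (Ca * Γ) := by
      intro i k
      refine (abs_real_inner_le_norm _ _).trans (mul_le_mul ?_ (norm_flux_le ha hCa i)
        (norm_nonneg _) (by positivity))
      exact norm_translate_mulL_sub_le (hq i k) (fun z => (hKq i k z r).trans_eq (by rw [hr])) _
    refine (Finset.abs_sum_le_sum_abs _ _).trans ?_
    have h2 : ∀ i ∈ Finset.univ, |∑ k, ⟪translate μ (r • et) (mulL μ (q i k) (Y k)) -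
        mulL μ (q i k) (translate μ (r • et) (Y k)), flux a G i⟫| ≤ Kq * |s| * Λ * (Ca * Γ) := by
      intro i _
      refine ((Finset.abs_sum_le_sum_abs _ _).trans (Finset.sum_le_sum fun k _ => h1 i k)).trans_eq
        ?_
      rw [hΛ, ← Finset.sum_mul, ← Finset.mul_sum]
    refine (Finset.sum_le_sum h2).trans_eq ?_
    rw [Finset.sum_const, Finset.card_univ, nsmul_eq_mul]
    ring
  have hS : |∑ i, ⟪translate μ x (G i), flux a G i⟫ - ∑ i, ⟪translate μ (-x) (G i), flux a G i⟫| ≤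
      Ka * Γ ^ 2 * |s| := by
    have h1 : ∑ i, ⟪translate μ x (G i), flux a G i⟫ =
        ∑ i, ∑ j, ⟪G i, mulL μ (a i j) (translate μ x (G j))⟫ := by
      simp only [flux, inner_sum]
      rw [Finset.sum_comm]
      refine Finset.sum_congr rfl fun j _ => Finset.sum_congr rfl fun i _ => ?_
      rw [hsymm i j, ← inner_mulL (ha j i), real_inner_comm]
    have h2 : ∑ i, ⟪translate μ (-x) (G i), flux a G i⟫ =
        ∑ i, ∑ j, ⟪G i, translate μ x (mulL μ (a i j) (G j))⟫ := by
      simp only [flux, inner_sum, inner_translate, neg_neg]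
    rw [h1, h2, ← Finset.sum_sub_distrib]
    simp only [← Finset.sum_sub_distrib, ← inner_sub_right]
    refine (Finset.abs_sum_le_sum_abs _ _).trans ?_
    have h3 : ∀ i ∈ Finset.univ, |∑ j, ⟪G i, mulL μ (a i j) (translate μ x (G j)) -
        translate μ x (mulL μ (a i j) (G j))⟫| ≤ ∑ j, ‖G i‖ * (Ka * |s| * ‖G j‖) := by
      intro i _
      refine (Finset.abs_sum_le_sum_abs _ _).trans (Finset.sum_le_sum fun j _ => ?_)
      refine (abs_real_inner_le_norm _ _).trans
        (mul_le_mul_of_nonneg_left ?_ (norm_nonneg _))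
      rw [norm_sub_rev]
      exact norm_translate_mulL_sub_le (ha i j) (fun z => hKa i j z s) _
    refine (Finset.sum_le_sum h3).trans_eq ?_
    simp only [← Finset.mul_sum, ← Finset.sum_mul, ← hΓ]
    ring
  rw [inner_sub_left, h.inner_translate_self hq, h.inner_translate_self hq, Real.norm_eq_abs,
    Real.norm_eq_abs]
  have e1 := hE x ⟨s, rfl, rfl⟩
  have e2 := hE (-x) ⟨-s, abs_neg s, by rw [hx, neg_smul]⟩
  rw [abs_le] at *
  constructor <;> nlinarith [e1.1, e1.2, e2.1, e2.2, hS.1, hS.2]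

/-- The energy identity. -/
theorem IsElliptic.inner_self (h : IsElliptic ev ey a q w L G Y) (hq : ∀ i k, BddMeas (q i k)) :
    ⟪w, L⟫ = -∑ i, ⟪G i, flux a G i⟫ := by
  have := h.inner_translate_self hq 0
  simpa only [translate_zero, sub_self, inner_zero_left, Finset.sum_const_zero, add_zero] using this

/-- The absorption of the error terms in the Carleman estimate. Here `W = ‖w‖²`, `R = ‖r‖²`,
`Γ` is the square of the norm of the gradient, `g² ≲ W + Γ + R` is the square of the norm of the
right hand side, and `N = ⟪p w, w⟫` carries the large parameter. -/
theorem absorb {lam C₁ C₂ W R Γ N g S : ℝ} (hlam : 0 < lam) (hC₁ : 0 ≤ C₁) (hC₂ : 0 < C₂)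
    (hW : 0 ≤ W)
    (h1 : (2 * lam * (C₁ + C₂) + 1) * N ≤ g ^ 2 + C₁ * (Γ + W)) (hR : 0 ≤ R)
    (h2 : g ^ 2 ≤ C₂ * (W + Γ + R)) (h3 : lam⁻¹ * Γ ≤ N + g * √W)
    (hS : (C₁ + C₂) * (4 + lam ^ 2 * C₂) ≤ S) (h4 : S * W ≤ N) : W ≤ R := by
  have h5 : lam * (g * √W) ≤ (W + Γ + R) / 2 + lam ^ 2 * C₂ / 2 * W := by
    have h6 : 0 ≤ (g - lam * C₂ * √W) ^ 2 := sq_nonneg _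
    have h7 : √W ^ 2 = W := Real.sq_sqrt hW
    have h8 : 2 * (lam * C₂ * (g * √W)) ≤ g ^ 2 + (lam * C₂) ^ 2 * W := by nlinarith
    have h9 : C₂ * (lam * (g * √W)) ≤ C₂ * ((W + Γ + R) / 2 + lam ^ 2 * C₂ / 2 * W) := by
      nlinarith
    exact le_of_mul_le_mul_left h9 hC₂
  have h6 : Γ ≤ lam * N + lam * (g * √W) := by
    have := mul_le_mul_of_nonneg_left h3 hlam.le
    rwa [← mul_assoc, mul_inv_cancel₀ hlam.ne', one_mul, mul_add] at this
  have h7 : Γ ≤ 2 * lam * N + W + R + lam ^ 2 * C₂ * W := by linarith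
  have hC : 0 < C₁ + C₂ := by linarith
  have h8 : (2 * lam * (C₁ + C₂) + 1) * N ≤ (C₁ + C₂) * (W + Γ + R) := by nlinarith
  have h9 : (C₁ + C₂) * (W + Γ + R) ≤
      (C₁ + C₂) * (W + (2 * lam * N + W + R + lam ^ 2 * C₂ * W) + R) :=
    mul_le_mul_of_nonneg_left (by linarith) hC.le
  have h10 : N ≤ (C₁ + C₂) * (2 + lam ^ 2 * C₂) * W + 2 * (C₁ + C₂) * R := by nlinarith
  have h11 : (C₁ + C₂) * (4 + lam ^ 2 * C₂) * W ≤ N :=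
    (mul_le_mul_of_nonneg_right hS hW).trans h4
  have h12 : 2 * (C₁ + C₂) * W ≤ 2 * (C₁ + C₂) * R := by nlinarith
  exact le_of_mul_le_mul_left h12 (by linarith)

theorem three_sq_le {c x y z m Γ : ℝ} (hm : 0 ≤ m) (hΓ : 0 ≤ Γ) (h : y ^ 2 ≤ m * Γ) :
    (c * (x + y) + z) ^ 2 ≤ 3 * (1 + c ^ 2 * (1 + m)) * (x ^ 2 + Γ + z ^ 2) := by
  have h1 : (c * (x + y) + z) ^ 2 ≤ 3 * (c ^ 2 * x ^ 2 + c ^ 2 * y ^ 2 + z ^ 2) := by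
    nlinarith [sq_nonneg (c * x - c * y), sq_nonneg (c * x - z), sq_nonneg (c * y - z)]
  refine h1.trans ?_
  rw [mul_assoc]
  refine mul_le_mul_of_nonneg_left ?_ (by norm_num)
  have h5 : c ^ 2 * y ^ 2 ≤ c ^ 2 * (m * Γ) := mul_le_mul_of_nonneg_left h (sq_nonneg _)
  have h6 : 0 ≤ (1 + c ^ 2 * m) * x ^ 2 := by positivity
  have h7 : 0 ≤ (1 + c ^ 2) * Γ := by positivity
  have h8 : 0 ≤ (c ^ 2 * (1 + m)) * z ^ 2 := by positivity
  linarith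

/-- The Carleman estimate for the conjugated equation `∂ₜ w + p w + L = g`. The weight enters
through `p`, which satisfies `∂ₜ p = -γ p` and is bounded below by `S`. -/
theorem exists_carleman (ι κ : Type*) [Fintype ι] [Fintype κ] {lam Ca Ka Kq CY Cd : ℝ}
    (hlam : 0 < lam) (hCa0 : 0 ≤ Ca) (hKa0 : 0 ≤ Ka) (hKq0 : 0 ≤ Kq) :
    ∃ γ S : ℝ, 0 < γ ∧ 0 < S ∧ ∀ {ev : ι → P} {ey : κ → P} {et : P} {a : ι → ι → P → ℝ}
      {q : ι → κ → P → ℝ} {p : P → ℝ} {w w' L g r : Lp ℝ 2 μ} {G : ι → Lp ℝ 2 μ}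
      {Y : κ → Lp ℝ 2 μ},
      IsElliptic ev ey a q w L G Y → WeakDeriv et w w' →
      (∀ i k, BddMeas (q i k)) → (∀ i j, BddMeas (a i j)) → (∀ i j, a i j = a j i) →
      (∀ i j z, |a i j z| ≤ Ca) →
      (∀ i j z (s : ℝ), |a i j (z + s • et) - a i j z| ≤ Ka * |s|) →
      (∀ i k z (s : ℝ), |q i k (z + s • et) - q i k z| ≤ Kq * |s|) →
      BddMeas p → WeakDeriv et (mulL μ p w) (mulL μ p w' - γ • mulL μ p w) →
      w' + mulL μ p w + L = g → ‖g‖ ≤ Cd * (‖w‖ + ∑ i, ‖G i‖) + ‖r‖ →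
      lam⁻¹ * ∑ i, ‖G i‖ ^ 2 ≤ ∑ i, ⟪G i, flux a G i⟫ →
      S * ‖w‖ ^ 2 ≤ ⟪mulL μ p w, w⟫ → (∀ k, ‖Y k‖ ≤ CY * ‖w‖) → ‖w‖ ≤ ‖r‖ := by
  set m : ℝ := (Fintype.card ι : ℝ) with hm
  set n : ℝ := (Fintype.card κ : ℝ) with hn
  have hm0 : 0 ≤ m := Nat.cast_nonneg _
  have hn0 : 0 ≤ n := Nat.cast_nonneg _
  set C₁ : ℝ := Ka * m + Kq * Ca * m * (m + (n * CY) ^ 2) with hC₁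
  set C₂ : ℝ := 3 * (1 + Cd ^ 2 * (1 + m)) with hC₂
  have hC₁0 : 0 ≤ C₁ := by positivity
  have hC₂0 : 0 < C₂ := by positivity
  refine ⟨2 * lam * (C₁ + C₂) + 1, (C₁ + C₂) * (4 + lam ^ 2 * C₂), by positivity, by positivity, ?_⟩
  intro ev ey et a q p w w' L g r G Y hE hw hq ha hsymm hCa hKa hKq hp hpw heq hg hell hS hY
  set Γ₁ := ∑ i, ‖G i‖ with hΓ₁
  set Γ := ∑ i, ‖G i‖ ^ 2 with hΓ
  have hΓ₁0 : 0 ≤ Γ₁ := Finset.sum_nonneg fun _ _ => norm_nonneg _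
  have hΓ0 : 0 ≤ Γ := Finset.sum_nonneg fun _ _ => sq_nonneg _
  have hΓΓ : Γ₁ ^ 2 ≤ m * Γ := by
    have := sq_sum_le_card_mul_sum_sq (s := Finset.univ) (f := fun i => ‖G i‖)
    rwa [Finset.card_univ] at this
  have hΛ : ∑ k, ‖Y k‖ ≤ n * CY * ‖w‖ := by
    refine (Finset.sum_le_sum fun k _ => hY k).trans_eq ?_
    rw [Finset.sum_const, Finset.card_univ, nsmul_eq_mul, mul_assoc]
  set Λ := ∑ k, ‖Y k‖ with hΛd
  have hΛ0 : 0 ≤ Λ := Finset.sum_nonneg fun _ _ => norm_nonneg _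
  have hcomm := hE.abs_inner_deriv_le hw hq ha hsymm hCa hCa0 hKa0 hKq0 hKa hKq
  have hB : Ka * Γ₁ ^ 2 + 2 * (Kq * Λ * (m * (Ca * Γ₁))) ≤ C₁ * (Γ + ‖w‖ ^ 2) := by
    have h1 : 2 * (Λ * Γ₁) ≤ m * Γ + (n * CY) ^ 2 * ‖w‖ ^ 2 := by
      have : Λ ^ 2 ≤ (n * CY * ‖w‖) ^ 2 := pow_le_pow_left₀ hΛ0 hΛ 2
      nlinarith [sq_nonneg (Λ - Γ₁)]
    have h2 : 2 * (Kq * Λ * (m * (Ca * Γ₁))) ≤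
        Kq * Ca * m * (m * Γ + (n * CY) ^ 2 * ‖w‖ ^ 2) := by
      have := mul_le_mul_of_nonneg_left h1 (show 0 ≤ Kq * Ca * m by positivity)
      linarith
    have h3 : Ka * Γ₁ ^ 2 ≤ Ka * (m * Γ) := mul_le_mul_of_nonneg_left hΓΓ hKa0
    have h4 : 0 ≤ Ka * m * ‖w‖ ^ 2 := by positivity
    have h5 : 0 ≤ Kq * Ca * m * (m * ‖w‖ ^ 2) := by positivity
    have h6 : 0 ≤ Kq * Ca * m * ((n * CY) ^ 2 * Γ) := by positivity
    rw [hC₁]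
    linarith
  -- the gain from the weight: `⟪w', p w⟫` is an exact derivative up to `∂ₜ p = -γ p`
  have hpw2 : 2 * ⟪w', mulL μ p w⟫ = (2 * lam * (C₁ + C₂) + 1) * ⟪mulL μ p w, w⟫ := by
    have h1 := hw.inner_eq hpw
    rw [inner_sub_right, inner_smul_right, ← inner_mulL hp, ← inner_mulL hp] at h1
    have h2 : ⟪mulL μ p w, w'⟫ = ⟪w', mulL μ p w⟫ := real_inner_comm _ _
    linarith
  have hww : ⟪w', w⟫ = 0 := by
    have h1 := hw.inner_eq hw
    rw [real_inner_comm] at h1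
    linarith
  have hwL := hE.inner_self hq
  -- expand the square of `w' + (p w + L)` and drop the squares of both summands
  have h1 : (2 * lam * (C₁ + C₂) + 1) * ⟪mulL μ p w, w⟫ ≤ ‖g‖ ^ 2 + C₁ * (Γ + ‖w‖ ^ 2) := by
    have h2 : ‖g‖ ^ 2 = ‖w'‖ ^ 2 + 2 * ⟪w', mulL μ p w + L⟫ + ‖mulL μ p w + L‖ ^ 2 := by
      rw [← heq, add_assoc, norm_add_sq_real]
    rw [inner_add_right] at h2
    have h3 := (abs_le.1 hcomm).1
    have h4 := sq_nonneg ‖w'‖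
    have h5 := sq_nonneg ‖mulL μ p w + L‖
    have h6 : -(2 * ⟪w', L⟫) ≤ C₁ * (Γ + ‖w‖ ^ 2) := (neg_le_abs _).trans (hcomm.trans hB)
    rw [h2, ← hpw2]
    linarith only [h4, h5, h6]
  have h2 : ‖g‖ ^ 2 ≤ C₂ * (‖w‖ ^ 2 + Γ + ‖r‖ ^ 2) := by
    have h3 : ‖g‖ ^ 2 ≤ (Cd * (‖w‖ + Γ₁) + ‖r‖) ^ 2 := pow_le_pow_left₀ (norm_nonneg _) hg 2
    exact h3.trans (three_sq_le hm0 hΓ0 hΓΓ)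
  -- the energy estimate: test the equation with `w`
  have h3 : lam⁻¹ * Γ ≤ ⟪mulL μ p w, w⟫ + ‖g‖ * √(‖w‖ ^ 2) := by
    rw [Real.sqrt_sq (norm_nonneg _)]
    have h4 : ⟪g, w⟫ = ⟪mulL μ p w, w⟫ + ⟪w, L⟫ := by
      rw [← heq, inner_add_left, inner_add_left, hww, real_inner_comm L w]; ring
    have h5 := (abs_le.1 (abs_real_inner_le_norm g w)).1
    linarith
  have := absorb hlam hC₁0 hC₂0 (sq_nonneg ‖w‖) h1 (sq_nonneg ‖r‖) h2 h3 le_rfl hS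
  exact le_of_sq_le_sq this (norm_nonneg _)

end Carleman

/-! ### Products of multipliers -/

section MulAlgebra

variable {Q : Type*} [MeasurableSpace Q] {μ : Measure Q}

theorem BddMeas.mul {b c : Q → ℝ} (hb : BddMeas b) (hc : BddMeas c) :
    BddMeas fun z => b z * c z := by
  obtain ⟨B, hB⟩ := hb.2
  obtain ⟨C, hC⟩ := hc.2
  refine ⟨hb.1.mul hc.1, B * C, fun z => ?_⟩
  rw [abs_mul]
  exact mul_le_mul (hB z) (hC z) (abs_nonneg _) ((abs_nonneg _).trans (hB z))

theorem mulL_mulL {b c : Q → ℝ} (hb : BddMeas b) (hc : BddMeas c) (f : Lp ℝ 2 μ) :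
    mulL μ b (mulL μ c f) = mulL μ (fun z => b z * c z) f := by
  apply Lp.ext
  filter_upwards [coeFn_mulL hb (mulL μ c f), coeFn_mulL hc f, coeFn_mulL (hb.mul hc) f]
    with z h1 h2 h3
  rw [h1, h2, h3, mul_assoc]

theorem mulL_comm {b c : Q → ℝ} (hb : BddMeas b) (hc : BddMeas c) (f : Lp ℝ 2 μ) :
    mulL μ b (mulL μ c f) = mulL μ c (mulL μ b f) := by
  rw [mulL_mulL hb hc, mulL_mulL hc hb]
  simp only [mul_comm]

/-- A linear relation between multipliers passes to the multiplication operators. -/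
theorem mulL_add_smul {b c d : Q → ℝ} (hb : BddMeas b) (hc : BddMeas c) (hd : BddMeas d) {r : ℝ}
    (h : ∀ z, b z = c z + r * d z) (f : Lp ℝ 2 μ) :
    mulL μ b f = mulL μ c f + r • mulL μ d f := by
  apply Lp.ext
  filter_upwards [coeFn_mulL hb f, coeFn_mulL hc f, coeFn_mulL hd f,
    Lp.coeFn_add (mulL μ c f) (r • mulL μ d f), Lp.coeFn_smul r (mulL μ d f)] with z h1 h2 h3 h4 h5
  rw [h1, h4, Pi.add_apply, h5, Pi.smul_apply, h2, h3, h, smul_eq_mul]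
  ring

end MulAlgebra

/-! ### The equation in straightened coordinates -/

section Slab

variable {m n : ℕ} {T : ℝ}

instance isAddHaarMeasure_volume_pt (m n : ℕ) :
    (volume : Measure (Pt m n)).IsAddHaarMeasure :=
  have : (volume : Measure (EuclideanSpace ℝ (Fin m) × EuclideanSpace ℝ (Fin n))).IsAddHaarMeasure :=
    Measure.prod.instIsAddHaarMeasure _ _
  Measure.prod.instIsAddHaarMeasure _ _

/-- The unit vector of the time direction. -/
def et (m n : ℕ) : Pt m n := (1, 0, 0)

/-- The unit vectors of the `v` directions. -/
noncomputable def ev (n : ℕ) {m : ℕ} (i : Fin m) : Pt m n := (0, EuclideanSpace.single i 1, 0)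

/-- The unit vectors of the `w` directions. -/
noncomputable def ey (m : ℕ) {n : ℕ} (k : Fin n) : Pt m n := (0, 0, EuclideanSpace.single k 1)

/-- The function `θ(t)` on the slab `0 < t < T`, extended by `0`. -/
noncomputable def cut (T : ℝ) (θ : ℝ → ℝ) (z : Pt m n) : ℝ := (Ioo 0 T).indicator θ z.1

theorem bddMeas_cut {θ : ℝ → ℝ} (hm : Measurable θ) {C : ℝ} (hC0 : 0 ≤ C)
    (hC : ∀ t ∈ Ioo 0 T, |θ t| ≤ C) : BddMeas (cut T θ : Pt m n → ℝ) := by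
  refine ⟨(hm.indicator measurableSet_Ioo).comp measurable_fst, C, fun z => ?_⟩
  by_cases hz : z.1 ∈ Ioo 0 T
  · rw [cut, indicator_of_mem hz]; exact hC _ hz
  · rw [cut, indicator_of_notMem hz, abs_zero]; exact hC0

theorem bddMeas_cut_of_continuous {θ : ℝ → ℝ} (h : Continuous θ) :
    BddMeas (cut T θ : Pt m n → ℝ) := by
  obtain ⟨C, hC⟩ := (isCompact_Icc (a := (0 : ℝ)) (b := T)).exists_bound_of_continuousOn
    h.continuousOn
  exact bddMeas_cut h.measurable (le_max_right C 0) fun t ht =>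
    (hC t (Ioo_subset_Icc_self ht)).trans (le_max_left _ _)

theorem cut_mul (θ η : ℝ → ℝ) (z : Pt m n) :
    cut T θ z * cut T η z = cut T (fun t => θ t * η t) z := by
  by_cases hz : z.1 ∈ Ioo 0 T <;> simp [cut, hz]

theorem mulL_cut_cut {θ η ζ : ℝ → ℝ} {μ : Measure (Pt m n)}
    (hθ : BddMeas (cut T θ : Pt m n → ℝ)) (hη : BddMeas (cut T η : Pt m n → ℝ))
    (h : ∀ t, θ t * η t = ζ t) (f : Lp ℝ 2 μ) :
    mulL μ (cut T θ) (mulL μ (cut T η) f) = mulL μ (cut T ζ) f := by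
  rw [mulL_mulL hθ hη]
  simp only [cut_mul, h]

theorem le_inner_mulL {μ : Measure (Pt m n)} {w : Lp ℝ 2 μ} (hw : mulL μ (cut T fun _ => 1) w = w)
    {p : ℝ → ℝ} (hp : BddMeas (cut T p : Pt m n → ℝ)) {S : ℝ} (hS : ∀ t ∈ Ioo 0 T, S ≤ p t) :
    S * ‖w‖ ^ 2 ≤ ⟪mulL μ (cut T p) w, w⟫ := by
  rw [← real_inner_self_eq_norm_sq, inner_eq_integral, inner_eq_integral, ← integral_const_mul]
  refine integral_mono_ae ((integrable_mul_L2 w w).const_mul S) (integrable_mul_L2 _ w) ?_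
  have h1 := coeFn_mulL (bddMeas_cut_of_continuous (m := m) (n := n) (T := T)
    (continuous_const (y := (1 : ℝ)))) w
  rw [hw] at h1
  filter_upwards [coeFn_mulL hp w, h1] with z h2 h3
  rw [h2]
  by_cases hz : z.1 ∈ Ioo 0 T
  · simp only [cut, indicator_of_mem hz, mul_assoc]
    exact mul_le_mul_of_nonneg_right (hS _ hz) (mul_self_nonneg _)
  · rw [h3]; simp [cut, hz]

/-- The coefficients of the equation in characteristic coordinates, as functions on the whole
space. They are independent of the last variable, and only their values for `0 < t < T` matter. -/
structure FlatCoeff (lam T : ℝ) (a : Fin m → Fin m → Pt m n → ℝ) (q : Fin m → Fin n → Pt m n → ℝ)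
    (c : Pt m n → ℝ) (d : Fin m → Pt m n → ℝ) : Prop where
  bddMeas_a : ∀ i j, BddMeas (a i j)
  symm : ∀ i j, a i j = a j i
  lipschitz_a : ∃ K, 0 ≤ K ∧ ∀ i j z (s : ℝ), |a i j (z + s • et m n) - a i j z| ≤ K * |s|
  a_invariant : ∀ i j z y, a i j (z + (0, 0, y)) = a i j z
  elliptic : ∀ z : Pt m n, z.1 ∈ Ioo 0 T → ∀ ξ : Fin m → ℝ,
    lam⁻¹ * ∑ i, ξ i ^ 2 ≤ ∑ i, ∑ j, a i j z * ξ i * ξ j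
  bddMeas_q : ∀ i k, BddMeas (q i k)
  smooth_q : ∀ i k, ContDiff ℝ ∞ (q i k)
  lipschitz_q : ∃ K, 0 ≤ K ∧ ∀ i k z (s : ℝ), |q i k (z + s • et m n) - q i k z| ≤ K * |s|
  q_invariant : ∀ i k z y, q i k (z + (0, 0, y)) = q i k z
  bddMeas_c : BddMeas c
  c_invariant : ∀ z y, c (z + (0, 0, y)) = c z
  bddMeas_d : ∀ i, BddMeas (d i)
  d_invariant : ∀ i z y, d i (z + (0, 0, y)) = d i z

/-- `u` solves `∂ₜ u + ∑ᵢ Dᵢ (∑ⱼ aᵢⱼ Dⱼ u) = c u + ∑ᵢ dᵢ Dᵢ u` for `0 < t < T`, with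
`Dᵢ = ∂_{vᵢ} + ∑ₖ qᵢₖ ∂_{yₖ}`, `f = ∂ₜ u`, `G i = Dᵢ u`, and `u` vanishes at `t = 0`. All this is
expressed by equations on the whole space for the products `θ(t) u`, extended by `0` to
`t ≤ 0`, where `θ` vanishes for `t ≥ t₂`. -/
structure IsFlatSolution (T t₂ : ℝ) (a : Fin m → Fin m → Pt m n → ℝ)
    (q : Fin m → Fin n → Pt m n → ℝ) (c : Pt m n → ℝ) (d : Fin m → Pt m n → ℝ)
    (u f : Lp ℝ 2 (volume : Measure (Pt m n))) (G : Fin m → Lp ℝ 2 (volume : Measure (Pt m n))) :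
    Prop where
  deriv_t : ∀ θ : ℝ → ℝ, ContDiff ℝ ∞ θ → (∀ t, t₂ ≤ t → θ t = 0) →
    WeakDeriv (et m n) (mulL volume (cut T θ) u)
      (mulL volume (cut T θ) f + mulL volume (cut T (deriv θ)) u)
  deriv_v : ∀ θ : ℝ → ℝ, ContDiff ℝ ∞ θ → (∀ t, t₂ ≤ t → θ t = 0) → ∀ i,
    WeakDiv (fun o : Option (Fin n) => o.elim (ev n i) (ey m))
      (fun o => o.elim (mulL volume (cut T θ) u)
        fun k => mulL volume (q i k) (mulL volume (cut T θ) u)) (mulL volume (cut T θ) (G i))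
  equation : ∀ θ : ℝ → ℝ, ContDiff ℝ ∞ θ → (∀ t, t₂ ≤ t → θ t = 0) →
    WeakDiv (Sum.elim (ev n) (ey m))
      (Sum.elim (flux a fun j => mulL volume (cut T θ) (G j))
        fun k => ∑ i, mulL volume (q i k) (flux a (fun j => mulL volume (cut T θ) (G j)) i))
      (mulL volume (cut T θ) (mulL volume c u + ∑ i, mulL volume (d i) (G i) - f))

theorem FlatCoeff.le_sum_inner_flux {lam : ℝ} {a : Fin m → Fin m → Pt m n → ℝ}
    {q : Fin m → Fin n → Pt m n → ℝ} {c : Pt m n → ℝ} {d : Fin m → Pt m n → ℝ}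
    (hc : FlatCoeff lam T a q c d) {G : Fin m → Lp ℝ 2 (volume : Measure (Pt m n))}
    (hG : ∀ i, mulL volume (cut T fun _ => 1) (G i) = G i) :
    lam⁻¹ * ∑ i, ‖G i‖ ^ 2 ≤ ∑ i, ⟪G i, flux a G i⟫ := by
  simp only [flux, inner_sum, ← real_inner_self_eq_norm_sq, inner_eq_integral]
  simp only [← integral_finsetSum Finset.univ fun j _ => integrable_mul_L2 (G _) (mulL volume (a _ j) (G j))]
  rw [← integral_finsetSum Finset.univ fun i _ => integrable_mul_L2 (G i) (G i),
    ← integral_finsetSum Finset.univ fun i _ => integrable_finsetSum Finset.univ fun j _ =>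
      integrable_mul_L2 (G i) (mulL volume (a i j) (G j)), ← integral_const_mul]
  refine integral_mono_ae ((integrable_finsetSum Finset.univ fun i _ =>
    integrable_mul_L2 (G i) (G i)).const_mul _) (integrable_finsetSum Finset.univ fun i _ =>
      integrable_finsetSum Finset.univ fun j _ => integrable_mul_L2 (G i) _) ?_
  have h1 : ∀ᵐ z, ∀ i j, mulL volume (a i j) (G j) z = a i j z * G j z := by
    rw [ae_all_iff]; intro i; rw [ae_all_iff]; exact fun j => coeFn_mulL (hc.bddMeas_a i j) _
  have h2 : ∀ᵐ z, ∀ i, G i z = cut T (fun _ => 1) z * G i z := by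
    rw [ae_all_iff]
    intro i
    have := coeFn_mulL (bddMeas_cut_of_continuous (m := m) (n := n) (T := T)
      (continuous_const (y := (1 : ℝ)))) (G i)
    rwa [hG i] at this
  filter_upwards [h1, h2] with z h1 h2
  by_cases hz : z.1 ∈ Ioo 0 T
  · have := hc.elliptic z hz fun i => G i z
    simp only [h1]
    calc _ = lam⁻¹ * ∑ i, G i z ^ 2 := by simp only [sq]
      _ ≤ _ := this
      _ = _ := Finset.sum_congr rfl fun i _ => Finset.sum_congr rfl fun j _ => by ring
  · have h0 : ∀ i, G i z = 0 := fun i => by rw [h2 i]; simp [cut, hz]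
    simp [h0]

theorem WeakDeriv.of_smul {P : Type*} [NormedAddCommGroup P] [NormedSpace ℝ P]
    [FiniteDimensional ℝ P] [MeasurableSpace P] [BorelSpace P] {μ : Measure P} [μ.IsAddHaarMeasure]
    {e : P} {f g : Lp ℝ 2 μ} {r : ℝ} (hr : r ≠ 0) (h : WeakDeriv (r • e) f g) :
    WeakDeriv e f (r⁻¹ • g) := by
  intro ψ hψ
  rw [inner_smul_right, h ψ hψ]
  have h1 : toL2 μ (fun z => fderiv ℝ ψ z (r • e)) = r • toL2 μ (fun z => fderiv ℝ ψ z e) := by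
    apply toL2_congr
    filter_upwards [Lp.coeFn_smul r (toL2 μ (fun z => fderiv ℝ ψ z e)),
      coeFn_toL2 (hψ.fderiv_apply e).memLp] with z h2 h3
    rw [h2, Pi.smul_apply, h3, map_smul]
  rw [h1, inner_smul_left]
  simp only [conj_trivial]
  field_simp

/-- The weak gradient of a band-limited average: once the `y`-derivatives are known to be in `L²`,
so are the `v`-derivatives. -/
theorem weakDeriv_of_weakDiv_option {q : Fin n → Pt m n → ℝ} (hq : ∀ k, BddMeas (q k))
    (hs : ∀ k, ContDiff ℝ ∞ (q k)) (hinv : ∀ k z y, q k (z + (0, 0, y)) = q k z) {e : Pt m n}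
    {w g : Lp ℝ 2 (volume : Measure (Pt m n))} {Y : Fin n → Lp ℝ 2 (volume : Measure (Pt m n))}
    (h : WeakDiv (fun o : Option (Fin n) => o.elim e (ey m))
      (fun o => o.elim w fun k => mulL volume (q k) w) g)
    (hY : ∀ k, WeakDeriv (ey m k) w (Y k)) :
    WeakDeriv e w (g - ∑ k, mulL volume (q k) (Y k)) := by
  intro ψ hψ
  have h1 := h ψ hψ
  rw [Fintype.sum_option] at h1
  simp only [Option.elim] at h1
  have h2 : ∀ k, ⟪toL2 volume ψ, mulL volume (q k) (Y k)⟫ =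
      -⟪toL2 volume (fun z => fderiv ℝ ψ z (ey m k)), mulL volume (q k) w⟫ := by
    intro k
    have hz : (fun z => fderiv ℝ (q k) z (ey m k)) = fun _ => 0 := by
      ext z
      have hd := ((hs k).differentiable (by simp) z).hasFDerivAt.hasLineDerivAt (ey m k)
      have hc : HasLineDerivAt ℝ (q k) 0 z (ey m k) := by
        have : (fun t : ℝ => q k (z + t • ey m k)) = fun _ => q k z := by
          ext t
          rw [← hinv k z (t • EuclideanSpace.single k 1)]
          simp [ey]
        rw [HasLineDerivAt, this]
        exact hasDerivAt_const _ _
      exact hd.unique hc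
    have hzero : BddMeas fun z => fderiv ℝ (q k) z (ey m k) := by
      rw [hz]; exact ⟨measurable_const, 0, fun z => by simp⟩
    have h3 := (hY k).mul (hs k) (hq k) hzero
    rw [hz, mulL_zero, add_zero] at h3
    exact h3 ψ hψ
  rw [inner_sub_right, inner_sum, h1]
  simp only [h2, Finset.sum_neg_distrib]
  ring

end Slab

/-! ### Uniqueness in straightened coordinates -/

section Uniqueness

variable {m n : ℕ} {T t₂ lam : ℝ} {a : Fin m → Fin m → Pt m n → ℝ}
  {q : Fin m → Fin n → Pt m n → ℝ} {c : Pt m n → ℝ} {d : Fin m → Pt m n → ℝ}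
  {u f : Lp ℝ 2 (volume : Measure (Pt m n))} {G : Fin m → Lp ℝ 2 (volume : Measure (Pt m n))}

/-- The inclusion of the last factor. -/
noncomputable def inclY (m n : ℕ) : EuclideanSpace ℝ (Fin n) →L[ℝ] Pt m n :=
  (ContinuousLinearMap.inr ℝ ℝ (EuclideanSpace ℝ (Fin m) × EuclideanSpace ℝ (Fin n))).comp
    (ContinuousLinearMap.inr ℝ (EuclideanSpace ℝ (Fin m)) (EuclideanSpace ℝ (Fin n)))

theorem inclY_apply (y : EuclideanSpace ℝ (Fin n)) : inclY m n y = (0, 0, y) := rfl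

theorem smul_inclY_apply (r : ℝ) (y : EuclideanSpace ℝ (Fin n)) :
    (r • inclY m n) y = (0, 0, r • y) := by
  rw [smul_apply, inclY_apply]
  simp

theorem cut_add_smul_inclY (θ : ℝ → ℝ) (r : ℝ) (z : Pt m n) (y : EuclideanSpace ℝ (Fin n)) :
    cut T θ (z + (r • inclY m n) y) = cut T θ z := by
  rw [smul_inclY_apply, cut, cut]; simp

theorem flux_avg {K : EuclideanSpace ℝ (Fin n) → ℝ} (hK : Integrable K) (r : ℝ)
    (ha : ∀ i j, BddMeas (a i j)) (hinv : ∀ i j z y, a i j (z + (0, 0, y)) = a i j z)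
    (G : Fin m → Lp ℝ 2 (volume : Measure (Pt m n))) (i : Fin m) :
    flux a (fun j => avg volume (r • inclY m n) hK (G j)) i =
      avg volume (r • inclY m n) hK (flux a G i) := by
  simp only [flux, map_sum]
  refine Finset.sum_congr rfl fun j _ => mulL_avg _ hK (ha i j) (fun z y => ?_) _
  rw [smul_inclY_apply, hinv]

/-- The band-limited averages of `θ u` solve the elliptic part of the equation, now with
`y`-derivatives in `L²`. -/
theorem IsFlatSolution.isElliptic_avg (h : IsFlatSolution T t₂ a q c d u f G)
    (hc : FlatCoeff lam T a q c d) {K : EuclideanSpace ℝ (Fin n) → ℝ} (hK : Integrable K) (r : ℝ)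
    {θ : ℝ → ℝ} (hθ : ContDiff ℝ ∞ θ) (hθ₂ : ∀ t, t₂ ≤ t → θ t = 0)
    {Y : Fin n → Lp ℝ 2 (volume : Measure (Pt m n))}
    (hY : ∀ k, WeakDeriv (ey m k) (avg volume (r • inclY m n) hK (mulL volume (cut T θ) u)) (Y k)) :
    IsElliptic (ev n) (ey m) a q (avg volume (r • inclY m n) hK (mulL volume (cut T θ) u))
      (avg volume (r • inclY m n) hK
        (mulL volume (cut T θ) (mulL volume c u + ∑ i, mulL volume (d i) (G i) - f)))
      (fun i => avg volume (r • inclY m n) hK (mulL volume (cut T θ) (G i))) Y where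
  deriv_v i := by
    refine weakDeriv_of_weakDiv_option (hc.bddMeas_q i) (hc.smooth_q i) (hc.q_invariant i) ?_ hY
    have h1 := (h.deriv_v θ hθ hθ₂ i).avg (r • inclY m n) hK
    convert h1 using 2 with o
    cases o with
    | none => rfl
    | some k =>
      refine mulL_avg _ hK (hc.bddMeas_q i k) (fun z y => ?_) _
      rw [smul_inclY_apply, hc.q_invariant]
  deriv_y := hY
  weakDiv := by
    have h1 := (h.equation θ hθ hθ₂).avg (r • inclY m n) hK
    convert h1 using 2 with o
    cases o with
    | inl i => exact flux_avg hK r hc.bddMeas_a hc.a_invariant _ i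
    | inr k =>
      simp only [Sum.elim_inr, map_sum]
      refine Finset.sum_congr rfl fun i _ => ?_
      rw [flux_avg hK r hc.bddMeas_a hc.a_invariant _ i]
      refine mulL_avg _ hK (hc.bddMeas_q i k) (fun z y => ?_) _
      rw [smul_inclY_apply, hc.q_invariant]

/-- Bernstein's inequality: the reproducing kernel bounds the derivatives of a band-limited average
by the average itself. -/
theorem exists_weakDeriv_avg {K K' : EuclideanSpace ℝ (Fin n) → ℝ} (hK : Integrable K)
    (hK' : Integrable K') (hd : Differentiable ℝ K')
    (hd' : ∀ e, Integrable fun y => fderiv ℝ K' y e)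
    (hrep : ∀ y, ∫ x, K' x * K (y - x) = K y) {r : ℝ} (hr : r ≠ 0) :
    ∃ C, ∀ w : Lp ℝ 2 (volume : Measure (Pt m n)), ∃ Y : Fin n → Lp ℝ 2 (volume : Measure (Pt m n)),
      (∀ k, WeakDeriv (ey m k) (avg volume (r • inclY m n) hK w) (Y k)) ∧
      ∀ k, ‖Y k‖ ≤ C * ‖avg volume (r • inclY m n) hK w‖ := by
  let D : Fin n → Lp ℝ 2 (volume : Measure (Pt m n)) →L[ℝ] Lp ℝ 2 (volume : Measure (Pt m n)) :=
    fun k => r⁻¹ • -avg volume (r • inclY m n) (hd' (EuclideanSpace.single k 1))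
  refine ⟨∑ k, ‖D k‖, fun w => ⟨fun k => D k (avg volume (r • inclY m n) hK w), fun k => ?_,
    fun k => ?_⟩⟩
  · refine WeakDeriv.of_smul hr ?_
    have h1 := weakDeriv_avg (μ := (volume : Measure (Pt m n))) (r • inclY m n) hK' hd
      (hd' (EuclideanSpace.single k 1)) (avg volume (r • inclY m n) hK w)
    rw [avg_avg _ hK hK' hK hrep] at h1
    have h2 : (r • inclY m n) (EuclideanSpace.single k 1) = r • ey m k := by
      rw [smul_inclY_apply, ey]; simp
    rwa [h2] at h1
  · refine ((D k).le_opNorm _).trans (mul_le_mul_of_nonneg_right ?_ (norm_nonneg _))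
    exact Finset.single_le_sum (f := fun k => ‖D k‖) (fun _ _ => norm_nonneg _) (Finset.mem_univ k)

/-- The smooth cutoff in time, `1` for `t ≤ t₁` and `0` for `t ≥ t₂`. -/
noncomputable def timeCutoff (t₁ t₂ t : ℝ) : ℝ := Real.smoothTransition ((t₂ - t) / (t₂ - t₁))

theorem contDiff_timeCutoff (t₁ t₂ : ℝ) : ContDiff ℝ ∞ (timeCutoff t₁ t₂) :=
  Real.smoothTransition.contDiff.comp ((contDiff_const.sub contDiff_id).div_const _)

theorem timeCutoff_eq_one {t₁ t₂ t : ℝ} (h : t₁ < t₂) (ht : t ≤ t₁) : timeCutoff t₁ t₂ t = 1 :=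
  Real.smoothTransition.one_of_one_le ((one_le_div (by linarith)).2 (by linarith))

theorem timeCutoff_eq_zero {t₁ t₂ t : ℝ} (h : t₁ < t₂) (ht : t₂ ≤ t) : timeCutoff t₁ t₂ t = 0 :=
  Real.smoothTransition.zero_of_nonpos (div_nonpos_of_nonpos_of_nonneg (by linarith) (by linarith))

theorem deriv_timeCutoff_eq_zero {t₁ t₂ t : ℝ} (h : t₁ < t₂) (ht : t < t₁) :
    deriv (timeCutoff t₁ t₂) t = 0 := by
  have : timeCutoff t₁ t₂ =ᶠ[𝓝 t] fun _ => 1 := by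
    filter_upwards [Iio_mem_nhds ht] with s hs
    exact timeCutoff_eq_one h (le_of_lt hs)
  rw [this.deriv_eq, deriv_const]

set_option maxHeartbeats 2000000 in
/-- The Carleman estimate for the averages: if `θ' = ρ - p θ` with `p' = -γ p` large, then `θ u` is
controlled by `ρ u`. -/
theorem IsFlatSolution.exists_norm_avg_le (h : IsFlatSolution T t₂ a q c d u f G)
    (hlam : 0 < lam) (hc : FlatCoeff lam T a q c d) {K K' : EuclideanSpace ℝ (Fin n) → ℝ}
    (hK : Integrable K) (hK' : Integrable K') (hd : Differentiable ℝ K')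
    (hd' : ∀ e, Integrable fun y => fderiv ℝ K' y e)
    (hrep : ∀ y, ∫ x, K' x * K (y - x) = K y) {r : ℝ} (hr : r ≠ 0) :
    ∃ γ S : ℝ, 0 < γ ∧ 0 < S ∧ ∀ θ p ρ : ℝ → ℝ, ContDiff ℝ ∞ θ → ContDiff ℝ ∞ p → Continuous ρ →
      (∀ t, t₂ ≤ t → θ t = 0) → (∀ t, deriv θ t = ρ t - p t * θ t) →
      (∀ t, deriv p t = -γ * p t) → (∀ t ∈ Ioo 0 T, S ≤ p t) →
      ‖avg volume (r • inclY m n) hK (mulL volume (cut T θ) u)‖ ≤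
      ‖avg volume (r • inclY m n) hK (mulL volume (cut T ρ) u)‖ := by
  obtain ⟨Ka, hKa0, hKa⟩ := hc.lipschitz_a
  obtain ⟨Kq, hKq0, hKq⟩ := hc.lipschitz_q
  obtain ⟨Ca, hCa0, hCa⟩ : ∃ Ca, 0 ≤ Ca ∧ ∀ i j z, |a i j z| ≤ Ca := by
    choose C hC using fun i j => (hc.bddMeas_a i j).2
    refine ⟨∑ i, ∑ j, |C i j|, by positivity, fun i j z => (hC i j z).trans ((le_abs_self _).trans ?_)⟩
    refine (Finset.single_le_sum (f := fun j => |C i j|) (fun _ _ => abs_nonneg _)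
      (Finset.mem_univ j)).trans ?_
    exact Finset.single_le_sum (f := fun i => ∑ j, |C i j|)
      (fun _ _ => Finset.sum_nonneg fun _ _ => abs_nonneg _) (Finset.mem_univ i)
  obtain ⟨Cd, hCdc, hCdd⟩ : ∃ Cd, (∀ z, |c z| ≤ Cd) ∧ ∀ i z, |d i z| ≤ Cd := by
    choose C hC using fun i => (hc.bddMeas_d i).2
    obtain ⟨C', hC'⟩ := hc.bddMeas_c.2
    refine ⟨|C'| + ∑ i, |C i|, fun z => ?_, fun i z => ?_⟩
    · have : 0 ≤ ∑ i, |C i| := Finset.sum_nonneg fun _ _ => abs_nonneg _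
      linarith [hC' z, le_abs_self C']
    · have := Finset.single_le_sum (f := fun i => |C i|) (fun _ _ => abs_nonneg _)
        (Finset.mem_univ i)
      linarith [hC i z, le_abs_self (C i), abs_nonneg C']
  obtain ⟨CY, hCY⟩ := exists_weakDeriv_avg (m := m) hK hK' hd hd' hrep hr
  obtain ⟨γ, S, hγ, hS, key⟩ := exists_carleman (P := Pt m n) (μ := volume) (Fin m) (Fin n)
    (CY := CY) (Cd := Cd) hlam hCa0 hKa0 hKq0
  refine ⟨γ, S, hγ, hS, fun θ p ρ hθ hps hρ hθ₂ hθ' hpd hSp => ?_⟩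
  set A := avg (volume : Measure (Pt m n)) (r • inclY m n) hK with hA
  have hpθs : ContDiff ℝ ∞ fun t => p t * θ t := hps.mul hθ
  have hpθ' : ∀ t, deriv (fun t => p t * θ t) t = p t * deriv θ t - γ * (p t * θ t) := fun t => by
    rw [deriv_fun_mul (hps.differentiable (by simp) t) (hθ.differentiable (by simp) t), hpd]
    ring
  have hdθc : Continuous (deriv θ) := hθ.continuous_deriv (by simp)
  have bρ : BddMeas (cut T ρ : Pt m n → ℝ) := bddMeas_cut_of_continuous hρ
  have bθ : BddMeas (cut T θ : Pt m n → ℝ) := bddMeas_cut_of_continuous hθ.continuous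
  have bp : BddMeas (cut T p : Pt m n → ℝ) := bddMeas_cut_of_continuous hps.continuous
  have bpθ : BddMeas (cut T (fun t => p t * θ t) : Pt m n → ℝ) :=
    bddMeas_cut_of_continuous hpθs.continuous
  have bdθ : BddMeas (cut T (deriv θ) : Pt m n → ℝ) := bddMeas_cut_of_continuous hdθc
  have bpdθ : BddMeas (cut T (fun t => p t * deriv θ t) : Pt m n → ℝ) :=
    bddMeas_cut_of_continuous (hps.continuous.mul hdθc)
  have bdpθ : BddMeas (cut T (deriv fun t => p t * θ t) : Pt m n → ℝ) :=
    bddMeas_cut_of_continuous (hpθs.continuous_deriv (by simp))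
  have b1 : BddMeas (cut T (fun _ => 1) : Pt m n → ℝ) := bddMeas_cut_of_continuous continuous_const
  -- the coefficients and cutoffs do not depend on `y`, so they commute with the average
  have hcutA : ∀ {η : ℝ → ℝ}, BddMeas (cut T η : Pt m n → ℝ) → ∀ x,
      mulL volume (cut T η) (A x) = A (mulL volume (cut T η) x) := fun hη x =>
    mulL_avg _ hK hη (cut_add_smul_inclY _ r) x
  have hcutpθ : ∀ x : Lp ℝ 2 (volume : Measure (Pt m n)),
      mulL volume (cut T p) (mulL volume (cut T θ) x) = mulL volume (cut T fun t => p t * θ t) x :=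
    mulL_cut_cut bp bθ fun t => rfl
  have hbA : ∀ {b : Pt m n → ℝ}, BddMeas b → (∀ z y, b (z + (0, 0, y)) = b z) →
      ∀ x : Lp ℝ 2 (volume : Measure (Pt m n)),
      mulL volume b (A (mulL volume (cut T θ) x)) =
        A (mulL volume (cut T θ) (mulL volume b x)) := by
    intro b hb hinv x
    rw [mulL_comm bθ hb]
    exact mulL_avg _ hK hb (fun z y => by rw [smul_inclY_apply, hinv]) _
  obtain ⟨Y, hY, hYC⟩ := hCY (mulL volume (cut T θ) u)
  have hw : WeakDeriv (et m n) (A (mulL volume (cut T θ) u))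
      (A (mulL volume (cut T θ) f + mulL volume (cut T (deriv θ)) u)) :=
    (h.deriv_t θ hθ hθ₂).avg (r • inclY m n) hK
  have hpw : WeakDeriv (et m n) (A (mulL volume (cut T fun t => p t * θ t) u))
      (A (mulL volume (cut T fun t => p t * θ t) f +
        mulL volume (cut T (deriv fun t => p t * θ t)) u)) :=
    (h.deriv_t _ hpθs fun t ht => by rw [hθ₂ t ht, mul_zero]).avg (r • inclY m n) hK
  have hpw' : WeakDeriv (et m n) (mulL volume (cut T p) (A (mulL volume (cut T θ) u)))
      (mulL volume (cut T p) (A (mulL volume (cut T θ) f + mulL volume (cut T (deriv θ)) u)) -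
        γ • mulL volume (cut T p) (A (mulL volume (cut T θ) u))) := by
    have h1 : mulL volume (cut T (deriv fun t => p t * θ t)) u =
        mulL volume (cut T fun t => p t * deriv θ t) u +
        (-γ) • mulL volume (cut T fun t => p t * θ t) u := by
      refine mulL_add_smul bdpθ bpdθ bpθ (fun z => ?_) u
      by_cases hz : z.1 ∈ Ioo 0 T
      · simp only [cut, indicator_of_mem hz, hpθ']; ring
      · simp [cut, hz]
    rw [h1, neg_smul, ← sub_eq_add_neg, ← add_sub_assoc, map_sub, map_smul] at hpw
    rw [hcutA bp, hcutA bp, map_add, hcutpθ, hcutpθ,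
      mulL_cut_cut (ζ := fun t => p t * deriv θ t) bp bdθ fun t => rfl]
    exact hpw
  -- the conjugated equation
  have heq : A (mulL volume (cut T θ) f + mulL volume (cut T (deriv θ)) u) +
      mulL volume (cut T p) (A (mulL volume (cut T θ) u)) +
      A (mulL volume (cut T θ) (mulL volume c u + ∑ i, mulL volume (d i) (G i) - f)) =
      mulL volume c (A (mulL volume (cut T θ) u)) +
      ∑ i, mulL volume (d i) (A (mulL volume (cut T θ) (G i))) +
      A (mulL volume (cut T ρ) u) := by
    have h1 : mulL volume (cut T (deriv θ)) u =
        mulL volume (cut T ρ) u + (-1 : ℝ) • mulL volume (cut T fun t => p t * θ t) u := by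
      refine mulL_add_smul bdθ bρ bpθ (fun z => ?_) u
      by_cases hz : z.1 ∈ Ioo 0 T
      · simp only [cut, indicator_of_mem hz, hθ']; ring
      · simp [cut, hz]
    have h2 : ∑ i, mulL volume (d i) (A (mulL volume (cut T θ) (G i))) =
        A (mulL volume (cut T θ) (∑ i, mulL volume (d i) (G i))) := by
      rw [map_sum, map_sum]
      exact Finset.sum_congr rfl fun i _ => hbA (hc.bddMeas_d i) (hc.d_invariant i) _
    rw [hcutA bp, hcutpθ, hbA hc.bddMeas_c hc.c_invariant, h2, h1, neg_one_smul]
    generalize ∑ i, mulL volume (d i) (G i) = D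
    simp only [map_add, map_sub, map_neg]
    abel
  have hnorm : ‖mulL volume c (A (mulL volume (cut T θ) u)) +
      ∑ i, mulL volume (d i) (A (mulL volume (cut T θ) (G i))) +
      A (mulL volume (cut T ρ) u)‖ ≤ Cd * (‖A (mulL volume (cut T θ) u)‖ +
        ∑ i, ‖A (mulL volume (cut T θ) (G i))‖) + ‖A (mulL volume (cut T ρ) u)‖ := by
    refine (norm_add_le _ _).trans (add_le_add ?_ le_rfl)
    refine (norm_add_le _ _).trans ?_
    rw [mul_add, Finset.mul_sum]
    refine add_le_add (norm_mulL_le hc.bddMeas_c hCdc _) ((norm_sum_le _ _).trans ?_)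
    exact Finset.sum_le_sum fun i _ => norm_mulL_le (hc.bddMeas_d i) (hCdd i) _
  refine key (h.isElliptic_avg hc hK r hθ hθ₂ hY) hw hc.bddMeas_q hc.bddMeas_a hc.symm hCa hKa hKq
    bp hpw' heq hnorm (hc.le_sum_inner_flux fun i => ?_) (le_inner_mulL ?_ bp hSp) hYC
  · rw [hcutA b1, mulL_cut_cut b1 bθ fun t => one_mul _]
  · rw [hcutA b1, mulL_cut_cut b1 bθ fun t => one_mul _]

theorem contDiff_weight (c γ : ℝ) : ContDiff ℝ ∞ fun t : ℝ => c * Real.exp (-γ * t) :=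
  contDiff_const.mul (Real.contDiff_exp.comp (contDiff_const.mul contDiff_id))

theorem deriv_weight (c γ t : ℝ) :
    deriv (fun t : ℝ => c * Real.exp (-γ * t)) t = -γ * (c * Real.exp (-γ * t)) := by
  have h1 := ((hasDerivAt_id' t).const_mul (-γ)).exp.const_mul c
  rw [h1.deriv]
  ring

set_option maxHeartbeats 2000000 in
/-- Uniqueness: letting the parameter `s` in the weight `exp (s γ⁻¹ exp (-γ t))` tend to infinity,
the averages of `u` vanish for `t < t₀`, and then so does `u`. -/
theorem IsFlatSolution.mulL_cut_eq_zero (h : IsFlatSolution T t₂ a q c d u f G)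
    (hlam : 0 < lam) (hc : FlatCoeff lam T a q c d) {t₀ : ℝ} (h0 : t₀ < t₂) :
    mulL volume (cut T ((Iio t₀).indicator fun _ => 1)) u = 0 := by
  obtain ⟨K, K', hK, hK', hd, hd', h1, hrep⟩ :=
    exists_reproducing_kernel (EuclideanSpace ℝ (Fin n))
  set v := mulL volume (cut T ((Iio t₀).indicator fun _ => 1)) u with hv
  have key : ∀ r : ℝ, r ≠ 0 → avg volume (r • inclY m n) hK v = 0 := by
    intro r hr
    obtain ⟨γ, S, hγ, hS, hle⟩ := h.exists_norm_avg_le hlam hc hK hK' hd hd' hrep hr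
    set A := avg (volume : Measure (Pt m n)) (r • inclY m n) hK with hA
    set t₁ := (t₀ + t₂) / 2 with ht₁
    have h01 : t₀ < t₁ := by rw [ht₁]; linarith
    have h12 : t₁ < t₂ := by rw [ht₁]; linarith
    set χ := timeCutoff t₁ t₂ with hχ
    have hχs : ContDiff ℝ ∞ χ := contDiff_timeCutoff t₁ t₂
    have hχc : Continuous (deriv χ) := hχs.continuous_deriv (by simp)
    -- `E s` is the Carleman weight, a decreasing function of `t`
    set φ : ℝ → ℝ → ℝ := fun s t => s / γ * Real.exp (-γ * t) with hφ
    have hφs : ∀ s, ContDiff ℝ ∞ (φ s) := fun s => contDiff_weight (s / γ) γ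
    have hE : ∀ s, ContDiff ℝ ∞ fun t => Real.exp (φ s t) := fun s => Real.contDiff_exp.comp (hφs s)
    have hanti : ∀ s, 0 ≤ s → ∀ x y, x ≤ y → φ s y ≤ φ s x := fun s hs x y hxy =>
      mul_le_mul_of_nonneg_left (Real.exp_le_exp.2 (by nlinarith)) (div_nonneg hs hγ.le)
    have bound : ∀ s, S * Real.exp (γ * T) ≤ s →
        ‖A v‖ ≤ Real.exp (φ s t₁ - φ s t₀) * ‖A (mulL volume (cut T (deriv χ)) u)‖ := by
      intro s hs
      have hs0 : 0 ≤ s := (by positivity : (0 : ℝ) ≤ S * Real.exp (γ * T)).trans hs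
      have main := hle (fun t => χ t * Real.exp (φ s t)) (fun t => s * Real.exp (-γ * t))
        (fun t => deriv χ t * Real.exp (φ s t)) (hχs.mul (hE s)) (contDiff_weight s γ)
        (hχc.mul (hE s).continuous)
        (fun t ht => by rw [hχ, timeCutoff_eq_zero h12 ht, zero_mul])
        (fun t => by
          have h3 : HasDerivAt (φ s) (-γ * φ s t) t := by
            rw [← deriv_weight (s / γ) γ t]
            exact ((hφs s).differentiable (by simp) t).hasDerivAt
          rw [((hχs.differentiable (by simp) t).hasDerivAt.fun_mul h3.exp).deriv]
          simp only [hφ]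
          field_simp
          ring)
        (fun t => deriv_weight s γ t)
        (fun t ht => by
          have h3 : S * Real.exp (γ * T) * Real.exp (-γ * T) = S := by
            rw [mul_assoc, ← Real.exp_add]; simp
          have h4 : Real.exp (-γ * T) ≤ Real.exp (-γ * t) :=
            Real.exp_le_exp.2 (by nlinarith [ht.2])
          calc S = S * Real.exp (γ * T) * Real.exp (-γ * T) := h3.symm
            _ ≤ s * Real.exp (-γ * T) := mul_le_mul_of_nonneg_right hs (Real.exp_pos _).le
            _ ≤ s * Real.exp (-γ * t) := mul_le_mul_of_nonneg_left h4 hs0)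
      have bθ : BddMeas (cut T (fun t => χ t * Real.exp (φ s t)) : Pt m n → ℝ) :=
        bddMeas_cut_of_continuous (hχs.continuous.mul (hE s).continuous)
      have bχ : BddMeas (cut T (deriv χ) : Pt m n → ℝ) := bddMeas_cut_of_continuous hχc
      have mE : Measurable fun t => Real.exp (φ s t) := (hE s).continuous.measurable
      -- multiplication by `exp (-φ)` on `t < t₀` recovers `v`
      have lower : ‖A v‖ ≤ Real.exp (-φ s t₀) *
          ‖A (mulL volume (cut T fun t => χ t * Real.exp (φ s t)) u)‖ := by
        set η : ℝ → ℝ := (Iio t₀).indicator fun t => Real.exp (-φ s t) with hη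
        have hηb : ∀ t, |η t| ≤ Real.exp (-φ s t₀) := fun t => by
          by_cases ht : t ∈ Iio t₀
          · rw [hη, indicator_of_mem ht, abs_of_pos (Real.exp_pos _)]
            exact Real.exp_le_exp.2 (neg_le_neg (hanti s hs0 _ _ (le_of_lt ht)))
          · rw [hη, indicator_of_notMem ht, abs_zero]; exact (Real.exp_pos _).le
        have mη : Measurable η :=
          ((Real.measurable_exp.comp (hφs s).continuous.measurable.neg)).indicator measurableSet_Iio
        have bη : BddMeas (cut T η : Pt m n → ℝ) :=
          bddMeas_cut mη (Real.exp_pos _).le fun t _ => hηb t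
        have h3 : mulL volume (cut T η)
            (A (mulL volume (cut T fun t => χ t * Real.exp (φ s t)) u)) = A v := by
          rw [hA, mulL_avg _ hK bη (cut_add_smul_inclY _ r), hv]
          congr 1
          refine mulL_cut_cut bη bθ (fun t => ?_) u
          by_cases ht : t ∈ Iio t₀
          · rw [hη, indicator_of_mem ht, indicator_of_mem ht, hχ,
              timeCutoff_eq_one h12 ((le_of_lt ht).trans h01.le), one_mul, ← Real.exp_add,
              neg_add_cancel, Real.exp_zero]
          · rw [hη, indicator_of_notMem ht, indicator_of_notMem ht, zero_mul]
        rw [← h3]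
        refine norm_mulL_le bη (fun z => ?_) _
        by_cases hz : z.1 ∈ Ioo 0 T
        · rw [cut, indicator_of_mem hz]; exact hηb _
        · rw [cut, indicator_of_notMem hz, abs_zero]; exact (Real.exp_pos _).le
      -- `χ'` lives on `t ≥ t₁`, where the weight is at most `exp (φ(t₁))`
      have upper : ‖A (mulL volume (cut T fun t => deriv χ t * Real.exp (φ s t)) u)‖ ≤
          Real.exp (φ s t₁) * ‖A (mulL volume (cut T (deriv χ)) u)‖ := by
        set η : ℝ → ℝ := (Ici t₁).indicator fun t => Real.exp (φ s t) with hη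
        have hηb : ∀ t, |η t| ≤ Real.exp (φ s t₁) := fun t => by
          by_cases ht : t ∈ Ici t₁
          · rw [hη, indicator_of_mem ht, abs_of_pos (Real.exp_pos _)]
            exact Real.exp_le_exp.2 (hanti s hs0 _ _ ht)
          · rw [hη, indicator_of_notMem ht, abs_zero]; exact (Real.exp_pos _).le
        have bη : BddMeas (cut T η : Pt m n → ℝ) :=
          bddMeas_cut (mE.indicator measurableSet_Ici) (Real.exp_pos _).le fun t _ => hηb t
        have h3 : mulL volume (cut T η) (A (mulL volume (cut T (deriv χ)) u)) =
            A (mulL volume (cut T fun t => deriv χ t * Real.exp (φ s t)) u) := by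
          rw [hA, mulL_avg _ hK bη (cut_add_smul_inclY _ r)]
          congr 1
          refine mulL_cut_cut bη bχ (fun t => ?_) u
          by_cases ht : t ∈ Ici t₁
          · rw [hη, indicator_of_mem ht, mul_comm]
          · rw [hη, indicator_of_notMem ht, hχ, deriv_timeCutoff_eq_zero h12 (not_le.1 ht),
              zero_mul, zero_mul]
        rw [← h3]
        refine norm_mulL_le bη (fun z => ?_) _
        by_cases hz : z.1 ∈ Ioo 0 T
        · rw [cut, indicator_of_mem hz]; exact hηb _
        · rw [cut, indicator_of_notMem hz, abs_zero]; exact (Real.exp_pos _).le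
      calc ‖A v‖ ≤ Real.exp (-φ s t₀) *
            ‖A (mulL volume (cut T fun t => χ t * Real.exp (φ s t)) u)‖ := lower
        _ ≤ Real.exp (-φ s t₀) * (Real.exp (φ s t₁) * ‖A (mulL volume (cut T (deriv χ)) u)‖) :=
          mul_le_mul_of_nonneg_left (main.trans upper) (Real.exp_pos _).le
        _ = _ := by rw [← mul_assoc, ← Real.exp_add]; congr 2; ring
    -- the exponent is negative since `t₀ < t₁`
    have hlim : Tendsto (fun s => Real.exp (φ s t₁ - φ s t₀) *
        ‖A (mulL volume (cut T (deriv χ)) u)‖) atTop (𝓝 0) := by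
      rw [← zero_mul ‖A (mulL volume (cut T (deriv χ)) u)‖]
      refine Tendsto.mul_const _ (Real.tendsto_exp_atBot.comp ?_)
      have h3 : (fun s => φ s t₁ - φ s t₀) = fun s =>
          s * ((Real.exp (-γ * t₁) - Real.exp (-γ * t₀)) / γ) := by
        ext s; simp only [hφ]; ring
      rw [h3]
      refine tendsto_id.atTop_mul_const_of_neg (div_neg_of_neg_of_pos ?_ hγ)
      exact sub_neg.2 (Real.exp_lt_exp.2 (by nlinarith))
    have : ‖A v‖ ≤ 0 := ge_of_tendsto hlim (eventually_atTop.2 ⟨_, bound⟩)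
    exact norm_le_zero_iff.1 this
  have hr : Tendsto (fun k : ℕ => ((k : ℝ) + 1)⁻¹) atTop (𝓝 0) := tendsto_inv_atTop_zero.comp
    (tendsto_atTop_add_const_right _ _ tendsto_natCast_atTop_atTop)
  have hl := tendsto_avg (inclY m n) hK h1 hr v
  simp only [fun k : ℕ => key ((k : ℝ) + 1)⁻¹ (by positivity)] at hl
  exact tendsto_nhds_unique hl tendsto_const_nhds |>.trans rfl

end Uniqueness

/-! ### Linear flows and the change of variables -/

section Flow

variable {E : Type*} [NormedAddCommGroup E] [NormedSpace ℝ E] [FiniteDimensional ℝ E]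

/-- The linear flow `exp (t M)`. -/
noncomputable def flow (M : E →L[ℝ] E) (t : ℝ) : E →L[ℝ] E := NormedSpace.exp (t • M)

variable (M : E →L[ℝ] E)

theorem contDiff_flow : ContDiff ℝ ∞ (flow M) := by
  have := FiniteDimensional.complete ℝ E
  have : ContDiff ℝ ∞ (NormedSpace.exp : (E →L[ℝ] E) → (E →L[ℝ] E)) :=
    contDiff_iff_contDiffAt.2 fun x => (NormedSpace.exp_analytic (𝕂 := ℝ) x).contDiffAt
  exact this.comp (contDiff_id.smul contDiff_const)

theorem flow_neg_apply_flow (t : ℝ) (x : E) : flow M (-t) (flow M t x) = x := by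
  have := FiniteDimensional.complete ℝ E
  let _ : NormedAlgebra ℚ (E →L[ℝ] E) := NormedAlgebra.restrictScalars ℚ ℝ _
  have h : flow M (-t) * flow M t = 1 := by
    rw [flow, flow, ← NormedSpace.exp_add_of_commute, ← add_smul, neg_add_cancel, zero_smul,
      NormedSpace.exp_zero]
    exact ((Commute.refl M).smul_left _).smul_right _
  exact DFunLike.congr_fun h x

theorem flow_apply_flow_neg (t : ℝ) (x : E) : flow M t (flow M (-t) x) = x := by
  simpa using flow_neg_apply_flow M (-t) x

theorem hasDerivAt_flow_apply (t : ℝ) (x : E) :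
    HasDerivAt (fun s => flow M s x) (M (flow M t x)) t := by
  have := FiniteDimensional.complete ℝ E
  have h := (hasDerivAt_exp_smul_const' (𝕂 := ℝ) M t).clm_apply (hasDerivAt_const t x)
  simpa [flow] using h

/-- A linear functional that annihilates the range of the generator is constant along the flow. -/
theorem map_flow_apply {F : Type*} [NormedAddCommGroup F] [NormedSpace ℝ F] (l : E →L[ℝ] F)
    (hl : ∀ x, l (M x) = 0) (t : ℝ) (x : E) : l (flow M t x) = l x := by
  have h : ∀ s, HasDerivAt (fun s => l (flow M s x)) 0 s := fun s => by
    have := l.hasFDerivAt.comp_hasDerivAt s (hasDerivAt_flow_apply M s x)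
    rwa [hl] at this
  have h2 := is_const_of_deriv_eq_zero (fun s => (h s).differentiableAt) (fun s => (h s).deriv) t 0
  rw [h2]
  simp [flow]

/-- The map `(t, x) ↦ (t, exp (t M) x)`. -/
noncomputable def flowHomeo : ℝ × E ≃ₜ ℝ × E where
  toFun z := (z.1, flow M z.1 z.2)
  invFun z := (z.1, flow M (-z.1) z.2)
  left_inv z := by simp [flow_neg_apply_flow]
  right_inv z := by simp [flow_apply_flow_neg]
  continuous_toFun := continuous_fst.prodMk
    (((contDiff_flow M).continuous.comp continuous_fst).clm_apply continuous_snd)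
  continuous_invFun := continuous_fst.prodMk
    (((contDiff_flow M).continuous.comp continuous_fst.neg).clm_apply continuous_snd)

theorem flowHomeo_apply (z : ℝ × E) : flowHomeo M z = (z.1, flow M z.1 z.2) := rfl

theorem flowHomeo_symm_apply (z : ℝ × E) : (flowHomeo M).symm z = (z.1, flow M (-z.1) z.2) := rfl

theorem contDiff_flowHomeo_symm : ContDiff ℝ ∞ (flowHomeo M).symm :=
  contDiff_fst.prodMk (((contDiff_flow M).comp contDiff_fst.neg).clm_apply contDiff_snd)

theorem IsTest.comp_flowHomeo_symm {ψ : ℝ × E → ℝ} (h : IsTest ψ) :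
    IsTest (ψ ∘ (flowHomeo M).symm) :=
  ⟨h.1.comp (contDiff_flowHomeo_symm M), h.2.comp_homeomorph (flowHomeo M).symm⟩

/-- The flow straightens the field `(1, M x)` to the time direction. -/
theorem fderiv_comp_flowHomeo_symm_drift {ψ : ℝ × E → ℝ} (h : IsTest ψ) (z : ℝ × E) :
    fderiv ℝ (ψ ∘ (flowHomeo M).symm) (flowHomeo M z) (1, M (flowHomeo M z).2) =
      fderiv ℝ ψ z (1, 0) := by
  have h1 : HasDerivAt (fun s : ℝ => flowHomeo M (s, z.2)) (1, M (flowHomeo M z).2) z.1 :=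
    (hasDerivAt_id z.1).prodMk (hasDerivAt_flow_apply M z.1 z.2)
  have h2 := ((h.comp_flowHomeo_symm M).differentiable (flowHomeo M z)).hasFDerivAt.comp_hasDerivAt
    z.1 h1
  have h3 : HasDerivAt (fun s : ℝ => (s, z.2)) (1, 0) z.1 :=
    (hasDerivAt_id z.1).prodMk (hasDerivAt_const _ _)
  have h4 := (h.differentiable z).hasFDerivAt.comp_hasDerivAt z.1 h3
  refine h2.unique (h4.congr_of_eventuallyEq (Eventually.of_forall fun s => ?_))
  simp

theorem fderiv_comp_flowHomeo_symm {ψ : ℝ × E → ℝ} (h : IsTest ψ) (z : ℝ × E) (e : E) :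
    fderiv ℝ (ψ ∘ (flowHomeo M).symm) (flowHomeo M z) (0, e) =
      fderiv ℝ ψ z (0, flow M (-z.1) e) := by
  have h1 : HasDerivAt (fun s : ℝ => flowHomeo M z + s • ((0, e) : ℝ × E)) (0, e) 0 := by
    simpa using ((hasDerivAt_id (0 : ℝ)).smul_const ((0, e) : ℝ × E)).const_add (flowHomeo M z)
  have h2 := (((h.comp_flowHomeo_symm M).differentiable _).hasFDerivAt.comp_hasDerivAt (0 : ℝ) h1)
  have h3 : HasDerivAt (fun s : ℝ => z + s • ((0, flow M (-z.1) e) : ℝ × E))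
      (0, flow M (-z.1) e) 0 := by
    simpa using ((hasDerivAt_id (0 : ℝ)).smul_const ((0, flow M (-z.1) e) : ℝ × E)).const_add z
  have h4 := ((h.differentiable _).hasFDerivAt.comp_hasDerivAt (0 : ℝ) h3)
  rw [zero_smul, add_zero] at h2 h4
  refine h2.unique (h4.congr_of_eventuallyEq (Eventually.of_forall fun s => ?_))
  simp only [Function.comp_apply, flowHomeo_apply, flowHomeo_symm_apply, Prod.fst_add, Prod.snd_add,
    Prod.smul_fst, Prod.smul_snd, smul_zero, add_zero, map_add, map_smul, flow_neg_apply_flow]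
  congr 1
  ext <;> simp

/-- The Jacobian determinant of `(t, x) ↦ (t, exp (t M) x)`, in absolute value. -/
noncomputable def flowJac (t : ℝ) : ℝ := |LinearMap.det (flow M t : E →ₗ[ℝ] E)|

theorem flowJac_pos (t : ℝ) : 0 < flowJac M t := by
  refine abs_pos.2 fun h => ?_
  have h1 : (flow M (-t) : E →ₗ[ℝ] E) * (flow M t : E →ₗ[ℝ] E) = 1 :=
    LinearMap.ext fun x => flow_neg_apply_flow M t x
  have h2 := congrArg LinearMap.det h1
  rw [map_mul, h, mul_zero, map_one] at h2
  exact zero_ne_one h2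

theorem continuous_flowJac : Continuous (flowJac M) :=
  (ContinuousLinearMap.continuous_det.comp (contDiff_flow M).continuous).abs

variable [MeasureSpace E] [BorelSpace E] [(volume : Measure E).IsAddHaarMeasure]

/-- Change of variables for the flow. -/
theorem measurePreserving_flowHomeo :
    MeasurePreserving (flowHomeo M)
      ((volume : Measure (ℝ × E)).withDensity fun z => ENNReal.ofReal (flowJac M z.1)) volume := by
  have hJ : Measurable fun z : ℝ × E => ENNReal.ofReal (flowJac M z.1) :=
    ((continuous_flowJac M).measurable.comp measurable_fst).ennreal_ofReal
  refine ⟨(flowHomeo M).continuous.measurable, ?_⟩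
  ext s hs
  have hs' : MeasurableSet (flowHomeo M ⁻¹' s) := (flowHomeo M).continuous.measurable hs
  rw [Measure.map_apply (flowHomeo M).continuous.measurable hs, withDensity_apply _ hs',
    ← lintegral_indicator hs', Measure.volume_eq_prod, Measure.prod_apply hs,
    lintegral_prod _ (hJ.indicator hs').aemeasurable]
  refine lintegral_congr fun t => ?_
  have h1 : ∀ x : E, (flowHomeo M ⁻¹' s).indicator
      (fun z : ℝ × E => ENNReal.ofReal (flowJac M z.1)) (t, x) =
      (flow M t ⁻¹' (Prod.mk t ⁻¹' s)).indicator (fun _ => ENNReal.ofReal (flowJac M t)) x :=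
    fun x => rfl
  have hst : MeasurableSet (flow M t ⁻¹' (Prod.mk t ⁻¹' s)) :=
    (flow M t).continuous.measurable (measurable_prodMk_left hs)
  have hdet : LinearMap.det (flow M t : E →ₗ[ℝ] E) ≠ 0 := abs_pos.1 (flowJac_pos M t)
  simp only [h1]
  rw [lintegral_indicator hst, setLIntegral_const,
    Measure.addHaar_preimage_continuousLinearMap volume hdet, ← mul_assoc,
    ← ENNReal.ofReal_mul (flowJac_pos M t).le, flowJac, abs_inv,
    mul_inv_cancel₀ (abs_pos.2 hdet).ne', ENNReal.ofReal_one, one_mul]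

end Flow

/-! ### Functions in straightened coordinates -/

section Pullback

variable {m n : ℕ} {T : ℝ}

instance isAddHaarMeasure_volume_space (m n : ℕ) :
    (volume : Measure (EuclideanSpace ℝ (Fin m) × EuclideanSpace ℝ (Fin n))).IsAddHaarMeasure :=
  Measure.prod.instIsAddHaarMeasure _ _

variable (M : EuclideanSpace ℝ (Fin m) × EuclideanSpace ℝ (Fin n) →L[ℝ]
  EuclideanSpace ℝ (Fin m) × EuclideanSpace ℝ (Fin n))

theorem mem_slab {z : Pt m n} : z ∈ (slab m n T : Set (Pt m n)) ↔ z.1 ∈ Ioo 0 T := by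
  simp [slab]

theorem measurableSet_slab : MeasurableSet (slab m n T : Set (Pt m n)) := (slab m n T).2.measurableSet

theorem flowHomeo_preimage_slab :
    flowHomeo M ⁻¹' (slab m n T : Set (Pt m n)) = (slab m n T : Set (Pt m n)) := by
  ext z
  rw [mem_preimage, mem_slab, mem_slab, flowHomeo_apply]

/-- The restriction of `g` to the slab in the coordinates straightened by the flow, multiplied by
the Jacobian and extended by `0`. With this factor, testing `pull M T g` against `ψ` is the same as
testing `g` against `ψ` in the original coordinates. -/
noncomputable def pull (T : ℝ) (g : Pt m n → ℝ) : Pt m n → ℝ :=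
  (slab m n T : Set (Pt m n)).indicator fun z => flowJac M z.1 * g (flowHomeo M z)

theorem pull_apply_of_mem {g : Pt m n → ℝ} {z : Pt m n} (hz : z.1 ∈ Ioo 0 T) :
    pull M T g z = flowJac M z.1 * g (flowHomeo M z) := indicator_of_mem (mem_slab.2 hz) _

theorem pull_apply_of_notMem {g : Pt m n → ℝ} {z : Pt m n} (hz : z.1 ∉ Ioo 0 T) :
    pull M T g z = 0 := indicator_of_notMem (fun h => hz (mem_slab.1 h)) _

theorem volume_restrict_slab_le : ∃ C : ℝ≥0∞, C ≠ ⊤ ∧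
    (volume : Measure (Pt m n)).restrict (slab m n T : Set (Pt m n)) ≤
      C • ((volume : Measure (Pt m n)).withDensity
        fun z => ENNReal.ofReal (flowJac M z.1)).restrict (slab m n T : Set (Pt m n)) := by
  obtain ⟨C, hC⟩ := (isCompact_Icc (a := (0 : ℝ)) (b := T)).exists_bound_of_continuousOn
    ((continuous_flowJac M).inv₀ fun t => (flowJac_pos M t).ne').continuousOn
  refine ⟨ENNReal.ofReal C, ENNReal.ofReal_ne_top, ?_⟩
  have hJ : Measurable fun z : Pt m n => ENNReal.ofReal (flowJac M z.1) :=
    ((continuous_flowJac M).measurable.comp measurable_fst).ennreal_ofReal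
  rw [restrict_withDensity measurableSet_slab, ← withDensity_smul _ hJ]
  nth_rewrite 1 [← withDensity_one (μ := volume.restrict (slab m n T : Set (Pt m n)))]
  refine withDensity_mono ((ae_restrict_iff' measurableSet_slab).2 (Eventually.of_forall fun z hz => ?_))
  rw [mem_slab] at hz
  have h1 := hC z.1 (Ioo_subset_Icc_self hz)
  have hp := flowJac_pos M z.1
  rw [Pi.inv_apply, Real.norm_eq_abs, abs_of_pos (inv_pos.2 hp)] at h1
  have hC0 : 0 ≤ C := (inv_pos.2 hp).le.trans h1
  have h2 : 1 ≤ C * flowJac M z.1 := by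
    rw [← inv_mul_cancel₀ hp.ne']
    exact mul_le_mul_of_nonneg_right h1 hp.le
  rw [Pi.smul_apply, smul_eq_mul, ← ENNReal.ofReal_mul hC0, Pi.one_apply]
  exact ENNReal.one_le_ofReal.2 h2

theorem memLp_pull {g : Pt m n → ℝ}
    (hg : MemLp g 2 (volume.restrict (slab m n T : Set (Pt m n)))) :
    MemLp (pull M T g) 2 volume := by
  obtain ⟨C, hC, hle⟩ := volume_restrict_slab_le (T := T) M
  have hmp := (measurePreserving_flowHomeo M).restrict_preimage_emb
    (flowHomeo M).measurableEmbedding (slab m n T : Set (Pt m n))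
  rw [flowHomeo_preimage_slab] at hmp
  have h1 : MemLp (g ∘ flowHomeo M) 2 (volume.restrict (slab m n T : Set (Pt m n))) :=
    (hg.comp_measurePreserving hmp).of_measure_le_smul hC hle
  obtain ⟨C', hC'⟩ := (isCompact_Icc (a := (0 : ℝ)) (b := T)).exists_bound_of_continuousOn
    (continuous_flowJac M).continuousOn
  rw [pull, memLp_indicator_iff_restrict measurableSet_slab]
  refine h1.of_le_mul (c := C')
    (((continuous_flowJac M).measurable.comp measurable_fst).aestronglyMeasurable.mul h1.1)
    ((ae_restrict_iff' measurableSet_slab).2 (Eventually.of_forall fun z hz => ?_))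
  rw [norm_mul]
  exact mul_le_mul_of_nonneg_right (hC' _ (Ioo_subset_Icc_self (mem_slab.1 hz))) (norm_nonneg _)

theorem setIntegral_slab_eq (φ g : Pt m n → ℝ) :
    ∫ z in (slab m n T : Set (Pt m n)), φ z * g z = ∫ z, φ (flowHomeo M z) * pull M T g z := by
  have hJ : Measurable fun z : Pt m n => ENNReal.ofReal (flowJac M z.1) :=
    ((continuous_flowJac M).measurable.comp measurable_fst).ennreal_ofReal
  rw [← (measurePreserving_flowHomeo M).setIntegral_preimage_emb
    (flowHomeo M).measurableEmbedding (fun z => φ z * g z), flowHomeo_preimage_slab,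
    setIntegral_withDensity_eq_setIntegral_toReal_smul hJ (Eventually.of_forall fun z =>
      ENNReal.ofReal_lt_top) _ measurableSet_slab, ← integral_indicator measurableSet_slab]
  refine integral_congr_ae (Eventually.of_forall fun z => ?_)
  by_cases hz : z.1 ∈ Ioo 0 T
  · simp only [indicator_of_mem (mem_slab.2 hz), pull_apply_of_mem M hz,
      ENNReal.toReal_ofReal (flowJac_pos M z.1).le, smul_eq_mul]
    ring
  · simp only [indicator_of_notMem (fun h => hz (mem_slab.1 h)), pull_apply_of_notMem M hz,
      mul_zero]

/-- If `pull g` vanishes for `t < t₁`, then so does `g`. -/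
theorem ae_eq_zero_of_pull {g : Pt m n → ℝ} {t₁ : ℝ} (h1 : t₁ ≤ T)
    (hg : ∀ᵐ z : Pt m n, z.1 < t₁ → pull M T g z = 0) :
    ∀ᵐ z ∂(volume.restrict (Ioo 0 t₁ ×ˢ univ : Set (Pt m n))), g z = 0 := by
  rw [ae_restrict_iff' (measurableSet_Ioo.prod MeasurableSet.univ)]
  have h2 : ∀ᵐ z ∂((volume : Measure (Pt m n)).withDensity
      fun z => ENNReal.ofReal (flowJac M z.1)), z.1 ∈ Ioo 0 t₁ → g (flowHomeo M z) = 0 := by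
    refine (withDensity_absolutelyContinuous _ _).ae_le ?_
    filter_upwards [hg] with z hz ht
    have h3 := hz ht.2
    rw [pull_apply_of_mem M ⟨ht.1, ht.2.trans_le h1⟩] at h3
    exact (mul_eq_zero.1 h3).resolve_left (flowJac_pos M z.1).ne'
  rw [← (measurePreserving_flowHomeo M).map_eq,
    (flowHomeo M).measurableEmbedding.ae_map_iff]
  filter_upwards [h2] with z hz ht
  exact hz ht.1

end Pullback

/-! ### Real solutions and their test functions -/

section RealSolution

variable {m n : ℕ} {T : ℝ}

/-- The drift `(v, w) ↦ (0, B₁ v + B₂ w)`. -/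
noncomputable def drift (B₁ : Matrix (Fin n) (Fin m) ℝ) (B₂ : Matrix (Fin n) (Fin n) ℝ) :
    EuclideanSpace ℝ (Fin m) × EuclideanSpace ℝ (Fin n) →L[ℝ]
      EuclideanSpace ℝ (Fin m) × EuclideanSpace ℝ (Fin n) :=
  (0 : _ →L[ℝ] EuclideanSpace ℝ (Fin m)).prod
    ((Matrix.toEuclideanLin B₁).toContinuousLinearMap.comp (ContinuousLinearMap.fst ℝ _ _) +
      (Matrix.toEuclideanLin B₂).toContinuousLinearMap.comp (ContinuousLinearMap.snd ℝ _ _))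

/-- A real-valued solution of the original equation, tested with `φ` supported in the slab. Here
`f = Y u + (tr B₂) u`, and `c` is the zeroth order coefficient for this choice of `f`. -/
structure IsRealSolution (T : ℝ) (B₁ : Matrix (Fin n) (Fin m) ℝ) (B₂ : Matrix (Fin n) (Fin n) ℝ)
    (a : Fin m → Fin m → Pt m n → ℝ) (c : Pt m n → ℝ) (d : Fin m → Pt m n → ℝ)
    (u f : Pt m n → ℝ) (G : Fin m → Pt m n → ℝ) : Prop where
  memLp_u : MemLp u 2 (volume.restrict (slab m n T : Set (Pt m n)))
  memLp_f : MemLp f 2 (volume.restrict (slab m n T : Set (Pt m n)))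
  memLp_G : ∀ i, MemLp (G i) 2 (volume.restrict (slab m n T : Set (Pt m n)))
  deriv_Y : ∀ φ : Pt m n → ℝ, IsTest φ → tsupport φ ⊆ slab m n T →
    ∫ z in (slab m n T : Set (Pt m n)), dY B₁ B₂ φ z * u z =
      -∫ z in (slab m n T : Set (Pt m n)), φ z * f z
  deriv_v : ∀ φ : Pt m n → ℝ, IsTest φ → tsupport φ ⊆ slab m n T → ∀ i,
    ∫ z in (slab m n T : Set (Pt m n)), dv φ i z * u z =
      -∫ z in (slab m n T : Set (Pt m n)), φ z * G i z
  equation : ∀ φ : Pt m n → ℝ, IsTest φ → tsupport φ ⊆ slab m n T →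
    ∫ z in (slab m n T : Set (Pt m n)), φ z * (c z * u z + ∑ i, d i z * G i z - f z) =
      -∑ i, ∑ j, ∫ z in (slab m n T : Set (Pt m n)), a i j z * dv φ i z * G j z
  trace_zero : ∀ ε : ℝ≥0∞, 0 < ε → ∃ δ : ℝ, 0 < δ ∧
    ∀ᵐ t ∂(volume.restrict (Ioo 0 δ)),
      eLpNorm (fun y : EuclideanSpace ℝ (Fin m) × EuclideanSpace ℝ (Fin n) => u (t, y)) 2 volume
        ≤ ε

variable {B₁ : Matrix (Fin n) (Fin m) ℝ} {B₂ : Matrix (Fin n) (Fin n) ℝ}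
  {a : Fin m → Fin m → Pt m n → ℝ} {c : Pt m n → ℝ} {d : Fin m → Pt m n → ℝ}
  {u f : Pt m n → ℝ} {G : Fin m → Pt m n → ℝ}

theorem flow_drift_fst (t : ℝ) (x : EuclideanSpace ℝ (Fin m) × EuclideanSpace ℝ (Fin n)) :
    (flow (drift B₁ B₂) t x).1 = x.1 :=
  map_flow_apply (drift B₁ B₂) (ContinuousLinearMap.fst ℝ _ _) (fun _ => rfl) t x

/-- A function that does not depend on `w` is not affected by the flow of the drift. -/
theorem comp_flowHomeo_drift {b : Pt m n → ℝ} (hb : ∀ z y, b (z + (0, 0, y)) = b z) (z : Pt m n) :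
    b (flowHomeo (drift B₁ B₂) z) = b z := by
  rw [← hb z ((flow (drift B₁ B₂) z.1 z.2).2 - z.2.2), flowHomeo_apply]
  congr 1
  refine Prod.ext (by simp) (Prod.ext ?_ (by simp))
  simp [flow_drift_fst]

/-- The derivative of `ψ` in the direction of the field `e_i(t) = exp (-t M) (e_i, 0)`. -/
noncomputable def dflow (B₁ : Matrix (Fin n) (Fin m) ℝ) (B₂ : Matrix (Fin n) (Fin n) ℝ)
    (ψ : Pt m n → ℝ) (i : Fin m) (z : Pt m n) : ℝ :=
  fderiv ℝ ψ z (0, flow (drift B₁ B₂) (-z.1) (EuclideanSpace.single i 1, 0))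

theorem tsupport_comp_flowHomeo_symm {ψ : Pt m n → ℝ} (hs : tsupport ψ ⊆ slab m n T) :
    tsupport (ψ ∘ (flowHomeo (drift B₁ B₂)).symm) ⊆ slab m n T := by
  rw [tsupport_comp_eq_preimage]
  intro z hz
  have h1 := hs (mem_preimage.1 hz)
  exact mem_slab.2 (mem_slab.1 h1)

theorem dY_comp_flowHomeo_symm {ψ : Pt m n → ℝ} (h : IsTest ψ) (z : Pt m n) :
    dY B₁ B₂ (ψ ∘ (flowHomeo (drift B₁ B₂)).symm) (flowHomeo (drift B₁ B₂) z) =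
      fderiv ℝ ψ z (et m n) :=
  fderiv_comp_flowHomeo_symm_drift (drift B₁ B₂) h z

theorem dv_comp_flowHomeo_symm {ψ : Pt m n → ℝ} (h : IsTest ψ) (i : Fin m) (z : Pt m n) :
    dv (ψ ∘ (flowHomeo (drift B₁ B₂)).symm) i (flowHomeo (drift B₁ B₂) z) = dflow B₁ B₂ ψ i z :=
  fderiv_comp_flowHomeo_symm (drift B₁ B₂) h z _

theorem IsRealSolution.pull_deriv_t (h : IsRealSolution T B₁ B₂ a c d u f G) {ψ : Pt m n → ℝ}
    (hψ : IsTest ψ) (hs : tsupport ψ ⊆ slab m n T) :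
    ∫ z, fderiv ℝ ψ z (et m n) * pull (drift B₁ B₂) T u z =
      -∫ z, ψ z * pull (drift B₁ B₂) T f z := by
  have h1 := h.deriv_Y _ (hψ.comp_flowHomeo_symm (drift B₁ B₂)) (tsupport_comp_flowHomeo_symm hs)
  rw [setIntegral_slab_eq (drift B₁ B₂), setIntegral_slab_eq (drift B₁ B₂)] at h1
  simpa only [dY_comp_flowHomeo_symm hψ, Function.comp_apply, Homeomorph.symm_apply_apply] using h1

theorem IsRealSolution.pull_deriv_v (h : IsRealSolution T B₁ B₂ a c d u f G) {ψ : Pt m n → ℝ}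
    (hψ : IsTest ψ) (hs : tsupport ψ ⊆ slab m n T) (i : Fin m) :
    ∫ z, dflow B₁ B₂ ψ i z * pull (drift B₁ B₂) T u z =
      -∫ z, ψ z * pull (drift B₁ B₂) T (G i) z := by
  have h1 := h.deriv_v _ (hψ.comp_flowHomeo_symm (drift B₁ B₂)) (tsupport_comp_flowHomeo_symm hs) i
  rw [setIntegral_slab_eq (drift B₁ B₂), setIntegral_slab_eq (drift B₁ B₂)] at h1
  simpa only [dv_comp_flowHomeo_symm hψ, Function.comp_apply, Homeomorph.symm_apply_apply] using h1

theorem IsRealSolution.pull_equation (h : IsRealSolution T B₁ B₂ a c d u f G)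
    (ha : ∀ i j z y, a i j (z + (0, 0, y)) = a i j z) (hc : ∀ z y, c (z + (0, 0, y)) = c z)
    (hd : ∀ i z y, d i (z + (0, 0, y)) = d i z) {ψ : Pt m n → ℝ}
    (hψ : IsTest ψ) (hs : tsupport ψ ⊆ slab m n T) :
    ∫ z, ψ z * (c z * pull (drift B₁ B₂) T u z + ∑ i, d i z * pull (drift B₁ B₂) T (G i) z -
        pull (drift B₁ B₂) T f z) =
      -∑ i, ∑ j, ∫ z, a i j z * dflow B₁ B₂ ψ i z * pull (drift B₁ B₂) T (G j) z := by
  have h1 := h.equation _ (hψ.comp_flowHomeo_symm (drift B₁ B₂)) (tsupport_comp_flowHomeo_symm hs)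
  simp only [setIntegral_slab_eq (drift B₁ B₂)] at h1
  simp only [dv_comp_flowHomeo_symm hψ, Function.comp_apply, Homeomorph.symm_apply_apply,
    comp_flowHomeo_drift (ha _ _)] at h1
  rw [← h1]
  refine integral_congr_ae (Eventually.of_forall fun z => ?_)
  by_cases hz : z.1 ∈ Ioo 0 T
  · simp only [pull_apply_of_mem _ hz, comp_flowHomeo_drift hc, comp_flowHomeo_drift (hd _)]
    congr 1
    rw [mul_sub, mul_add, Finset.mul_sum]
    congr 2
    · ring
    · exact Finset.sum_congr rfl fun i _ => by ring
  · simp only [pull_apply_of_notMem _ hz, mul_zero, Finset.sum_const_zero, add_zero, sub_zero]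

end RealSolution

/-! ### The initial trace and a cutoff near `t = 0` -/

section Ramp

/-- A smooth function of time that vanishes for `t ≤ ε` and equals `1` for `t ≥ 2 ε`. -/
noncomputable def ramp (ε t : ℝ) : ℝ := Real.smoothTransition (t / ε - 1)

theorem contDiff_ramp (ε : ℝ) : ContDiff ℝ ∞ (ramp ε) :=
  Real.smoothTransition.contDiff.comp ((contDiff_id.div_const _).sub contDiff_const)

theorem ramp_eq_zero {ε t : ℝ} (hε : 0 < ε) (ht : t ≤ ε) : ramp ε t = 0 :=
  Real.smoothTransition.zero_of_nonpos (sub_nonpos.2 ((div_le_one hε).2 ht))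

theorem ramp_eq_one {ε t : ℝ} (hε : 0 < ε) (ht : 2 * ε ≤ t) : ramp ε t = 1 := by
  refine Real.smoothTransition.one_of_one_le ?_
  have : 2 ≤ t / ε := (le_div_iff₀ hε).2 ht
  linarith

theorem abs_ramp_le (ε t : ℝ) : |ramp ε t| ≤ 1 := by
  rw [ramp, abs_of_nonneg (Real.smoothTransition.nonneg _)]
  exact Real.smoothTransition.le_one _

theorem deriv_ramp_eq_zero {ε t : ℝ} (hε : 0 < ε) (ht : 2 * ε < t) : deriv (ramp ε) t = 0 := by
  have : ramp ε =ᶠ[𝓝 t] fun _ => 1 := by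
    filter_upwards [Ioi_mem_nhds ht] with s hs
    exact ramp_eq_one hε (le_of_lt hs)
  rw [this.deriv_eq, deriv_const]

theorem exists_abs_deriv_ramp_le : ∃ C : ℝ, 0 ≤ C ∧ ∀ ε t : ℝ, 0 < ε → |deriv (ramp ε) t| ≤ C / ε := by
  have hs : ContDiff ℝ ∞ Real.smoothTransition := Real.smoothTransition.contDiff
  obtain ⟨C, hC⟩ := (isCompact_Icc (a := (0 : ℝ)) (b := 1)).exists_bound_of_continuousOn
    (hs.continuous_deriv (by simp)).continuousOn
  have hC0 : 0 ≤ C := (norm_nonneg _).trans (hC 0 (by simp))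
  refine ⟨C, hC0, fun ε t hε => ?_⟩
  have h1 : deriv (ramp ε) t = deriv Real.smoothTransition (t / ε - 1) * (1 / ε) := by
    have h2 : HasDerivAt (fun t : ℝ => t / ε - 1) (1 / ε) t :=
      ((hasDerivAt_id t).div_const ε).sub_const 1
    exact ((hs.differentiable (by simp) _).hasDerivAt.comp t h2).deriv
  rw [h1, abs_mul, abs_of_pos (one_div_pos.2 hε), mul_one_div]
  refine div_le_div_of_nonneg_right ?_ hε.le
  by_cases h : t / ε - 1 ∈ Icc (0 : ℝ) 1
  · exact hC _ h
  · have h0 : deriv Real.smoothTransition (t / ε - 1) = 0 := by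
      rcases not_and_or.1 h with h | h
      · have : Real.smoothTransition =ᶠ[𝓝 (t / ε - 1)] fun _ => 0 := by
          filter_upwards [Iio_mem_nhds (not_le.1 h)] with s hs
          exact Real.smoothTransition.zero_of_nonpos (le_of_lt hs)
        rw [this.deriv_eq, deriv_const]
      · have : Real.smoothTransition =ᶠ[𝓝 (t / ε - 1)] fun _ => 1 := by
          filter_upwards [Ioi_mem_nhds (not_le.1 h)] with s hs
          exact Real.smoothTransition.one_of_one_le (le_of_lt hs)
        rw [this.deriv_eq, deriv_const]
    rw [h0, abs_zero]
    exact hC0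

theorem tendsto_ramp {t : ℝ} (ht : 0 < t) :
    ∀ᶠ k : ℕ in atTop, ramp (1 / ((k : ℝ) + 1)) t = 1 := by
  have h1 := (tendsto_one_div_add_atTop_nhds_zero_nat (𝕜 := ℝ)).eventually
    (gt_mem_nhds (half_pos ht))
  filter_upwards [h1] with k hk
  exact ramp_eq_one (by positivity) (by linarith)

variable {m n : ℕ} {T : ℝ}

theorem fderiv_time_mul {b : ℝ → ℝ} {ψ : Pt m n → ℝ} (hb : Differentiable ℝ b)
    (hψ : Differentiable ℝ ψ) (z e : Pt m n) :
    fderiv ℝ (fun z : Pt m n => b z.1 * ψ z) z e =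
      e.1 * deriv b z.1 * ψ z + b z.1 * fderiv ℝ ψ z e := by
  have h1 : HasFDerivAt (fun z : Pt m n => b z.1)
      ((ContinuousLinearMap.toSpanSingleton ℝ (deriv b z.1)).comp (ContinuousLinearMap.fst ℝ _ _)) z :=
    (hb z.1).hasDerivAt.hasFDerivAt.comp z hasFDerivAt_fst
  rw [(h1.fun_mul (hψ z).hasFDerivAt).fderiv]
  simp
  ring

theorem tendsto_integral_ramp_mul {h : Pt m n → ℝ} (hi : Integrable h)
    (h0 : ∀ z : Pt m n, z.1 ∉ Ioo 0 T → h z = 0) :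
    Tendsto (fun k : ℕ => ∫ z, ramp (1 / ((k : ℝ) + 1)) z.1 * h z) atTop (𝓝 (∫ z, h z)) := by
  refine tendsto_integral_of_dominated_convergence (fun z => ‖h z‖) (fun k => ?_) hi.norm
    (fun k => Eventually.of_forall fun z => ?_) (Eventually.of_forall fun z => ?_)
  · exact (((contDiff_ramp _).continuous.measurable.comp measurable_fst).aestronglyMeasurable).mul hi.1
  · rw [norm_mul]
    exact mul_le_of_le_one_left (norm_nonneg _) (abs_ramp_le _ _)
  · by_cases hz : z.1 ∈ Ioo 0 T
    · refine tendsto_const_nhds.congr' ?_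
      filter_upwards [tendsto_ramp hz.1] with k hk
      rw [hk, one_mul]
    · simp [h0 z hz]

/-- A function with zero trace at `t = 0` does not see the jump of the cutoff at `t = 0`. -/
theorem tendsto_integral_deriv_ramp_mul {u φ : Pt m n → ℝ}
    (hu : MemLp u 2 (volume.restrict (slab m n T : Set (Pt m n))))
    (htr : ∀ ε : ℝ≥0∞, 0 < ε → ∃ δ : ℝ, 0 < δ ∧
      ∀ᵐ t ∂(volume.restrict (Ioo 0 δ)),
        eLpNorm (fun y : EuclideanSpace ℝ (Fin m) × EuclideanSpace ℝ (Fin n) => u (t, y)) 2 volume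
          ≤ ε) (hφ : IsTest φ) :
    Tendsto (fun k : ℕ => ∫ z in (slab m n T : Set (Pt m n)),
      deriv (ramp (1 / ((k : ℝ) + 1))) z.1 * (φ z * u z)) atTop (𝓝 0) := by
  obtain ⟨C, hC0, hC⟩ := exists_abs_deriv_ramp_le
  -- the slices of the test function are uniformly bounded in `L²`
  obtain ⟨K, hK, hφK⟩ : ∃ K : ℝ≥0∞, K ≠ ⊤ ∧ ∀ t : ℝ, eLpNorm
      (fun y : EuclideanSpace ℝ (Fin m) × EuclideanSpace ℝ (Fin n) => φ (t, y)) 2 volume ≤ K := by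
    obtain ⟨Cφ, hCφ⟩ := hφ.1.continuous.bounded_above_of_compact_support hφ.2
    set B : Set (EuclideanSpace ℝ (Fin m) × EuclideanSpace ℝ (Fin n)) :=
      Prod.snd '' tsupport φ with hB
    have hBc : IsCompact B := hφ.2.isCompact.image continuous_snd
    refine ⟨eLpNorm (B.indicator fun _ => Cφ) 2 volume,
      ((memLp_indicator_const 2 hBc.measurableSet Cφ (Or.inr hBc.measure_lt_top.ne)).2).ne,
      fun t => eLpNorm_mono_real fun y => ?_⟩
    by_cases hy : y ∈ B
    · rw [indicator_of_mem hy]; exact hCφ _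
    · rw [indicator_of_notMem hy, image_eq_zero_of_notMem_tsupport fun h => hy ⟨_, h, rfl⟩, norm_zero]
  have hsl : (volume : Measure (Pt m n)).restrict (slab m n T : Set (Pt m n)) =
      (volume.restrict (Ioo 0 T)).prod volume := by
    rw [Measure.volume_eq_prod]
    conv_rhs => rw [← Measure.restrict_univ (μ := (volume : Measure
      (EuclideanSpace ℝ (Fin m) × EuclideanSpace ℝ (Fin n))))]
    rw [Measure.prod_restrict]
    rfl
  have hum := hu.1
  rw [hsl] at hum
  rw [tendsto_zero_iff_enorm_tendsto_zero, ENNReal.tendsto_nhds_zero]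
  intro η hη
  obtain ⟨ε, hε, hεη⟩ : ∃ ε : ℝ≥0∞, 0 < ε ∧ ENNReal.ofReal (2 * C) * (K * ε) ≤ η := by
    rcases eq_or_ne η ⊤ with rfl | hη'
    · exact ⟨1, one_pos, le_top⟩
    refine ⟨η / (ENNReal.ofReal (2 * C) * K + 1), ENNReal.div_pos hη.ne' (by finiteness), ?_⟩
    rw [← mul_assoc, ← mul_div_assoc]
    refine ENNReal.div_le_of_le_mul ?_
    rw [mul_comm]
    gcongr
    exact le_self_add
  obtain ⟨δ, hδ, hδu⟩ := htr ε hε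
  filter_upwards [(tendsto_one_div_add_atTop_nhds_zero_nat (𝕜 := ℝ)).eventually
    (gt_mem_nhds (half_pos hδ))] with k hk
  set r : ℝ := 1 / ((k : ℝ) + 1) with hr
  have hr0 : 0 < r := by positivity
  rw [ae_restrict_iff' measurableSet_Ioo] at hδu
  calc ‖∫ z in (slab m n T : Set (Pt m n)), deriv (ramp r) z.1 * (φ z * u z)‖ₑ
      ≤ ∫⁻ z in (slab m n T : Set (Pt m n)), ‖deriv (ramp r) z.1 * (φ z * u z)‖ₑ :=
        enorm_integral_le_lintegral_enorm _
    _ = ∫⁻ t in Ioo 0 T, ∫⁻ y, ‖deriv (ramp r) t * (φ (t, y) * u (t, y))‖ₑ := by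
        rw [hsl, lintegral_prod]
        refine AEStronglyMeasurable.enorm (AEStronglyMeasurable.mul ?_
          (hφ.1.continuous.aestronglyMeasurable.mul hum))
        exact ((((contDiff_ramp r).continuous_deriv (by simp)).measurable).comp
          measurable_fst).aestronglyMeasurable
    _ ≤ ∫⁻ t in Ioo 0 T, (Ioc 0 (2 * r)).indicator (fun _ => ENNReal.ofReal (C / r) * (K * ε)) t := by
        refine lintegral_mono_ae ?_
        have h1 := hum.prodMk_left
        filter_upwards [h1, ae_restrict_of_ae (s := Ioo 0 T) hδu,
          ae_restrict_mem measurableSet_Ioo] with t ht hut htT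
        simp only [enorm_mul]
        rw [lintegral_const_mul' _ _ (by finiteness)]
        by_cases htr : t ≤ 2 * r
        · rw [indicator_of_mem (show t ∈ Ioc 0 (2 * r) from ⟨htT.1, htr⟩)]
          gcongr
          · rw [← ofReal_norm]
            exact ENNReal.ofReal_le_ofReal (hC r t hr0)
          · have h2 := eLpNorm_smul_le_mul_eLpNorm (p := 2) (q := 2) (r := 1) ht
              (φ := fun y => φ (t, y)) (hφ.1.continuous.comp (Continuous.prodMk_right t)).aestronglyMeasurable
            rw [eLpNorm_one_eq_lintegral_enorm] at h2
            simp only [Pi.smul_apply', smul_eq_mul, enorm_mul] at h2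
            exact h2.trans (mul_le_mul' (hφK t) (hut ⟨htT.1, by linarith⟩))
        · rw [deriv_ramp_eq_zero hr0 (not_le.1 htr), enorm_zero, zero_mul]
          exact zero_le
    _ ≤ ∫⁻ t, (Ioc 0 (2 * r)).indicator (fun _ => ENNReal.ofReal (C / r) * (K * ε)) t :=
        lintegral_mono' Measure.restrict_le_self le_rfl
    _ = ENNReal.ofReal (2 * C) * (K * ε) := by
        rw [lintegral_indicator measurableSet_Ioc, setLIntegral_const, Real.volume_Ioc, mul_right_comm,
          ← ENNReal.ofReal_mul (by positivity)]
        congr 2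
        field_simp
        ring
    _ ≤ η := hεη

end Ramp

/-! ### Extension by zero -/

section Extension

variable {m n : ℕ} {T t₂ : ℝ}
variable {B₁ : Matrix (Fin n) (Fin m) ℝ} {B₂ : Matrix (Fin n) (Fin n) ℝ}
  {a : Fin m → Fin m → Pt m n → ℝ} {c : Pt m n → ℝ} {d : Fin m → Pt m n → ℝ}
  {u f : Pt m n → ℝ} {G : Fin m → Pt m n → ℝ} {χ : Pt m n → ℝ}

theorem IsTest.time_mul {b : ℝ → ℝ} (hb : ContDiff ℝ ∞ b) (hχ : IsTest χ) :
    IsTest fun z => b z.1 * χ z := hχ.mul_left (hb.comp contDiff_fst)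

theorem tsupport_ramp_mul {ε : ℝ} (hε : 0 < ε) (h2 : t₂ < T)
    (hχ₂ : ∀ z : Pt m n, t₂ ≤ z.1 → χ z = 0) :
    tsupport (fun z => ramp ε z.1 * χ z) ⊆ slab m n T := by
  have h1 : tsupport (fun z => ramp ε z.1 * χ z) ⊆ Prod.fst ⁻¹' Icc ε t₂ := by
    refine closure_minimal (fun z hz => ?_) (isClosed_Icc.preimage continuous_fst)
    by_contra h
    rcases not_and_or.1 h with h | h
    · exact hz (by simp only [ramp_eq_zero hε (not_le.1 h).le, zero_mul])
    · exact hz (by simp only [hχ₂ z (not_le.1 h).le, mul_zero])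
  exact fun z hz => mem_slab.2 ⟨hε.trans_le (h1 hz).1, (h1 hz).2.trans_lt h2⟩

theorem IsTest.dflow (hχ : IsTest χ) (i : Fin m) : IsTest (dflow B₁ B₂ χ i) := by
  refine ⟨(hχ.1.fderiv_right (m := ∞) le_rfl).clm_apply (contDiff_const.prodMk
    (((contDiff_flow (drift B₁ B₂)).comp contDiff_fst.neg).clm_apply contDiff_const)), ?_⟩
  refine hχ.2.fderiv (𝕜 := ℝ) |>.mono fun z hz h0 => hz ?_
  rw [Ultraparabolic.dflow, h0, zero_apply]

theorem dflow_time_mul {b : ℝ → ℝ} (hb : ContDiff ℝ ∞ b) (hχ : IsTest χ) (i : Fin m) (z : Pt m n) :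
    dflow B₁ B₂ (fun z => b z.1 * χ z) i z = b z.1 * dflow B₁ B₂ χ i z := by
  rw [dflow, fderiv_time_mul (hb.differentiable (by simp)) hχ.differentiable]
  simp [dflow]

/-- Extension by zero to `t ≤ 0`: the zero trace allows test functions that do not vanish near
`t = 0`. -/
theorem IsRealSolution.extend_deriv_t (h : IsRealSolution T B₁ B₂ a c d u f G) (h2 : t₂ < T)
    (hχ : IsTest χ) (hχ₂ : ∀ z : Pt m n, t₂ ≤ z.1 → χ z = 0) :
    ∫ z, fderiv ℝ χ z (et m n) * pull (drift B₁ B₂) T u z =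
      -∫ z, χ z * pull (drift B₁ B₂) T f z := by
  have hU := memLp_pull (drift B₁ B₂) h.memLp_u
  have hF := memLp_pull (drift B₁ B₂) h.memLp_f
  have h1 := tendsto_integral_ramp_mul (T := T) ((hχ.fderiv_apply (et m n)).memLp.integrable_mul hU)
    fun z hz => by rw [Pi.mul_apply, pull_apply_of_notMem _ hz, mul_zero]
  have h3 := (tendsto_integral_ramp_mul (T := T) (hχ.memLp.integrable_mul hF)
    fun z hz => by rw [Pi.mul_apply, pull_apply_of_notMem _ hz, mul_zero]).neg
  have h4 := tendsto_integral_deriv_ramp_mul h.memLp_u h.trace_zero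
    (hχ.comp_flowHomeo_symm (drift B₁ B₂))
  have h5 := (h4.neg.add h3)
  rw [neg_zero, zero_add] at h5
  refine tendsto_nhds_unique h1 (h5.congr fun k => ?_)
  have hk : (0 : ℝ) < 1 / ((k : ℝ) + 1) := by positivity
  have h6 := h.pull_deriv_t (hχ.time_mul (contDiff_ramp (1 / ((k : ℝ) + 1))))
    (tsupport_ramp_mul hk h2 hχ₂)
  have hr := contDiff_ramp (1 / ((k : ℝ) + 1))
  have h8 : ∫ z in (slab m n T : Set (Pt m n)), deriv (ramp (1 / ((k : ℝ) + 1))) z.1 *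
      ((χ ∘ (flowHomeo (drift B₁ B₂)).symm) z * u z) =
      ∫ z, deriv (ramp (1 / ((k : ℝ) + 1))) z.1 * χ z * pull (drift B₁ B₂) T u z := by
    simp only [← mul_assoc]
    rw [setIntegral_slab_eq (drift B₁ B₂)]
    simp only [Function.comp_apply, Homeomorph.symm_apply_apply]
    rfl
  simp only [fderiv_time_mul (hr.differentiable (by simp)) hχ.differentiable] at h6
  rw [h8]
  simp only [Pi.mul_apply, ← mul_assoc]
  have i1 : Integrable fun z : Pt m n =>
      deriv (ramp (1 / ((k : ℝ) + 1))) z.1 * χ z * pull (drift B₁ B₂) T u z := by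
    refine MemLp.integrable_mul (p := 2) (q := 2) (IsTest.memLp ?_) hU
    exact hχ.time_mul ((contDiff_infty_iff_deriv.1 hr).2)
  have i2 : Integrable fun z : Pt m n =>
      ramp (1 / ((k : ℝ) + 1)) z.1 * fderiv ℝ χ z (et m n) * pull (drift B₁ B₂) T u z :=
    MemLp.integrable_mul (p := 2) (q := 2) ((hχ.fderiv_apply (et m n)).time_mul hr).memLp hU
  have h7 : ∫ z, (et m n).1 * deriv (ramp (1 / ((k : ℝ) + 1))) z.1 * χ z *
        pull (drift B₁ B₂) T u z + ramp (1 / ((k : ℝ) + 1)) z.1 * fderiv ℝ χ z (et m n) *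
        pull (drift B₁ B₂) T u z = -∫ z, ramp (1 / ((k : ℝ) + 1)) z.1 * χ z *
        pull (drift B₁ B₂) T f z := by
    rw [← h6]
    exact integral_congr_ae (Eventually.of_forall fun z => by simp only [add_mul])
  simp only [et, one_mul] at h7 i2 ⊢
  rw [integral_add i1 i2] at h7
  linarith

theorem IsRealSolution.extend_deriv_v (h : IsRealSolution T B₁ B₂ a c d u f G) (h2 : t₂ < T)
    (hχ : IsTest χ) (hχ₂ : ∀ z : Pt m n, t₂ ≤ z.1 → χ z = 0) (i : Fin m) :
    ∫ z, dflow B₁ B₂ χ i z * pull (drift B₁ B₂) T u z =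
      -∫ z, χ z * pull (drift B₁ B₂) T (G i) z := by
  have hU := memLp_pull (drift B₁ B₂) h.memLp_u
  have hG := memLp_pull (drift B₁ B₂) (h.memLp_G i)
  have h1 := tendsto_integral_ramp_mul (T := T)
    ((hχ.dflow (B₁ := B₁) (B₂ := B₂) i).memLp.integrable_mul hU)
    fun z hz => by rw [Pi.mul_apply, pull_apply_of_notMem _ hz, mul_zero]
  have h3 := (tendsto_integral_ramp_mul (T := T) (hχ.memLp.integrable_mul hG)
    fun z hz => by rw [Pi.mul_apply, pull_apply_of_notMem _ hz, mul_zero]).neg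
  refine tendsto_nhds_unique h1 (h3.congr fun k => ?_)
  have hk : (0 : ℝ) < 1 / ((k : ℝ) + 1) := by positivity
  have h6 := h.pull_deriv_v (hχ.time_mul (contDiff_ramp (1 / ((k : ℝ) + 1))))
    (tsupport_ramp_mul hk h2 hχ₂) i
  simp only [dflow_time_mul (contDiff_ramp _) hχ] at h6
  simp only [Pi.mul_apply, ← mul_assoc]
  exact h6.symm

theorem IsRealSolution.extend_equation (h : IsRealSolution T B₁ B₂ a c d u f G) (h2 : t₂ < T)
    (ha : ∀ i j z y, a i j (z + (0, 0, y)) = a i j z) (hc : ∀ z y, c (z + (0, 0, y)) = c z)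
    (hd : ∀ i z y, d i (z + (0, 0, y)) = d i z) (bda : ∀ i j, BddMeas (a i j)) (bdc : BddMeas c)
    (bdd : ∀ i, BddMeas (d i)) (hχ : IsTest χ) (hχ₂ : ∀ z : Pt m n, t₂ ≤ z.1 → χ z = 0) :
    ∫ z, χ z * (c z * pull (drift B₁ B₂) T u z + ∑ i, d i z * pull (drift B₁ B₂) T (G i) z -
        pull (drift B₁ B₂) T f z) =
      -∑ i, ∑ j, ∫ z, a i j z * dflow B₁ B₂ χ i z * pull (drift B₁ B₂) T (G j) z := by
  have hU := memLp_pull (drift B₁ B₂) h.memLp_u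
  have hF := memLp_pull (drift B₁ B₂) h.memLp_f
  have hG := fun i => memLp_pull (drift B₁ B₂) (h.memLp_G i)
  have hR : MemLp (fun z => c z * pull (drift B₁ B₂) T u z +
      ∑ i, d i z * pull (drift B₁ B₂) T (G i) z - pull (drift B₁ B₂) T f z) 2 volume :=
    ((bdc.memLp_mul hU).add (memLp_finsetSum _ fun i _ => (bdd i).memLp_mul (hG i))).sub hF
  have h1 := tendsto_integral_ramp_mul (T := T) (hχ.memLp.integrable_mul hR)
    fun z hz => by simp only [Pi.mul_apply, pull_apply_of_notMem _ hz, mul_zero,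
      Finset.sum_const_zero, add_zero, sub_zero]
  have h3 : Tendsto (fun k : ℕ => -∑ i, ∑ j, ∫ z, ramp (1 / ((k : ℝ) + 1)) z.1 *
      (a i j z * dflow B₁ B₂ χ i z * pull (drift B₁ B₂) T (G j) z)) atTop
      (𝓝 (-∑ i, ∑ j, ∫ z, a i j z * dflow B₁ B₂ χ i z * pull (drift B₁ B₂) T (G j) z)) := by
    refine (tendsto_finsetSum _ fun i _ => tendsto_finsetSum _ fun j _ =>
      tendsto_integral_ramp_mul (T := T) ?_ fun z hz => by rw [pull_apply_of_notMem _ hz, mul_zero]).neg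
    exact MemLp.integrable_mul (p := 2) (q := 2) ((bda i j).memLp_mul (hχ.dflow i).memLp) (hG j)
  refine tendsto_nhds_unique h1 (h3.congr fun k => ?_)
  have hk : (0 : ℝ) < 1 / ((k : ℝ) + 1) := by positivity
  have h6 := h.pull_equation ha hc hd (hχ.time_mul (contDiff_ramp (1 / ((k : ℝ) + 1))))
    (tsupport_ramp_mul hk h2 hχ₂)
  simp only [dflow_time_mul (contDiff_ramp _) hχ] at h6
  simp only [Pi.mul_apply, ← mul_assoc]
  rw [h6]
  refine congrArg Neg.neg (Finset.sum_congr rfl fun i _ => Finset.sum_congr rfl fun j _ => ?_)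
  exact integral_congr_ae (Eventually.of_forall fun z => by ring)

end Extension

/-! ### From real solutions to the straightened equation -/

section Flattening

variable {m n : ℕ} {T t₂ lam : ℝ}

theorem inner_mulL_cut_toL2 {θ : ℝ → ℝ} (hθ : Continuous θ) {ψ g : Pt m n → ℝ}
    (hψ : MemLp ψ 2 volume) (hg : MemLp g 2 volume) (h0 : ∀ z : Pt m n, z.1 ∉ Ioo 0 T → g z = 0) :
    ⟪toL2 volume ψ, mulL volume (cut T θ) (toL2 volume g)⟫ = ∫ z, θ z.1 * ψ z * g z := by
  have hb : BddMeas (cut T θ : Pt m n → ℝ) := bddMeas_cut_of_continuous hθ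
  rw [mulL_toL2 hb hg, inner_toL2 hψ]
  refine integral_congr_ae ?_
  filter_upwards [coeFn_toL2 (hb.memLp_mul hg)] with z hz
  rw [hz]
  by_cases h : z.1 ∈ Ioo 0 T
  · rw [cut, indicator_of_mem h]; ring
  · rw [h0 z h]; ring

theorem ae_mulL_cut_eq_zero {θ : ℝ → ℝ} (hθ : Continuous θ) (g : Lp ℝ 2 (volume : Measure (Pt m n))) :
    ∀ᵐ z : Pt m n, z.1 ∉ Ioo 0 T → mulL volume (cut T θ) g z = 0 := by
  filter_upwards [coeFn_mulL (bddMeas_cut_of_continuous (m := m) (n := n) (T := T) hθ) g] with z hz h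
  rw [hz, cut, indicator_of_notMem h, zero_mul]

variable {B₁ : Matrix (Fin n) (Fin m) ℝ} {B₂ : Matrix (Fin n) (Fin n) ℝ}
  {a : Fin m → Fin m → Pt m n → ℝ} {q : Fin m → Fin n → Pt m n → ℝ} {c : Pt m n → ℝ}
  {d : Fin m → Pt m n → ℝ} {u f : Pt m n → ℝ} {G : Fin m → Pt m n → ℝ}

/-- Decomposition of the straightened field `e_i(t) = exp (-t M) (e_i, 0)` into coordinates. -/
theorem dflow_eq {q : Fin n → ℝ} {i : Fin m} {z : Pt m n}
    (hq : ∀ k, q k = (flow (drift B₁ B₂) (-z.1) (EuclideanSpace.single i 1, 0)).2 k)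
    (ψ : Pt m n → ℝ) :
    dflow B₁ B₂ ψ i z =
      fderiv ℝ ψ z (ev n i) + ∑ k, q k * fderiv ℝ ψ z (ey m k) := by
  have h1 : ((0, flow (drift B₁ B₂) (-z.1) (EuclideanSpace.single i 1, 0)) : Pt m n) =
      ev n i + ∑ k, q k • ey m k := by
    refine Prod.ext ?_ (Prod.ext ?_ ?_)
    · simp [ev, ey, Prod.fst_sum]
    · simp [ev, ey, flow_drift_fst, Prod.fst_sum, Prod.snd_sum]
    · ext k
      simp [ev, ey, Prod.snd_sum, hq, Pi.single_apply]
  rw [dflow, h1, map_add, map_sum]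
  simp only [map_smul, smul_eq_mul]

/-- Testing with the straightened field, for functions supported in the slab, where `q` agrees with
the coordinates of `e_i(t)`. -/
theorem inner_dir {q : Fin n → Pt m n → ℝ} {i : Fin m} (hqb : ∀ k, BddMeas (q k))
    (hq : ∀ k (z : Pt m n), z.1 ∈ Ioo 0 T →
      q k z = (flow (drift B₁ B₂) (-z.1) (EuclideanSpace.single i 1, 0)).2 k)
    {ψ : Pt m n → ℝ} (hψ : IsTest ψ) {g : Lp ℝ 2 (volume : Measure (Pt m n))}
    (hg : ∀ᵐ z : Pt m n, z.1 ∉ Ioo 0 T → g z = 0) :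
    ⟪toL2 volume (fun z => fderiv ℝ ψ z (ev n i)), g⟫ +
      ∑ k, ⟪toL2 volume (fun z => fderiv ℝ ψ z (ey m k)), mulL volume (q k) g⟫ =
      ⟪toL2 volume (dflow B₁ B₂ ψ i), g⟫ := by
  simp only [inner_eq_integral]
  rw [← integral_finsetSum _ fun k _ => integrable_mul_L2 _ _,
    ← integral_add (integrable_mul_L2 _ _) (integrable_finsetSum _ fun k _ => integrable_mul_L2 _ _)]
  refine integral_congr_ae ?_
  have h1 : ∀ᵐ z : Pt m n, ∀ k, toL2 volume (fun z => fderiv ℝ ψ z (ey m k)) z =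
      fderiv ℝ ψ z (ey m k) := ae_all_iff.2 fun k => coeFn_toL2 (hψ.fderiv_apply _).memLp
  have h2 : ∀ᵐ z : Pt m n, ∀ k, mulL volume (q k) g z = q k z * g z :=
    ae_all_iff.2 fun k => coeFn_mulL (hqb k) g
  filter_upwards [hg, h1, h2, coeFn_toL2 (hψ.fderiv_apply (ev n i)).memLp,
    coeFn_toL2 (hψ.dflow (B₁ := B₁) (B₂ := B₂) i).memLp] with z h0 h1 h2 h3 h4
  rw [h3, h4]
  by_cases hz : z.1 ∈ Ioo 0 T
  · rw [dflow_eq (fun k => hq k z hz), add_mul, Finset.sum_mul]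
    congr 1
    refine Finset.sum_congr rfl fun k _ => ?_
    rw [h1, h2]; ring
  · simp [h0 hz, h2]

/-- In straightened coordinates a real solution with zero initial trace solves the flat equation. -/
theorem IsRealSolution.isFlatSolution (h : IsRealSolution T B₁ B₂ a c d u f G) (h2 : t₂ < T)
    (hc : FlatCoeff lam T a q c d)
    (hq : ∀ i k (z : Pt m n), z.1 ∈ Ioo 0 T →
      q i k z = (flow (drift B₁ B₂) (-z.1) (EuclideanSpace.single i 1, 0)).2 k) :
    IsFlatSolution T t₂ a q c d (toL2 volume (pull (drift B₁ B₂) T u))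
      (toL2 volume (pull (drift B₁ B₂) T f)) fun i => toL2 volume (pull (drift B₁ B₂) T (G i)) := by
  have hU := memLp_pull (drift B₁ B₂) h.memLp_u
  have hF := memLp_pull (drift B₁ B₂) h.memLp_f
  have hG := fun i => memLp_pull (drift B₁ B₂) (h.memLp_G i)
  have h0 : ∀ g : Pt m n → ℝ, ∀ z : Pt m n, z.1 ∉ Ioo 0 T → pull (drift B₁ B₂) T g z = 0 :=
    fun g z hz => pull_apply_of_notMem _ hz
  refine ⟨fun θ hθ hθ₂ ψ hψ => ?_, fun θ hθ hθ₂ i ψ hψ => ?_, fun θ hθ hθ₂ ψ hψ => ?_⟩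
  · have hd : Continuous (deriv θ) := hθ.continuous_deriv (by simp)
    rw [inner_add_right, inner_mulL_cut_toL2 hθ.continuous hψ.memLp hF (h0 f),
      inner_mulL_cut_toL2 hd hψ.memLp hU (h0 u),
      inner_mulL_cut_toL2 hθ.continuous (hψ.fderiv_apply _).memLp hU (h0 u)]
    have h1 := h.extend_deriv_t h2 (hψ.time_mul hθ) fun z hz => by rw [hθ₂ _ hz, zero_mul]
    have i1 : Integrable fun z : Pt m n => deriv θ z.1 * ψ z * pull (drift B₁ B₂) T u z :=
      MemLp.integrable_mul (p := 2) (q := 2)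
        (hψ.time_mul (contDiff_infty_iff_deriv.1 hθ).2).memLp hU
    have i2 : Integrable fun z : Pt m n =>
        θ z.1 * fderiv ℝ ψ z (et m n) * pull (drift B₁ B₂) T u z :=
      MemLp.integrable_mul (p := 2) (q := 2) ((hψ.fderiv_apply (et m n)).time_mul hθ).memLp hU
    have h3 : ∫ z, fderiv ℝ (fun z : Pt m n => θ z.1 * ψ z) z (et m n) *
        pull (drift B₁ B₂) T u z = ∫ z, deriv θ z.1 * ψ z * pull (drift B₁ B₂) T u z +
          θ z.1 * fderiv ℝ ψ z (et m n) * pull (drift B₁ B₂) T u z := by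
      refine integral_congr_ae (Eventually.of_forall fun z => ?_)
      simp only [fderiv_time_mul (hθ.differentiable (by simp)) hψ.differentiable, et]
      ring
    rw [h3, integral_add i1 i2] at h1
    linarith
  · rw [Fintype.sum_option]
    simp only [Option.elim]
    rw [inner_dir (hc.bddMeas_q i) (hq i) hψ (ae_mulL_cut_eq_zero hθ.continuous _),
      inner_mulL_cut_toL2 hθ.continuous hψ.memLp (hG i) (h0 (G i)),
      inner_mulL_cut_toL2 hθ.continuous (hψ.dflow i).memLp hU (h0 u)]
    have h1 := h.extend_deriv_v h2 (hψ.time_mul hθ) (fun z hz => by rw [hθ₂ _ hz, zero_mul]) i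
    simp only [dflow_time_mul hθ hψ] at h1
    rw [h1, neg_neg]
  · have hR : MemLp (fun z => c z * pull (drift B₁ B₂) T u z +
        ∑ i, d i z * pull (drift B₁ B₂) T (G i) z - pull (drift B₁ B₂) T f z) 2 volume :=
      ((hc.bddMeas_c.memLp_mul hU).add
        (memLp_finsetSum _ fun i _ => (hc.bddMeas_d i).memLp_mul (hG i))).sub hF
    have hR' : mulL volume c (toL2 volume (pull (drift B₁ B₂) T u)) +
        ∑ i, mulL volume (d i) (toL2 volume (pull (drift B₁ B₂) T (G i))) -
        toL2 volume (pull (drift B₁ B₂) T f) = toL2 volume (fun z => c z * pull (drift B₁ B₂) T u z +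
        ∑ i, d i z * pull (drift B₁ B₂) T (G i) z - pull (drift B₁ B₂) T f z) := by
      symm
      apply toL2_congr
      have h1 : ∀ᵐ z : Pt m n, ∀ i, mulL volume (d i) (toL2 volume (pull (drift B₁ B₂) T (G i))) z =
          d i z * pull (drift B₁ B₂) T (G i) z := ae_all_iff.2 fun i => by
        filter_upwards [coeFn_mulL (hc.bddMeas_d i) (toL2 volume (pull (drift B₁ B₂) T (G i))),
          coeFn_toL2 (hG i)] with z h3 h4
        rw [h3, h4]
      filter_upwards [h1, coeFn_mulL hc.bddMeas_c (toL2 volume (pull (drift B₁ B₂) T u)),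
        coeFn_toL2 hU, coeFn_toL2 hF, Lp.coeFn_sub (mulL volume c (toL2 volume
          (pull (drift B₁ B₂) T u)) + ∑ i, mulL volume (d i) (toL2 volume
          (pull (drift B₁ B₂) T (G i)))) (toL2 volume (pull (drift B₁ B₂) T f)),
        Lp.coeFn_add (mulL volume c (toL2 volume (pull (drift B₁ B₂) T u)))
          (∑ i, mulL volume (d i) (toL2 volume (pull (drift B₁ B₂) T (G i)))),
        Lp.coeFn_finsetSum Finset.univ fun i => mulL volume (d i) (toL2 volume
          (pull (drift B₁ B₂) T (G i)))] with z e1 e2 e3 e4 e5 e6 e7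
      rw [e5, Pi.sub_apply, e6, Pi.add_apply, e7, e2, e3, e4, Finset.sum_apply]
      simp only [e1]
    rw [hR', inner_mulL_cut_toL2 hθ.continuous hψ.memLp hR fun z hz => by simp [h0 _ z hz],
      Fintype.sum_sum_type]
    have h1 := h.extend_equation h2 hc.a_invariant hc.c_invariant hc.d_invariant hc.bddMeas_a
      hc.bddMeas_c hc.bddMeas_d (hψ.time_mul hθ) fun z hz => by rw [hθ₂ _ hz, zero_mul]
    rw [h1]
    simp only [Sum.elim_inl, Sum.elim_inr, inner_sum]
    rw [Finset.sum_comm (s := (Finset.univ : Finset (Fin n))), ← Finset.sum_add_distrib]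
    refine congrArg Neg.neg (Finset.sum_congr rfl fun i _ => ?_)
    have hz : ∀ᵐ z : Pt m n, z.1 ∉ Ioo 0 T → flux a (fun j => mulL volume (cut T θ)
        (toL2 volume (pull (drift B₁ B₂) T (G j)))) i z = 0 := by
      have e1 : ∀ᵐ z : Pt m n, ∀ j, z.1 ∉ Ioo 0 T →
          mulL volume (a i j) (mulL volume (cut T θ)
            (toL2 volume (pull (drift B₁ B₂) T (G j)))) z = 0 := ae_all_iff.2 fun j => by
        filter_upwards [coeFn_mulL (hc.bddMeas_a i j) (mulL volume (cut T θ)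
            (toL2 volume (pull (drift B₁ B₂) T (G j)))),
          ae_mulL_cut_eq_zero (T := T) hθ.continuous (toL2 volume (pull (drift B₁ B₂) T (G j)))]
          with z e2 e3 hz
        rw [e2, e3 hz, mul_zero]
      filter_upwards [e1, Lp.coeFn_finsetSum Finset.univ fun j => mulL volume (a i j) (mulL volume (cut T θ)
            (toL2 volume (pull (drift B₁ B₂) T (G j))))] with z e1 e2 hz
      rw [flux, e2, Finset.sum_apply]
      exact Finset.sum_eq_zero fun j _ => e1 j hz
    rw [inner_dir (hc.bddMeas_q i) (hq i) hψ hz, flux, inner_sum]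
    refine Finset.sum_congr rfl fun j _ => ?_
    rw [← inner_mulL (hc.bddMeas_a i j), mulL_toL2 (hc.bddMeas_a i j) (hψ.dflow i).memLp,
      inner_mulL_cut_toL2 hθ.continuous ((hc.bddMeas_a i j).memLp_mul (hψ.dflow i).memLp) (hG j)
        (h0 (G j))]
    refine integral_congr_ae (Eventually.of_forall fun z => ?_)
    simp only [dflow_time_mul hθ hψ]
    ring

end Flattening

/-! ### Extension of the coefficients -/

section Coefficients

variable {m n : ℕ} {T lam : ℝ}

/-- Almost every `(t, v)` in the sense of the coefficient domain is almost every `(t, v, w)` in the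
slab. -/
theorem ae_slab_of_ae_coeffDomain {p : ℝ × EuclideanSpace ℝ (Fin m) → Prop}
    (h : ∀ᵐ x ∂(volume.restrict (coeffDomain m T)), p x) :
    ∀ᵐ z ∂(volume.restrict (slab m n T : Set (Pt m n))), p (z.1, z.2.1) := by
  rw [coeffDomain, ae_restrict_iff' (measurableSet_Ioo.prod MeasurableSet.univ)] at h
  rw [ae_restrict_iff' measurableSet_slab]
  have h1 : Measure.QuasiMeasurePreserving (fun z : Pt m n => (z.1, z.2.1)) volume volume :=
    Measure.quasiMeasurePreserving_fst.comp
      ((volume_preserving_prodAssoc (α₁ := ℝ) (β₁ := EuclideanSpace ℝ (Fin m))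
        (γ₁ := EuclideanSpace ℝ (Fin n))).symm).quasiMeasurePreserving
  filter_upwards [h1.ae h] with z hz h2
  exact hz ⟨mem_slab.1 h2, mem_univ _⟩

/-- A bounded measurable function on the coefficient domain has a representative that is bounded
and measurable everywhere. -/
theorem exists_bddMeas_ae_eq {g : ℝ × EuclideanSpace ℝ (Fin m) → ℝ}
    (hg : AEStronglyMeasurable g (volume.restrict (coeffDomain m T))) {C : ℝ}
    (hC : ∀ᵐ x ∂(volume.restrict (coeffDomain m T)), |g x| ≤ C) :
    ∃ b : ℝ × EuclideanSpace ℝ (Fin m) → ℝ, BddMeas b ∧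
      ∀ᵐ x ∂(volume.restrict (coeffDomain m T)), b x = g x := by
  refine ⟨fun x => max (-C) (min C (hg.mk g x)), ⟨?_, |C|, fun x => ?_⟩, ?_⟩
  · exact measurable_const.max (measurable_const.min hg.stronglyMeasurable_mk.measurable)
  · rw [abs_le]
    exact ⟨(neg_le_neg (le_abs_self C)).trans (le_max_left _ _),
      max_le (neg_le_abs C) ((min_le_left _ _).trans (le_abs_self C))⟩
  · filter_upwards [hC, hg.ae_eq_mk] with x h1 h2
    rw [← h2, min_eq_right (abs_le.1 h1).2, max_eq_right (abs_le.1 h1).1]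

/-- The entries of a symmetric matrix with quadratic form between `0` and `lam |ξ|²` are bounded
by `lam`. -/
theorem abs_entry_le {A : Matrix (Fin m) (Fin m) ℝ} (hA : A.IsSymm)
    (h0 : ∀ ξ : EuclideanSpace ℝ (Fin m), 0 ≤ ∑ i, ∑ j, A i j * ξ i * ξ j)
    (h1 : ∀ ξ : EuclideanSpace ℝ (Fin m), ∑ i, ∑ j, A i j * ξ i * ξ j ≤ lam * ‖ξ‖ ^ 2)
    (i j : Fin m) : |A i j| ≤ lam := by
  have hd : ∀ k, A k k ≤ lam := fun k => by
    have := h1 (EuclideanSpace.single k 1)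
    simpa [Pi.single_apply] using this
  -- the quadratic form at `e_i + s e_j`
  have hq : ∀ s : ℝ, 0 ≤ A i i + 2 * s * A i j + s ^ 2 * A j j := fun s => by
    have := h0 (EuclideanSpace.single i 1 + EuclideanSpace.single j s)
    simp only [PiLp.add_apply, PiLp.single_apply, mul_add, add_mul, mul_ite, mul_one,
      mul_zero, ite_mul, zero_mul, Finset.sum_add_distrib, Finset.sum_ite_eq', Finset.mem_univ,
      if_true] at this
    have hs : A j i = A i j := hA.apply i j
    simp only [hs] at this
    nlinarith [this]
  rw [abs_le]
  constructor <;> nlinarith [hq 1, hq (-1), hd i, hd j]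

/-- The fields `e_i(t)` are cut off smoothly outside `[0, T]`, to have bounded and Lipschitz
coefficients on the whole space. -/
theorem exists_flowCoeff (hT : 0 < T) (B₁ : Matrix (Fin n) (Fin m) ℝ)
    (B₂ : Matrix (Fin n) (Fin n) ℝ) (i : Fin m) (k : Fin n) :
    ∃ (g : ℝ → ℝ) (C : ℝ≥0), ContDiff ℝ ∞ g ∧ (∃ B, ∀ t, |g t| ≤ B) ∧ LipschitzWith C g ∧
      ∀ t ∈ Ioo 0 T, g t = (flow (drift B₁ B₂) (-t) (EuclideanSpace.single i 1, 0)).2 k := by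
  let β : ContDiffBump (0 : ℝ) := ⟨T, T + 1, hT, by linarith⟩
  set r : ℝ → ℝ := fun t => (flow (drift B₁ B₂) (-t) (EuclideanSpace.single i 1, 0)).2 k with hr
  have hrs : ContDiff ℝ ∞ r := by
    have h1 : ContDiff ℝ ∞ fun t : ℝ =>
        flow (drift B₁ B₂) (-t) (EuclideanSpace.single i 1, 0) :=
      ((contDiff_flow _).comp contDiff_neg).clm_apply contDiff_const
    exact ((EuclideanSpace.proj k : EuclideanSpace ℝ (Fin n) →L[ℝ] ℝ).contDiff).comp
      (contDiff_snd.comp h1)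
  have hs : ContDiff ℝ ∞ fun t => β t * r t := β.contDiff.mul hrs
  have hc : HasCompactSupport fun t => β t * r t := β.hasCompactSupport.mul_right
  obtain ⟨C, hC⟩ := hs.lipschitzWith_of_hasCompactSupport hc (by simp)
  refine ⟨_, C, hs, hs.continuous.bounded_above_of_compact_support hc, hC, fun t ht => ?_⟩
  rw [β.one_of_mem_closedBall, one_mul]
  rw [mem_closedBall_zero_iff, Real.norm_eq_abs, abs_of_pos ht.1]
  exact ht.2.le

/-- The coefficients have extensions to the whole space that satisfy the requirements of the
straightened equation. The constant `κ` is the zeroth order term produced by the drift. -/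
theorem CoeffHyp.exists_flatCoeff (hT : 0 < T) (hm : 1 ≤ m) (hlam : 1 < lam)
    {A : ℝ × EuclideanSpace ℝ (Fin m) → Matrix (Fin m) (Fin m) ℝ}
    {c : ℝ × EuclideanSpace ℝ (Fin m) → ℝ}
    {d : ℝ × EuclideanSpace ℝ (Fin m) → EuclideanSpace ℝ (Fin m)} (h : CoeffHyp lam T A c d)
    (B₁ : Matrix (Fin n) (Fin m) ℝ) (B₂ : Matrix (Fin n) (Fin n) ℝ) (κ : ℝ) :
    ∃ (a : Fin m → Fin m → Pt m n → ℝ) (q : Fin m → Fin n → Pt m n → ℝ) (c' : Pt m n → ℝ)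
      (d' : Fin m → Pt m n → ℝ), FlatCoeff lam T a q c' d' ∧
      (∀ i k (z : Pt m n), z.1 ∈ Ioo 0 T →
        q i k z = (flow (drift B₁ B₂) (-z.1) (EuclideanSpace.single i 1, 0)).2 k) ∧
      (∀ i j (z : Pt m n), z.1 ∈ Ioo 0 T → a i j z = A (z.1, z.2.1) i j) ∧
      (∀ᵐ z ∂(volume.restrict (slab m n T : Set (Pt m n))), c' z = c (z.1, z.2.1) + κ) ∧
      ∀ i, ∀ᵐ z ∂(volume.restrict (slab m n T : Set (Pt m n))), d' i z = d (z.1, z.2.1) i := by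
  have hlam0 : 0 < lam := one_pos.trans hlam
  -- the diffusion matrix: Lipschitz extension, symmetrization, truncation
  choose Ka hKa using h.lipschitz
  choose g hgL hgE using fun i j => (hKa i j).extend_real
  set g' : Fin m → Fin m → ℝ × EuclideanSpace ℝ (Fin m) → ℝ := fun i j p =>
    max (-lam) (min lam ((g i j p + g j i p) / 2)) with hg'
  have hg'E : ∀ i j, ∀ p ∈ coeffDomain m T, g' i j p = A p i j := fun i j p hp => by
    have hs : A p j i = A p i j := (h.symm p hp).apply i j
    have hb := abs_le.1 (abs_entry_le (h.symm p hp) (fun ξ => le_trans (by positivity)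
      (h.elliptic p hp ξ).1) (fun ξ => (h.elliptic p hp ξ).2) i j)
    simp only [hg', ← hgE i j hp, ← hgE j i hp, hs, add_self_div_two]
    rw [min_eq_right hb.2, max_eq_right hb.1]
  have hg'L : ∃ K : ℝ≥0, ∀ i j, LipschitzWith K (g' i j) := by
    have h1 : ∀ i j, ∃ K : ℝ≥0, LipschitzWith K (g' i j) := fun i j => by
      have h2 : LipschitzWith (Ka i j + Ka j i) fun p => (g i j p + g j i p) / 2 := by
        refine LipschitzWith.of_dist_le_mul fun x y => ?_
        have h3 := (hgL i j).dist_le_mul x y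
        have h4 := (hgL j i).dist_le_mul x y
        have h5 : (0 : ℝ) ≤ (Ka i j + Ka j i) * dist x y := by positivity
        rw [Real.dist_eq] at *
        have h6 : (g i j x + g j i x) / 2 - (g i j y + g j i y) / 2 =
          ((g i j x - g i j y) + (g j i x - g j i y)) / 2 := by ring
        rw [h6, abs_div, abs_two]
        have := abs_add_le (g i j x - g i j y) (g j i x - g j i y)
        push_cast
        linarith
      exact ⟨_, (h2.const_min lam).const_max (-lam)⟩
    choose K hK using h1
    refine ⟨∑ i, ∑ j, K i j, fun i j => (hK i j).weaken ?_⟩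
    exact (Finset.single_le_sum (f := fun j => K i j) (fun _ _ => zero_le) (Finset.mem_univ j)).trans
      (Finset.single_le_sum (f := fun i => ∑ j, K i j) (fun _ _ => zero_le) (Finset.mem_univ i))
  obtain ⟨K, hK⟩ := hg'L
  -- the lower order coefficients
  have hbd := h.bound ⟨0, hm⟩ ⟨0, hm⟩
  obtain ⟨c₁, hc₁, hc₁E⟩ := exists_bddMeas_ae_eq h.aestronglyMeasurable_c (C := lam) (by
    filter_upwards [hbd] with p hp
    have h1 := abs_nonneg (deriv (fun s : ℝ => A (s, p.2) ⟨0, hm⟩ ⟨0, hm⟩) p.1)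
    have h2 := norm_nonneg (fderiv ℝ (fun v : EuclideanSpace ℝ (Fin m) =>
      A (p.1, v) ⟨0, hm⟩ ⟨0, hm⟩) p.2)
    linarith [norm_nonneg (d p)])
  have hdi : ∀ i, ∃ b : ℝ × EuclideanSpace ℝ (Fin m) → ℝ, BddMeas b ∧
      ∀ᵐ x ∂(volume.restrict (coeffDomain m T)), b x = d x i := fun i => by
    refine exists_bddMeas_ae_eq ((EuclideanSpace.proj i :
      EuclideanSpace ℝ (Fin m) →L[ℝ] ℝ).continuous.comp_aestronglyMeasurable
        h.aestronglyMeasurable_d) (C := lam) ?_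
    filter_upwards [hbd] with p hp
    have h1 := abs_nonneg (deriv (fun s : ℝ => A (s, p.2) ⟨0, hm⟩ ⟨0, hm⟩) p.1)
    have h2 := norm_nonneg (fderiv ℝ (fun v : EuclideanSpace ℝ (Fin m) =>
      A (p.1, v) ⟨0, hm⟩ ⟨0, hm⟩) p.2)
    have h3 : |d p i| ≤ ‖d p‖ := PiLp.norm_apply_le (d p) i
    change |d p i| ≤ lam
    linarith [abs_nonneg (c p)]
  choose d₁ hd₁ hd₁E using hdi
  choose q₁ Kq hqs hqb hqL hqE using exists_flowCoeff (T := T) hT B₁ B₂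
  have hπ : Measurable fun z : Pt m n => (z.1, z.2.1) :=
    measurable_fst.prodMk (measurable_fst.comp measurable_snd)
  refine ⟨fun i j z => g' i j (z.1, z.2.1), fun i k z => q₁ i k z.1,
    fun z => c₁ (z.1, z.2.1) + κ, fun i z => d₁ i (z.1, z.2.1), ?_,
    fun i k z hz => hqE i k z.1 hz, fun i j z hz => hg'E i j _ ⟨hz, mem_univ _⟩, ?_,
    fun i => ae_slab_of_ae_coeffDomain (hd₁E i)⟩
  · constructor
    · refine fun i j => ⟨(hK i j).continuous.measurable.comp hπ, lam, fun z => abs_le.2 ⟨?_, ?_⟩⟩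
      · exact le_max_left _ _
      · exact max_le (by linarith) (min_le_left _ _)
    · intro i j
      ext z
      simp only [hg', add_comm]
    · refine ⟨K, K.2, fun i j z s => ?_⟩
      have h1 := (hK i j).dist_le_mul ((z + s • et m n).1, (z + s • et m n).2.1) (z.1, z.2.1)
      rw [Real.dist_eq] at h1
      refine h1.trans (mul_le_mul_of_nonneg_left ?_ K.2)
      simp [et, Prod.dist_eq]
    · intro i j z y
      simp
    · intro z hz ξ
      have h1 := (h.elliptic (z.1, z.2.1) ⟨hz, mem_univ _⟩ (WithLp.toLp 2 ξ)).1
      simp only [hg'E _ _ (z.1, z.2.1) ⟨hz, mem_univ _⟩]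
      rwa [EuclideanSpace.real_norm_sq_eq] at h1
    · exact fun i k => ⟨(hqs i k).continuous.measurable.comp measurable_fst,
        (hqb i k).imp fun B hB z => hB _⟩
    · exact fun i k => (hqs i k).comp contDiff_fst
    · refine ⟨∑ i, ∑ k, Kq i k, by positivity, fun i k z s => ?_⟩
      have h1 := (hqL i k).dist_le_mul (z + s • et m n).1 z.1
      have h2 : (Kq i k : ℝ) ≤ ∑ i, ∑ k, (Kq i k : ℝ) :=
        (Finset.single_le_sum (f := fun k => (Kq i k : ℝ)) (fun _ _ => NNReal.coe_nonneg _)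
          (Finset.mem_univ k)).trans (Finset.single_le_sum (f := fun i => ∑ k, (Kq i k : ℝ))
          (fun _ _ => by positivity) (Finset.mem_univ i))
      rw [Real.dist_eq] at h1
      refine h1.trans (mul_le_mul h2 ?_ dist_nonneg (by positivity))
      simp [et]
    · intro i k z y
      simp
    · obtain ⟨C, hC⟩ := hc₁.2
      refine ⟨(hc₁.1.comp hπ).add_const κ, C + |κ|, fun z => ?_⟩
      exact (abs_add_le _ _).trans (add_le_add (hC _) le_rfl)
    · intro z y
      simp
    · exact fun i => ⟨(hd₁ i).1.comp hπ, (hd₁ i).2.imp fun C hC z => hC _⟩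
    · intro i z y
      simp
  · filter_upwards [ae_slab_of_ae_coeffDomain (n := n) hc₁E] with z hz
    rw [hz]

end Coefficients

/-! ### Real and imaginary parts -/

section RealPart

variable {m n : ℕ} {T lam : ℝ}

/-- Real-linear functionals commute with testing. -/
theorem integral_mul_map {μ : Measure (Pt m n)} (l : ℂ →L[ℝ] ℝ) {φ : Pt m n → ℝ} {g : Pt m n → ℂ}
    (hφ : MemLp φ 2 μ) (hg : MemLp g 2 μ) : ∫ z, φ z * l (g z) ∂μ = l (∫ z, φ z • g z ∂μ) := by
  have hi : Integrable (fun z => φ z • g z) μ := memLp_one_iff_integrable.1 (hg.smul hφ)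
  rw [← l.integral_comp_comm hi]
  exact integral_congr_ae (Eventually.of_forall fun z => by
    simp only [map_smul, smul_eq_mul])

theorem IsTest.dv {φ : Pt m n → ℝ} (h : IsTest φ) (i : Fin m) : IsTest (dv φ i) :=
  h.fderiv_apply _

theorem IsTest.memLp_dY {φ : Pt m n → ℝ} (h : IsTest φ) (B₁ : Matrix (Fin n) (Fin m) ℝ)
    (B₂ : Matrix (Fin n) (Fin n) ℝ) {μ : Measure (Pt m n)} [IsFiniteMeasureOnCompacts μ] :
    MemLp (dY B₁ B₂ φ) 2 μ := by
  have hc : Continuous (dY B₁ B₂ φ) :=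
    (h.1.continuous_fderiv (by simp)).clm_apply (continuous_const.prodMk
      ((drift B₁ B₂).continuous.comp continuous_snd))
  refine hc.memLp_of_hasCompactSupport (h.2.fderiv (𝕜 := ℝ) |>.mono fun z hz h0 => hz ?_)
  rw [Ultraparabolic.dY, h0, zero_apply]

/-- The real and imaginary parts of a weak solution are real solutions. -/
theorem IsWeakSolution.exists_isRealSolution
    {A : ℝ × EuclideanSpace ℝ (Fin m) → Matrix (Fin m) (Fin m) ℝ}
    {c : ℝ × EuclideanSpace ℝ (Fin m) → ℝ}
    {d : ℝ × EuclideanSpace ℝ (Fin m) → EuclideanSpace ℝ (Fin m)}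
    {B₁ : Matrix (Fin n) (Fin m) ℝ} {B₂ : Matrix (Fin n) (Fin n) ℝ} {u : Pt m n → ℂ}
    (h : IsWeakSolution T B₁ B₂ A c d u)
    {a : Fin m → Fin m → Pt m n → ℝ} {c' : Pt m n → ℝ} {d' : Fin m → Pt m n → ℝ}
    (hab : ∀ i j, BddMeas (a i j)) (hcb : BddMeas c') (hdb : ∀ i, BddMeas (d' i))
    (ha : ∀ i j (z : Pt m n), z.1 ∈ Ioo 0 T → a i j z = A (z.1, z.2.1) i j)
    (hc : ∀ᵐ z ∂(volume.restrict (slab m n T : Set (Pt m n))), c' z = c (z.1, z.2.1) + B₂.trace)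
    (hd : ∀ i, ∀ᵐ z ∂(volume.restrict (slab m n T : Set (Pt m n))), d' i z = d (z.1, z.2.1) i)
    (l : ℂ →L[ℝ] ℝ) (hl : ∀ x, |l x| ≤ ‖x‖) :
    ∃ (f : Pt m n → ℝ) (G : Fin m → Pt m n → ℝ),
      IsRealSolution T B₁ B₂ a c' d' (fun z => l (u z)) f G := by
  obtain ⟨G, f, hG, hf, hGw, hfw, heq⟩ := h.equation
  have hu := h.memLp
  set μ : Measure (Pt m n) := volume.restrict (slab m n T : Set (Pt m n)) with hμ
  have hGi : ∀ i, MemLp (fun z => G z i) 2 μ := fun i =>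
    (EuclideanSpace.proj i : EuclideanSpace ℂ (Fin m) →L[ℂ] ℂ).comp_memLp' hG
  refine ⟨fun z => l (f z) + B₂.trace * l (u z), fun i z => l (G z i), ?_⟩
  constructor
  · exact l.comp_memLp' hu
  · exact (l.comp_memLp' hf).add ((l.comp_memLp' hu).const_mul _)
  · exact fun i => l.comp_memLp' (hGi i)
  -- testing `Y u + (tr B₂) u` against `φ` is testing `u` against `-Y φ`
  · intro φ hφ hs
    have h1 := congrArg l (hfw ⟨φ, hφ.1, hφ.2, hs⟩)
    have hφ2 : MemLp φ 2 μ := hφ.memLp.restrict _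
    have hY : MemLp (dY B₁ B₂ φ) 2 μ := hφ.memLp_dY B₁ B₂
    rw [map_neg] at h1
    have h2 := integral_mul_map l (hY.add (hφ2.const_mul B₂.trace)) hu
    have h3 := integral_mul_map l hφ2 hf
    have i1 : Integrable (fun z => dY B₁ B₂ φ z * l (u z)) μ := hY.integrable_mul (l.comp_memLp' hu)
    have i2 : Integrable (fun z => φ z * l (u z)) μ := hφ2.integrable_mul (l.comp_memLp' hu)
    have i3 : Integrable (fun z => φ z * l (f z)) μ := hφ2.integrable_mul (l.comp_memLp' hf)
    have h4 : ∫ z, (dY B₁ B₂ φ z + B₂.trace * φ z) * l (u z) ∂μ =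
        -∫ z, φ z * l (f z) ∂μ := by
      rw [h3]
      exact h2.trans h1
    have h5 : ∫ z, (dY B₁ B₂ φ z + B₂.trace * φ z) * l (u z) ∂μ =
        ∫ z, dY B₁ B₂ φ z * l (u z) ∂μ + B₂.trace * ∫ z, φ z * l (u z) ∂μ := by
      rw [← integral_const_mul, ← integral_add i1 (i2.const_mul _)]
      exact integral_congr_ae (Eventually.of_forall fun z => by ring)
    have h6 : ∫ z, φ z * (l (f z) + B₂.trace * l (u z)) ∂μ =
        ∫ z, φ z * l (f z) ∂μ + B₂.trace * ∫ z, φ z * l (u z) ∂μ := by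
      rw [← integral_const_mul, ← integral_add i3 (i2.const_mul _)]
      exact integral_congr_ae (Eventually.of_forall fun z => by ring)
    rw [h6]
    linarith
  · intro φ hφ hs i
    have h1 := congrArg l (hGw ⟨φ, hφ.1, hφ.2, hs⟩ i)
    have hφ2 : MemLp φ 2 μ := hφ.memLp.restrict _
    have hv : MemLp (dv φ i) 2 μ := (hφ.dv i).memLp.restrict _
    rw [map_neg] at h1
    rw [integral_mul_map l hv hu, integral_mul_map l hφ2 (hGi i)]
    exact h1
  · intro φ hφ hs
    have h1 := congrArg l (heq ⟨φ, hφ.1, hφ.2, hs⟩)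
    have hφ2 : MemLp φ 2 μ := hφ.memLp.restrict _
    have hav : ∀ i j, MemLp (fun z => a i j z * dv φ i z) 2 μ := fun i j =>
      (hab i j).memLp_mul ((hφ.dv i).memLp.restrict _)
    have hφf : Integrable (fun z => φ z • f z) μ := memLp_one_iff_integrable.1 (hf.smul hφ2)
    have hφG : ∀ i j, Integrable (fun z => (a i j z * dv φ i z) • G z j) μ := fun i j =>
      memLp_one_iff_integrable.1 ((hGi j).smul (hav i j))
    have hL : ∫ z, (φ z • f z - ∑ i, ∑ j, (A (z.1, z.2.1) i j * dv φ i z) • G z j) ∂μ =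
        ∫ z, φ z • f z ∂μ - ∑ i, ∑ j, ∫ z, (a i j z * dv φ i z) • G z j ∂μ := by
      rw [← Finset.sum_congr rfl fun i _ => integral_finsetSum _ fun j _ => hφG i j,
        ← integral_finsetSum _ fun i _ => integrable_finsetSum _ fun j _ => hφG i j,
        ← integral_sub hφf (integrable_finsetSum _ fun i _ => integrable_finsetSum _ fun j _ => hφG i j)]
      refine integral_congr_ae ((ae_restrict_iff' measurableSet_slab).2
        (Eventually.of_forall fun z hz => ?_))
      simp only [ha _ _ z (mem_slab.1 hz)]
    have hcu : MemLp (fun z => (c' z - B₂.trace) • u z) 2 μ := by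
      have : BddMeas fun z => c' z - B₂.trace := by
        obtain ⟨C, hC⟩ := hcb.2
        exact ⟨hcb.1.sub_const _, C + |B₂.trace|, fun z =>
          (abs_sub _ _).trans (add_le_add (hC z) le_rfl)⟩
      obtain ⟨C, hC⟩ := this.2
      refine hu.of_le_mul (c := C) (this.1.aestronglyMeasurable.smul hu.1)
        (Eventually.of_forall fun z => ?_)
      rw [norm_smul]
      exact mul_le_mul_of_nonneg_right (hC z) (norm_nonneg _)
    have hdG : ∀ i, MemLp (fun z => d' i z • G z i) 2 μ := fun i => by
      obtain ⟨C, hC⟩ := (hdb i).2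
      refine (hGi i).of_le_mul (c := C) ((hdb i).1.aestronglyMeasurable.smul (hGi i).1)
        (Eventually.of_forall fun z => ?_)
      rw [norm_smul]
      exact mul_le_mul_of_nonneg_right (hC z) (norm_nonneg _)
    have hR : ∫ z, φ z • (c (z.1, z.2.1) • u z + ∑ i, d (z.1, z.2.1) i • G z i) ∂μ =
        ∫ z, φ z • ((c' z - B₂.trace) • u z + ∑ i, d' i z • G z i) ∂μ := by
      refine integral_congr_ae ?_
      filter_upwards [hc, ae_all_iff.2 hd] with z h2 h3
      simp only [h2, h3, add_sub_cancel_right]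
    have hR2 : MemLp (fun z => (c' z - B₂.trace) • u z + ∑ i, d' i z • G z i) 2 μ :=
      hcu.add (memLp_finsetSum _ fun i _ => hdG i)
    have h2 : l (∫ z, φ z • f z ∂μ - ∑ i, ∑ j, ∫ z, (a i j z * dv φ i z) • G z j ∂μ) =
        l (∫ z, φ z • ((c' z - B₂.trace) • u z + ∑ i, d' i z • G z i) ∂μ) := by
      rw [← hL, ← hR]
      exact h1
    rw [← integral_mul_map l hφ2 hR2, map_sub, ← integral_mul_map l hφ2 hf, map_sum] at h2
    simp only [map_sum] at h2
    simp only [← integral_mul_map l (hav _ _) (hGi _)] at h2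
    have j1 : Integrable (fun z => φ z * l ((c' z - B₂.trace) • u z + ∑ i, d' i z • G z i)) μ :=
      hφ2.integrable_mul (l.comp_memLp' hR2)
    have j2 : Integrable (fun z => φ z * l (f z)) μ := hφ2.integrable_mul (l.comp_memLp' hf)
    have h3 : ∫ z, φ z * (c' z * l (u z) + ∑ i, d' i z * l (G z i) -
        (l (f z) + B₂.trace * l (u z))) ∂μ =
        ∫ z, φ z * l ((c' z - B₂.trace) • u z + ∑ i, d' i z • G z i) ∂μ -
          ∫ z, φ z * l (f z) ∂μ := by
      rw [← integral_sub j1 j2]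
      refine integral_congr_ae (Eventually.of_forall fun z => ?_)
      simp only [map_add, map_sum, map_smul, smul_eq_mul]
      ring
    rw [h3]
    linarith
  · intro ε hε
    obtain ⟨δ, hδ, h1⟩ := h.trace_zero ε hε
    refine ⟨δ, hδ, h1.mono fun t ht => (eLpNorm_mono fun y => ?_).trans ht⟩
    exact hl _

end RealPart

/-! ### Conclusion -/

section Conclusion

variable {m n : ℕ} {T lam : ℝ}

/-- Uniqueness for real solutions. -/
theorem IsRealSolution.ae_eq_zero {B₁ : Matrix (Fin n) (Fin m) ℝ} {B₂ : Matrix (Fin n) (Fin n) ℝ}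
    {a : Fin m → Fin m → Pt m n → ℝ} {q : Fin m → Fin n → Pt m n → ℝ} {c : Pt m n → ℝ}
    {d : Fin m → Pt m n → ℝ} {u f : Pt m n → ℝ} {G : Fin m → Pt m n → ℝ}
    (h : IsRealSolution T B₁ B₂ a c d u f G) (hlam : 0 < lam) (hc : FlatCoeff lam T a q c d)
    (hq : ∀ i k (z : Pt m n), z.1 ∈ Ioo 0 T →
      q i k z = (flow (drift B₁ B₂) (-z.1) (EuclideanSpace.single i 1, 0)).2 k)
    {t₁ t₂ : ℝ} (h12 : t₁ < t₂) (h2 : t₂ < T) :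
    ∀ᵐ z ∂(volume.restrict (Ioo 0 t₁ ×ˢ univ : Set (Pt m n))), u z = 0 := by
  have h3 := (h.isFlatSolution h2 hc hq).mulL_cut_eq_zero hlam hc h12
  refine ae_eq_zero_of_pull (drift B₁ B₂) (h12.le.trans h2.le) ?_
  have hb : BddMeas (cut T ((Iio t₁).indicator fun _ => 1) : Pt m n → ℝ) :=
    bddMeas_cut (measurable_const.indicator measurableSet_Iio) zero_le_one fun t _ => by
      by_cases ht : t ∈ Iio t₁
      · rw [indicator_of_mem ht, abs_one]
      · rw [indicator_of_notMem ht, abs_zero]; exact zero_le_one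
  have h4 := coeFn_mulL hb (toL2 volume (pull (drift B₁ B₂) T u))
  rw [h3] at h4
  filter_upwards [h4, coeFn_toL2 (memLp_pull (drift B₁ B₂) h.memLp_u),
    Lp.coeFn_zero ℝ 2 (volume : Measure (Pt m n))] with z e1 e2 e3 hz
  by_cases hzT : z.1 ∈ Ioo 0 T
  · rw [e3, e2, cut, indicator_of_mem hzT, indicator_of_mem (mem_Iio.2 hz), one_mul] at e1
    exact e1.symm
  · exact pull_apply_of_notMem _ hzT

end Conclusion

end Ultraparabolic

theorem proposition4p2 (m n : ℕ) (hm : 1 ≤ m) (hn : 1 ≤ n) (lam : ℝ) (hlam : 1 < lam)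
    (B₁ : Matrix (Fin n) (Fin m) ℝ) (B₂ : Matrix (Fin n) (Fin n) ℝ)
    (hB : Ultraparabolic.KalmanRankCondition B₁ B₂) :
    ∃ c₀ : ℝ, 0 < c₀ ∧ c₀ < 1 ∧
      ∀ (T : ℝ), 0 < T →
      ∀ (A : ℝ × EuclideanSpace ℝ (Fin m) → Matrix (Fin m) (Fin m) ℝ)
        (c : ℝ × EuclideanSpace ℝ (Fin m) → ℝ)
        (d : ℝ × EuclideanSpace ℝ (Fin m) → EuclideanSpace ℝ (Fin m))
        (u : Ultraparabolic.Pt m n → ℂ),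
        Ultraparabolic.CoeffHyp lam T A c d →
        Ultraparabolic.IsWeakSolution T B₁ B₂ A c d u →
        ∀ t₁ t₂ : ℝ, 0 < t₁ → t₁ < t₂ → t₂ < min (c₀ * (lam ^ 2)⁻¹) T →
          ∀ᵐ z ∂(volume.restrict
              (Ioo 0 t₁ ×ˢ univ : Set (Ultraparabolic.Pt m n))), u z = 0 := by
  -- the weight `exp ((s / γ) exp (-γ t))` reaches every `t₂ < T`, so any value in `(0, 1)` will do
  refine ⟨1 / 2, by norm_num, by norm_num, fun T hT A c d u hco hu t₁ t₂ _ h12 h2 => ?_⟩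
  have h2T : t₂ < T := h2.trans_le (min_le_right _ _)
  have hlam0 : 0 < lam := one_pos.trans hlam
  obtain ⟨a, q, c', d', hfl, hq, ha, hc, hd⟩ := hco.exists_flatCoeff hT hm hlam B₁ B₂ B₂.trace
  have key : ∀ l : ℂ →L[ℝ] ℝ, (∀ x, |l x| ≤ ‖x‖) → ∀ᵐ z ∂(volume.restrict
      (Ioo 0 t₁ ×ˢ univ : Set (Ultraparabolic.Pt m n))), l (u z) = 0 := fun l hl => by
    obtain ⟨f, G, h⟩ := hu.exists_isRealSolution hfl.bddMeas_a hfl.bddMeas_c hfl.bddMeas_d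
      ha hc hd l hl
    exact h.ae_eq_zero hlam0 hfl hq h12 h2T
  filter_upwards [key Complex.reCLM Complex.abs_re_le_norm,
    key Complex.imCLM Complex.abs_im_le_norm] with z h1 h3
  exact Complex.ext h1 h3
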